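/- **Setting.** Let $D\ge 1$ and let $X=(x_1,\dots,x_n)$ be i.i.d. with a continuous bounded density $f$ with respect to Lebesgue measure on $\mathbb{R}^D$. For $t>0$ let $\mathcal{C}_t$ be the family of connected components of $\{x: f(x)\ge t\}$, and for a set $C$ let $C^{\oplus r}=\{x : d(x,C)\le r\}$. Fix constants $\beta,\check C_\beta,\hat C_\beta,r_s,r_c,\lambda_0,F>0$. Assume $f\le F$, $\lambda>\lambda_0$, and that for each $C\in\mathcal{C}_\lambda$ there is $A_C\in\mathcal{C}_{\lambda_0}$ such that * $A_C$ meets no other member of $\mathcal{C}_\lambda$, and there is a set $S_C$ that meets every path from $A_C$ to $\{f\ge\lambda_0\}\setminus A_C$ and satisfies $\sup_{S_C+B(0,r_s)}f<\inf_{\{f\ge\lambda_0\}}f$; * $C^{\oplus r_c}\subseteq A_C$; * $\check C_\beta\, d(x,C)^\beta\le\lambda-f(x)\le\hat C_\beta\, d(x,C)^\beta$ for all $x\in C^{\oplus r_c}\setminus C$. Put $\gamma(f)=\lambda-\sup\{f(x): x\notin\bigcup_{C\in\mathcal{C}_\lambda}C^{\oplus r_c}\}$. **Procedure.** DBSCAN(minPts,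 $\varepsilon$) calls a sample point a core-point if at least minPts sample points lie within distance $\varepsilon$ of it; sample points within $\varepsilon$ of a core-point are directly reachable from it; the clusters are the sets of points reachable from a core-point through chains of direct reachability. For $C_0>0$ and $0<\delta<1$ let $C_{\delta,n}=C_0\log(2/\delta)\sqrt{D\log n}$, let $v_D$ be the volume of the unit ball, and set $$\varepsilon=\Big(\frac{k}{n\,v_D(\lambda-\lambda C_{\delta,n}^2/\sqrt k)}\Big)^{1/D},\qquad \tilde\varepsilon=\Big(\frac{k}{n\,v_D(\lambda-\lambda C_{\delta,n}^2/\sqrt[3]{k})}\Big)^{1/D}.$$ Let $\widehat{\mathcal{C}}_\lambda$ and $\widehat{\mathcal{D}}_\lambda$ be the clusters of DBSCAN($k,\varepsilon$) and DBSCAN($k,\tilde\varepsilon$), and let $\widetilde{\mathcal{C}}_\lambda$ be obtained from $\widehat{\mathcal{C}}_\lambda$ by merging the clusters that are subsets of the same cluster of $\widehat{\mathcal{D}}_\lambda$. **Theorem.** There is a universal constant $C_0>0$ such that the following holds for all $D\ge1$, $0<\delta<1$ and all values of the constants above. 1. (Hausdorff error) There are $K_l,K_u>0$, depending only on $D,\delta,\beta,\check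 C_\beta,\hat C_\beta,r_s,r_c,\lambda_0,F$, such that for all $\lambda$ and $f$ as above, all $n\ge2$ and all $k$ with $$K_l(\log n)^2\le k\le K_u(\log n)^{2D/(2\beta+D)}\,n^{2\beta/(2\beta+D)},$$ with probability at least $1-\delta$: for each $C\in\mathcal{C}_\lambda$ there is $\widehat C\in\widehat{\mathcal{C}}_\lambda$ with $$d_{\rm Haus}(C,\widehat C)\le 2\,(4\lambda/\check C_\beta)^{1/\beta}\,C_{\delta,n}^{2/\beta}\,k^{-1/(2\beta)}.$$ 2. (Removal of false clusters) For every $\gamma>0$ there are $K_l,K_u>0$, depending only on these constants and $\gamma$, such that for all $\lambda$ and $f$ as above with $\gamma(f)\ge\gamma$, all $n\ge2$ and all $k$ with $$K_l(\log n)^3\le k\le K_u(\log n)^{2D/(2\beta+D)}\,n^{2\beta/(2\beta+D)},$$ with probability at least $1-\delta$: for each $\widehat C\in\widetilde{\mathcal{C}}_\lambda$ there is $C\in\mathcal{C}_\lambda$ satisfying the same bound. Moreover $\gamma(f)>0$ whenever $f(x)\to0$ as $|x|\to\infty$. 3. (Rate) For all $a_1,a_2>0$ there are $N$ and $R$, depending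 only on $a_1,a_2$ and the constants in 1 (in 2, respectively), such that for all $n\ge N$ and all $k$ with $a_1n^{2\beta/(2\beta+D)}\le k\le a_2n^{2\beta/(2\beta+D)}$, the conclusions of 1 and of 2 each hold with the bound $R\,(\log n)^{1/\beta}\,n^{-1/(2\beta+D)}=\widetilde O(n^{-1/(2\beta+D)})$. 4. (Optimality up to logarithms) For all $D\ge1$ and $\beta,\lambda>0$ there are values of the remaining constants $\check C_\beta,\hat C_\beta,r_s,r_c,\lambda_0,F$ and $\gamma,c>0$ such that for every $n\ge1$ and every set-valued estimator $T$ of the sample there is an $f$ as above with $\gamma(f)\ge\gamma$ and $\mathcal{C}_\lambda=\{C\}$ for a single $C$, for which $d_{\rm Haus}(C,T(X))>c\,n^{-1/(2\beta+D)}$ with probability at least $1/4$. -/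

import Mathlib

open MeasureTheory Filter Topology
open scoped ENNReal Pointwise

namespace LevelSetDBSCAN

/-! ### DBSCAN -/

section DBSCAN

variable {α : Type*} [PseudoMetricSpace α] {n : ℕ}

/-- Core-points: sample points having at least `m` sample points within distance `ε`
(sample points are counted with multiplicity). -/
def corePoints (X : Fin n → α) (m : ℕ) (ε : ℝ) : Set α :=
  {p | p ∈ Set.range X ∧ m ≤ {i : Fin n | dist (X i) p ≤ ε}.ncard}

/-- `q` is directly reachable from `p`: `p` is a core-point and `q` is a sample point in its
`ε`-neighborhood. -/
def DirectlyReachable (X : Fin n → α) (m : ℕ) (ε : ℝ) (q p : α) : Prop :=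
  p ∈ corePoints X m ε ∧ q ∈ Set.range X ∧ dist q p ≤ ε

/-- `q` is reachable from `p`: there is a path from `q` to `p` in which each point is directly
reachable from the next one. -/
def Reachable (X : Fin n → α) (m : ℕ) (ε : ℝ) (q p : α) : Prop :=
  Relation.ReflTransGen (DirectlyReachable X m ε) q p

/-- The clusters returned by DBSCAN(minPts, `ε`) on the sample `X`: for each core-point, the set
of points reachable from it. -/
def dbscan (X : Fin n → α) (minPts : ℕ) (ε : ℝ) : Set (Set α) :=
  {K | ∃ p ∈ corePoints X minPts ε, K = {q | Reachable X minPts ε q p}}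

/-- Merge the clusters of `𝒞` that are subsets of the same cluster of `𝒟`. -/
def mergeClusters (𝒞 𝒟 : Set (Set α)) : Set (Set α) :=
  {E | ∃ W ∈ 𝒟, (∃ K ∈ 𝒞, K ⊆ W) ∧ E = ⋃₀ {K | K ∈ 𝒞 ∧ K ⊆ W}}

end DBSCAN

noncomputable section

/-- Euclidean space `ℝ^D`. -/
abbrev Euc (D : ℕ) : Type := EuclideanSpace ℝ (Fin D)

/-! ### Level sets and the separation conditions -/

section Conditions

variable {D : ℕ}

/-- The upper level set `{x : f x ≥ t}`. -/
def levelSet (f : Euc D → ℝ) (t : ℝ) : Set (Euc D) := {x | t ≤ f x}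

/-- The family of connected components of `{x : f x ≥ t}`. -/
def levelComponents (f : Euc D → ℝ) (t : ℝ) : Set (Set (Euc D)) :=
  {C | ∃ x ∈ levelSet f t, C = connectedComponentIn (levelSet f t) x}

/-- `A` and `A'` are `r`-separated by `S`: every path from `A` to `A'` meets `S`, and
`sup_{S + B(0, r)} f < inf_{A ∪ A'} f` (supremum and infimum in the extended reals). -/
def SeparatedBy (f : Euc D → ℝ) (r : ℝ) (A A' S : Set (Euc D)) : Prop :=
  (∀ x ∈ A, ∀ y ∈ A', ∀ p : Path x y, ∃ t, p t ∈ S) ∧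
    (⨆ x ∈ S + Metric.ball (0 : Euc D) r, (f x : EReal)) < ⨅ x ∈ A ∪ A', (f x : EReal)

/-- The constants of the regularity and separation conditions; `fmax` bounds `‖f‖_∞`. -/
structure Params where
  (beta cLow cUp rs rc lam0 fmax : ℝ)
  beta_pos : 0 < beta
  cLow_pos : 0 < cLow
  cUp_pos : 0 < cUp
  rs_pos : 0 < rs
  rc_pos : 0 < rc
  lam0_pos : 0 < lam0
  fmax_pos : 0 < fmax

/-- `f` is a continuous bounded probability density with respect to Lebesgue measure on `ℝ^D`
satisfying the separation conditions at level `lam` with the constants `P`. -/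
structure Admissible (P : Params) (lam : ℝ) (f : Euc D → ℝ) : Prop where
  continuous : Continuous f
  nonneg : ∀ x, 0 ≤ f x
  le_fmax : ∀ x, f x ≤ P.fmax
  lintegral_eq_one : ∫⁻ x, ENNReal.ofReal (f x) = 1
  lam0_lt : P.lam0 < lam
  separation : ∀ C ∈ levelComponents f lam, ∃ A ∈ levelComponents f P.lam0,
    (∀ C' ∈ levelComponents f lam, C' ≠ C → Disjoint A C') ∧
    (∃ S, SeparatedBy f P.rs A (levelSet f P.lam0 \ A) S) ∧
    Metric.cthickening P.rc C ⊆ A ∧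
    ∀ x ∈ Metric.cthickening P.rc C \ C,
      P.cLow * Metric.infDist x C ^ P.beta ≤ lam - f x ∧
        lam - f x ≤ P.cUp * Metric.infDist x C ^ P.beta

/-- `γ = lam - sup f` over the points at distance more than `rc` from every connected component
of `{f ≥ lam}`. -/
def gap (f : Euc D → ℝ) (lam rc : ℝ) : ℝ :=
  lam - sSup (f '' (⋃ C ∈ levelComponents f lam, Metric.cthickening rc C)ᶜ)

/-- The law of `n` i.i.d. draws from the density `f` with respect to Lebesgue measure. -/
def sampleLaw (f : Euc D → ℝ) (n : ℕ) : Measure (Fin n → Euc D) :=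
  Measure.pi fun _ => (volume : Measure (Euc D)).withDensity fun x => ENNReal.ofReal (f x)

end Conditions

/-! ### Parameter settings -/

/-- The volume `v_D` of the unit ball of `ℝ^D`. -/
def unitBallVol (D : ℕ) : ℝ := (volume (Metric.ball (0 : Euc D) 1)).toReal

/-- `C_{δ,n} = C₀ log(2/δ) √(D log n)`. -/
def confConst (C₀ δ : ℝ) (D n : ℕ) : ℝ :=
  C₀ * Real.log (2 / δ) * Real.sqrt (D * Real.log n)

/-- `ε = (k / (n v_D (λ - λ C_{δ,n}² / √k)))^{1/D}`. -/
def eps (C₀ δ lam : ℝ) (D n k : ℕ) : ℝ :=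
  ((k : ℝ) / (n * unitBallVol D * (lam - lam * confConst C₀ δ D n ^ 2 / Real.sqrt k)))
    ^ (1 / (D : ℝ))

/-- `ε̃ = (k / (n v_D (λ - λ C_{δ,n}² / k^{1/3})))^{1/D}`. -/
def epsTilde (C₀ δ lam : ℝ) (D n k : ℕ) : ℝ :=
  ((k : ℝ) / (n * unitBallVol D * (lam - lam * confConst C₀ δ D n ^ 2 / (k : ℝ) ^ (1 / 3 : ℝ))))
    ^ (1 / (D : ℝ))

/-- The estimated clusters `Ĉ_λ`: the output of DBSCAN(k, `ε`). -/
def estClusters (C₀ δ lam : ℝ) {D n : ℕ} (k : ℕ) (X : Fin n → Euc D) : Set (Set (Euc D)) :=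
  dbscan X k (eps C₀ δ lam D n k)

/-- The pruned clusters `C̃_λ`: clusters of DBSCAN(k, `ε`) merged along those of
DBSCAN(k, `ε̃`). -/
def prunedClusters (C₀ δ lam : ℝ) {D n : ℕ} (k : ℕ) (X : Fin n → Euc D) : Set (Set (Euc D)) :=
  mergeClusters (dbscan X k (eps C₀ δ lam D n k)) (dbscan X k (epsTilde C₀ δ lam D n k))

/-- `K_l (log n)^a ≤ k ≤ K_u (log n)^{2D/(2β+D)} n^{2β/(2β+D)}`. -/
def InRange (Kl Ku β : ℝ) (a D n k : ℕ) : Prop :=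
  Kl * Real.log n ^ a ≤ k ∧
    (k : ℝ) ≤ Ku * Real.log n ^ (2 * D / (2 * β + D)) * (n : ℝ) ^ (2 * β / (2 * β + D))

/-- The Hausdorff error bound `2 (4λ/Č_β)^{1/β} C_{δ,n}^{2/β} k^{-1/(2β)}`. -/
def errBound (C₀ δ lam : ℝ) (P : Params) (D n k : ℕ) : ℝ :=
  2 * (4 * lam / P.cLow) ^ (1 / P.beta) * confConst C₀ δ D n ^ (2 / P.beta) *
    (k : ℝ) ^ (-(1 / (2 * P.beta)))

/-- Every true cluster has an estimate within Hausdorff distance `ρ`. -/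
def AllRecovered {D : ℕ} (true_ est : Set (Set (Euc D))) (ρ : ℝ) : Prop :=
  ∀ C ∈ true_, ∃ K ∈ est, Metric.hausdorffEDist C K ≤ ENNReal.ofReal ρ

/-- Every estimate is within Hausdorff distance `ρ` of a true cluster. -/
def NoFalseCluster {D : ℕ} (true_ est : Set (Set (Euc D))) (ρ : ℝ) : Prop :=
  ∀ K ∈ est, ∃ C ∈ true_, Metric.hausdorffEDist C K ≤ ENNReal.ofReal ρ

end

end LevelSetDBSCAN

/-! Upper bounds. Put η = C_{δ,n}²/√k. The radius ε is the one at which a ball with density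
constantly λ(1-η) has mass k/n, and kη² = C_{δ,n}⁴ exceeds log n by a large factor, so Chernoff
bounds resolve relative density errors of order η. On a good sample (`GoodSample`), a sample point
with f ≥ λ(1-η/2) on its ε-ball is a core-point, every core-point has a point with f ≥ λ(1-2η)
within ε, and the sample is ε/3-dense near {f ≥ λ}. The upper limit on k amounts to ε^β ≲ η, so f
drops by less than λη/2 within a few ε of a component C. Hence the sample points near C are
core-points, and connectedness of C chains them into one cluster (`GoodSample.reachable_of_near`).
Conversely the lower growth bound puts a core-point in the r_c-collar of C within s + ε of C, where
s = (2λη/Č)^{1/β} ≥ 2ε. As s is far below r_c, steps of length ε cannot cross the collar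
(`GoodSample.near_of_reachable`). The error is s + 2ε ≤ 2s.

Pruning. When η is small against γ, every core-point lies near some C, but C may carry several
clusters: points at distance about s from C need not be linked at radius ε. The second run has slack
η' = C_{δ,n}²/k^{1/3} ≫ η, so f drops by less than λη'/2 up to a fixed multiple of s, and all sample
points within s + 2ε of C become one cluster. That cluster still stays in the collar of C, so
merging joins exactly the pieces belonging to one component.

Good samples are likely (`measure_not_goodSample_le`): for the counts, condition on the centre and
take a union bound over the n sample points; for the covering, use a finite net whose size is
bounded by mass.

Lower bound. Le Cam's method compares two densities λ - κq^β near the origin, with q = |x| or a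
perturbation of it inside |x| ≤ 2s (s is now the distance between the peaks) whose zero sits at
distance s from the origin. Both have a one-point level set. Their χ²-distance is of order s^{2β+D},
so with s of order n^{-1/(2β+D)} the n-fold laws stay close, and no estimator can be within s/3 of
both points with high probability. -/

namespace LevelSetDBSCAN

/-! ### Reachability in DBSCAN -/

section DBSCANLemmas

variable {α : Type*} [PseudoMetricSpace α] {n : ℕ} {X : Fin n → α} {m : ℕ} {ε : ℝ}

/-- Reachability is symmetric on core-points. -/
lemma Reachable.symm {p q : α} (h : Reachable X m ε q p) (hq : q ∈ corePoints X m ε) :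
    Reachable X m ε p q := by
  induction h using Relation.ReflTransGen.head_induction_on with
  | refl => exact .refl
  | head h' _ ih => exact (ih h'.1).tail ⟨hq, h'.1.1, by rw [dist_comm]; exact h'.2.2⟩

/-- A reachable point is a sample point. -/
lemma Reachable.mem_range {p q : α} (h : Reachable X m ε q p) (hp : p ∈ Set.range X) :
    q ∈ Set.range X := by
  induction h using Relation.ReflTransGen.head_induction_on with
  | refl => exact hp
  | head h' _ _ => exact h'.2.1

/-- This makes the two runs comparable: with the same threshold `m`, a core-point of the first run
is one of the second, where the radius is larger. -/
lemma corePoints_mono {ε' : ℝ} (h : ε ≤ ε') : corePoints X m ε ⊆ corePoints X m ε' := by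
  rintro p ⟨hp, hm⟩
  exact ⟨hp, hm.trans (Set.ncard_le_ncard (fun i hi => le_trans hi h) (Set.toFinite _))⟩

end DBSCANLemmas

/-! ### Level sets and clusters on a good sample -/

section Geometry

variable {D : ℕ}

/-- `x` is within distance `r` of some point of `C`. -/
def Near (r : ℝ) (C : Set (Euc D)) (x : Euc D) : Prop := ∃ c ∈ C, dist x c ≤ r

lemma Near.mono {r r' : ℝ} {C : Set (Euc D)} {x : Euc D} (h : Near r C x) (hr : r ≤ r') :
    Near r' C x :=
  let ⟨c, hc, hd⟩ := h; ⟨c, hc, hd.trans hr⟩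

lemma Near.trans {r s : ℝ} {C : Set (Euc D)} {x y : Euc D} (h : Near r C x) (hs : dist y x ≤ s) :
    Near (r + s) C y := by
  obtain ⟨c, hc, hd⟩ := h
  exact ⟨c, hc, by linarith [dist_triangle y x c]⟩

lemma Near.mem_cthickening {r : ℝ} {C : Set (Euc D)} {x : Euc D} (h : Near r C x) :
    x ∈ Metric.cthickening r C :=
  let ⟨c, hc, hd⟩ := h; Metric.mem_cthickening_of_dist_le x c r C hc hd

lemma isClosed_levelSet {f : Euc D → ℝ} (hf : Continuous f) (t : ℝ) : IsClosed (levelSet f t) :=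
  isClosed_le continuous_const hf

lemma levelComponents_subset {f : Euc D → ℝ} {t : ℝ} {C : Set (Euc D)}
    (hC : C ∈ levelComponents f t) : C ⊆ levelSet f t := by
  obtain ⟨x, -, rfl⟩ := hC
  exact connectedComponentIn_subset _ _

lemma levelComponents_isConnected {f : Euc D → ℝ} {t : ℝ} {C : Set (Euc D)}
    (hC : C ∈ levelComponents f t) : IsConnected C := by
  obtain ⟨x, hx, rfl⟩ := hC
  exact isConnected_connectedComponentIn_iff.mpr hx

lemma levelComponents_isClosed {f : Euc D → ℝ} (hf : Continuous f) {t : ℝ} {C : Set (Euc D)}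
    (hC : C ∈ levelComponents f t) : IsClosed C := by
  obtain ⟨x, hx, rfl⟩ := hC
  rw [← closure_subset_iff_isClosed]
  refine isPreconnected_connectedComponentIn.closure.subset_connectedComponentIn
    (subset_closure (mem_connectedComponentIn hx)) ?_
  exact closure_minimal (connectedComponentIn_subset _ _) (isClosed_levelSet hf t)

lemma exists_levelComponent {f : Euc D → ℝ} {t : ℝ} {x : Euc D} (hx : x ∈ levelSet f t) :
    ∃ C ∈ levelComponents f t, x ∈ C :=
  ⟨_, ⟨x, hx, rfl⟩, mem_connectedComponentIn hx⟩

variable {P : Params} {lam : ℝ} {f : Euc D → ℝ}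

namespace Admissible

lemma lam_pos (h : Admissible P lam f) : 0 < lam := P.lam0_pos.trans h.lam0_lt

lemma lam_le_fmax (h : Admissible P lam f) {x : Euc D} (hx : x ∈ levelSet f lam) :
    lam ≤ P.fmax := le_trans hx (h.le_fmax x)

/-- Near the level set, `f` drops below `lam` at most like the `β`-th power of the distance. -/
lemma lower_bound (h : Admissible P lam f) {x c : Euc D} (hc : c ∈ levelSet f lam) {r : ℝ}
    (hr : r ≤ P.rc) (hd : dist x c ≤ r) : lam - P.cUp * r ^ P.beta ≤ f x := by
  obtain ⟨C, hC, hcC⟩ := exists_levelComponent hc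
  have hr0 : 0 ≤ r := dist_nonneg.trans hd
  by_cases hx : x ∈ C
  · have : lam ≤ f x := levelComponents_subset hC hx
    have := mul_nonneg P.cUp_pos.le (Real.rpow_nonneg hr0 P.beta)
    linarith
  · obtain ⟨A, -, -, -, -, H⟩ := h.separation C hC
    have hnear : Near P.rc C x := ⟨c, hcC, hd.trans hr⟩
    have h2 := (H x ⟨hnear.mem_cthickening, hx⟩).2
    have h3 : Metric.infDist x C ≤ r := (Metric.infDist_le_dist_of_mem hcC).trans hd
    have := mul_le_mul_of_nonneg_left
      (Real.rpow_le_rpow Metric.infDist_nonneg h3 P.beta_pos.le) P.cUp_pos.le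
    linarith

/-- A point near `C` at which `f` is almost `lam` is very close to `C`. -/
lemma near_of_le (h : Admissible P lam f) {C : Set (Euc D)} (hC : C ∈ levelComponents f lam)
    {x : Euc D} (hx : x ∈ Metric.cthickening P.rc C) {τ : ℝ} (hτ : 0 ≤ τ) (hf : lam - τ ≤ f x) :
    Near ((τ / P.cLow) ^ (1 / P.beta)) C x := by
  by_cases hxC : x ∈ C
  · refine ⟨x, hxC, ?_⟩
    rw [dist_self]
    exact Real.rpow_nonneg (div_nonneg hτ P.cLow_pos.le) _
  · obtain ⟨A, -, -, -, -, H⟩ := h.separation C hC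
    have h1 := (H x ⟨hx, hxC⟩).1
    obtain ⟨c, hc, hd⟩ := (levelComponents_isClosed h.continuous hC).exists_infDist_eq_dist
      (levelComponents_isConnected hC).nonempty x
    refine ⟨c, hc, ?_⟩
    rw [← hd]
    have h2 : Metric.infDist x C ^ P.beta ≤ τ / P.cLow := by
      rw [le_div_iff₀' P.cLow_pos]; linarith
    have h3 := Real.rpow_le_rpow (Real.rpow_nonneg Metric.infDist_nonneg _) h2
      (one_div_pos.mpr P.beta_pos).le
    rwa [← Real.rpow_mul Metric.infDist_nonneg, mul_one_div_cancel P.beta_pos.ne',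
      Real.rpow_one] at h3

/-- Off the components' neighbourhoods, `f` is below `lam` by at least the gap. -/
lemma mem_cthickening_of_gap (h : Admissible P lam f) {γ : ℝ} (hγ : γ ≤ gap f lam P.rc)
    {x : Euc D} (hx : lam - γ < f x) :
    ∃ C ∈ levelComponents f lam, x ∈ Metric.cthickening P.rc C := by
  by_contra hcon
  push Not at hcon
  have hmem : f x ∈ f '' (⋃ C ∈ levelComponents f lam, Metric.cthickening P.rc C)ᶜ := by
    refine ⟨x, ?_, rfl⟩
    simpa using hcon
  have hb : BddAbove (f '' (⋃ C ∈ levelComponents f lam, Metric.cthickening P.rc C)ᶜ) :=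
    ⟨P.fmax, by rintro _ ⟨y, -, rfl⟩; exact h.le_fmax y⟩
  have := le_csSup hb hmem
  unfold gap at hγ
  linarith

end Admissible

/-- The deterministic conclusions on the sample at scale `ε` with slack `η`. -/
structure GoodSample (f : Euc D → ℝ) (lam : ℝ) {n : ℕ} (X : Fin n → Euc D) (k : ℕ)
    (ε η ρ : ℝ) : Prop where
  core : ∀ i, (∀ y, dist y (X i) ≤ ε → lam * (1 - η / 2) ≤ f y) → X i ∈ corePoints X k ε
  noncore : ∀ x ∈ corePoints X k ε, ∃ y, dist y x ≤ ε ∧ lam * (1 - 2 * η) ≤ f y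
  cover : ∀ x c, c ∈ levelSet f lam → dist x c ≤ ρ → ∃ i, dist (X i) x ≤ ε / 3

variable {n k : ℕ} {X : Fin n → Euc D} {ε η ρ : ℝ} {C : Set (Euc D)}

namespace GoodSample

/-- The `ε`-ball about such a point stays within `ρ + 2ε` of `C`, where the upper growth bound costs
at most `lam * η / 2`, which is what `G.core` tolerates. -/
lemma core_of_near (G : GoodSample f lam X k ε η ρ) (h : Admissible P lam f)
    (hC : C ∈ levelComponents f lam) (h1 : P.cUp * (ρ + 2 * ε) ^ P.beta ≤ lam * η / 2)
    (h2 : ρ + 2 * ε ≤ P.rc) {i : Fin n} (hi : Near (ρ + ε) C (X i)) :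
    X i ∈ corePoints X k ε := by
  refine G.core i fun y hy => ?_
  obtain ⟨c, hc, hd⟩ := hi.trans hy
  have := h.lower_bound (levelComponents_subset hC hc) h2 (by linarith : dist y c ≤ ρ + 2 * ε)
  linarith

/-- All sample points near a component belong to one cluster. -/
lemma reachable_of_near (G : GoodSample f lam X k ε η ρ) (h : Admissible P lam f) (hε : 0 < ε)
    (hC : C ∈ levelComponents f lam) (h1 : P.cUp * (ρ + 2 * ε) ^ P.beta ≤ lam * η / 2)
    (h2 : ρ + 2 * ε ≤ P.rc) {i j : Fin n} (hi : Near ρ C (X i)) (hj : Near ρ C (X j)) :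
    Reachable X k ε (X i) (X j) := by
  have hS : ∀ x, x ∈ C + Metric.closedBall (0 : Euc D) ρ ↔ Near ρ C x := by
    intro x
    constructor
    · rintro ⟨c, hc, v, hv, rfl⟩
      exact ⟨c, hc, by simpa [dist_eq_norm] using hv⟩
    · rintro ⟨c, hc, hd⟩
      exact ⟨c, hc, x - c, by simpa [dist_eq_norm] using hd, by simp⟩
  have hpre : IsPreconnected (C + Metric.closedBall (0 : Euc D) ρ) := by
    rw [← Set.image2_add, ← Set.image_uncurry_prod]
    exact ((levelComponents_isConnected hC).isPreconnected.prod
      (convex_closedBall _ _).isPreconnected).image _ continuous_add.continuousOn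
  have hcore : ∀ x, Near ρ C x → ∀ p, dist (X p) x ≤ ε / 3 → X p ∈ corePoints X k ε := by
    intro x hx p hp
    exact G.core_of_near h hC h1 h2 ((hx.trans hp).mono (by linarith))
  -- Induction over the connected set `C + closedBall 0 ρ`. Nearby `x`, `y` have sample points at
  -- distance below `3 * (ε / 3)`, hence directly reachable; transitivity needs a sample point near
  -- the middle point, which `cover` supplies.
  have key := hpre.induction₂ (fun x y => ∀ p q : Fin n, dist (X p) x ≤ ε / 3 →
      dist (X q) y ≤ ε / 3 → Reachable X k ε (X p) (X q)) ?_ ?_ ?_ ((hS _).2 hi) ((hS _).2 hj)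
  · exact key i j (by rw [dist_self]; positivity) (by rw [dist_self]; positivity)
  · intro x hx
    have : ∀ᶠ y in 𝓝[C + Metric.closedBall (0 : Euc D) ρ] x, dist y x < ε / 3 :=
      mem_nhdsWithin_of_mem_nhds (Metric.ball_mem_nhds x (by linarith))
    filter_upwards [this, self_mem_nhdsWithin] with y hy hyS p q hp hq
    refine Relation.ReflTransGen.single ⟨hcore y ((hS _).1 hyS) q hq, ⟨p, rfl⟩, ?_⟩
    have e1 := dist_triangle4 (X p) x y (X q)
    rw [dist_comm] at hq
    rw [dist_comm y x] at hy
    linarith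
  · intro x y z _ hy _ hxy hyz p q hp hq
    obtain ⟨c, hc, hd⟩ := (hS _).1 hy
    obtain ⟨r, hr⟩ := G.cover y c (levelComponents_subset hC hc) hd
    exact (hxy p r hp hr).trans (hyz r q hr hq)
  · intro x y hx _ hxy p q hp hq
    exact (hxy q p hq hp).symm (hcore x ((hS _).1 hx) q hq)

/-- The core-points close to a component are very close to it. -/
lemma near_of_core (G : GoodSample f lam X k ε η ρ) (h : Admissible P lam f) (hη : 0 ≤ η)
    (hC : C ∈ levelComponents f lam) {R : ℝ} (hR : R + ε ≤ P.rc)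
    {p : Euc D} (hp : p ∈ corePoints X k ε) (hpR : Near R C p) :
    Near ((2 * lam * η / P.cLow) ^ (1 / P.beta) + ε) C p := by
  obtain ⟨y, hy, hfy⟩ := G.noncore p hp
  have h1 : Near P.rc C y := (hpR.trans hy).mono hR
  have h2 := h.near_of_le hC h1.mem_cthickening
    (τ := 2 * lam * η) (by have := h.lam_pos; positivity) (by linarith)
  exact h2.trans (by rwa [dist_comm])

/-- A cluster that starts near a component stays near it. -/
lemma near_of_reachable (G : GoodSample f lam X k ε η ρ) (h : Admissible P lam f) (hη : 0 ≤ η)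
    (hε : 0 < ε)
    (hC : C ∈ levelComponents f lam)
    (hloc : (2 * lam * η / P.cLow) ^ (1 / P.beta) + 3 * ε ≤ P.rc) {R : ℝ} (hR : R + ε ≤ P.rc)
    {p q : Euc D} (hp : p ∈ corePoints X k ε) (hpR : Near R C p) (hq : Reachable X k ε q p) :
    Near ((2 * lam * η / P.cLow) ^ (1 / P.beta) + 2 * ε) C q := by
  induction hq using Relation.ReflTransGen.head_induction_on with
  | refl => exact (G.near_of_core h hη hC hR hp hpR).mono (by linarith)
  | head h' _ ih =>
    -- The conclusion of `near_of_core` does not depend on `R`: a core-point within `s + 2ε` of `C`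
    -- is within `s + ε`, so a further step of length `ε` preserves the invariant.
    have := G.near_of_core h hη hC (R := (2 * lam * η / P.cLow) ^ (1 / P.beta) + 2 * ε)
      (by linarith) h'.1 ih
    exact (this.trans h'.2.2).mono (by linarith)

/-- Existence of a cluster within a small Hausdorff distance of a given component. -/
theorem recovered (G : GoodSample f lam X k ε η ε) (h : Admissible P lam f) (hη : 0 ≤ η)
    (hε : 0 < ε)
    (h1 : P.cUp * (3 * ε) ^ P.beta ≤ lam * η / 2)
    (hloc : (2 * lam * η / P.cLow) ^ (1 / P.beta) + 3 * ε ≤ P.rc)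
    (hC : C ∈ levelComponents f lam) :
    ∃ K ∈ dbscan X k ε,
      (∀ q ∈ K, Near ((2 * lam * η / P.cLow) ^ (1 / P.beta) + 2 * ε) C q) ∧
      (∀ i, Near ε C (X i) → X i ∈ K) ∧
      ∀ c ∈ C, ∃ i, X i ∈ K ∧ dist (X i) c ≤ ε := by
  have hρ0 : 0 ≤ (2 * lam * η / P.cLow) ^ (1 / P.beta) :=
    Real.rpow_nonneg (div_nonneg (by have := h.lam_pos; positivity) P.cLow_pos.le) _
  obtain ⟨c, hc⟩ := (levelComponents_isConnected hC).nonempty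
  have hex : ∀ c ∈ C, ∃ i, dist (X i) c ≤ ε / 3 := fun c hc =>
    G.cover c c (levelComponents_subset hC hc) (by simp [hε.le])
  obtain ⟨i, hi⟩ := hex c hc
  have h1' : P.cUp * (ε + 2 * ε) ^ P.beta ≤ lam * η / 2 := by
    rwa [show ε + 2 * ε = 3 * ε by ring]
  have hiN : Near ε C (X i) := ⟨c, hc, by linarith⟩
  have hcore : X i ∈ corePoints X k ε :=
    G.core_of_near h hC h1' (by linarith) (hiN.mono (by linarith))
  refine ⟨{q | Reachable X k ε q (X i)}, ⟨X i, hcore, rfl⟩, ?_, ?_, ?_⟩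
  · intro q hq
    exact G.near_of_reachable h hη hε hC hloc (R := ε) (by linarith) hcore hiN hq
  · intro j hj
    exact G.reachable_of_near h hε hC h1' (by linarith) hj hiN
  · intro c hc
    obtain ⟨j, hj⟩ := hex c hc
    exact ⟨j, G.reachable_of_near h hε hC h1' (by linarith) ⟨c, hc, by linarith⟩ hiN,
      by linarith⟩

end GoodSample

lemma hausdorffEDist_le_ofReal {A B : Set (Euc D)} {r : ℝ}
    (h1 : ∀ x ∈ A, ∃ y ∈ B, dist x y ≤ r) (h2 : ∀ x ∈ B, ∃ y ∈ A, dist x y ≤ r) :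
    Metric.hausdorffEDist A B ≤ ENNReal.ofReal r := by
  refine Metric.hausdorffEDist_le_of_mem_edist ?_ ?_
  · intro x hx
    obtain ⟨y, hy, hd⟩ := h1 x hx
    exact ⟨y, hy, by rw [edist_dist]; exact ENNReal.ofReal_le_ofReal hd⟩
  · intro x hx
    obtain ⟨y, hy, hd⟩ := h2 x hx
    exact ⟨y, hy, by rw [edist_dist]; exact ENNReal.ofReal_le_ofReal hd⟩

/-- Recovery of every component on a good sample. -/
theorem allRecovered_of_goodSample (h : Admissible P lam f) (hη : 0 ≤ η) (hε : 0 < ε)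
    (G : GoodSample f lam X k ε η ε)
    (h1 : lam ≤ P.fmax → P.cUp * (3 * ε) ^ P.beta ≤ lam * η / 2)
    (hloc : lam ≤ P.fmax → (2 * lam * η / P.cLow) ^ (1 / P.beta) + 3 * ε ≤ P.rc) {r : ℝ}
    (hr : (2 * lam * η / P.cLow) ^ (1 / P.beta) + 2 * ε ≤ r) :
    AllRecovered (levelComponents f lam) (dbscan X k ε) r := by
  intro C hC
  obtain ⟨c, hc⟩ := (levelComponents_isConnected hC).nonempty
  -- A component forces `lam ≤ fmax`. A level above `fmax` has none, so the smallness conditions are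
  -- assumed only below it.
  have hF := h.lam_le_fmax (levelComponents_subset hC hc)
  have hρ0 : 0 ≤ (2 * lam * η / P.cLow) ^ (1 / P.beta) :=
    Real.rpow_nonneg (div_nonneg (by have := h.lam_pos; positivity) P.cLow_pos.le) _
  obtain ⟨K, hK, hK1, -, hK3⟩ := G.recovered h hη hε (h1 hF) (hloc hF) hC
  refine ⟨K, hK, hausdorffEDist_le_ofReal ?_ ?_⟩
  · intro c hc
    obtain ⟨i, hi, hd⟩ := hK3 c hc
    exact ⟨X i, hi, by rw [dist_comm]; linarith⟩
  · intro q hq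
    exact (hK1 q hq).mono hr

/-- No false cluster survives the pruning on a sample that is good at both scales. -/
theorem noFalseCluster_of_goodSample (h : Admissible P lam f) {γ ε' η' ρ' : ℝ}
    (hγ : γ ≤ gap f lam P.rc) (hη : 0 ≤ η) (hη' : 0 ≤ η') (hε : 0 < ε) (hεε : ε ≤ ε')
    (hηγ : 4 * P.fmax * η < γ) (hη4 : η ≤ 1 / 4)
    (hρ' : ρ' = (2 * lam * η / P.cLow) ^ (1 / P.beta) + 2 * ε)
    (G : GoodSample f lam X k ε η ε) (G' : GoodSample f lam X k ε' η' ρ')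
    (h1 : lam ≤ P.fmax → P.cUp * (3 * ε) ^ P.beta ≤ lam * η / 2)
    (hloc : lam ≤ P.fmax → (2 * lam * η / P.cLow) ^ (1 / P.beta) + 3 * ε ≤ P.rc)
    (h1' : lam ≤ P.fmax → P.cUp * (ρ' + 2 * ε') ^ P.beta ≤ lam * η' / 2)
    (h2' : lam ≤ P.fmax → ρ' + 2 * ε' ≤ P.rc)
    (hloc' : lam ≤ P.fmax → (2 * lam * η' / P.cLow) ^ (1 / P.beta) + 3 * ε' ≤ P.rc) {r : ℝ}
    (hr : (2 * lam * η / P.cLow) ^ (1 / P.beta) + 2 * ε ≤ r) :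
    NoFalseCluster (levelComponents f lam) (mergeClusters (dbscan X k ε) (dbscan X k ε')) r := by
  rintro E ⟨W, ⟨w, hw, rfl⟩, ⟨_, ⟨p, hp, rfl⟩, hpW⟩, rfl⟩
  have hρ0 : 0 ≤ (2 * lam * η / P.cLow) ^ (1 / P.beta) :=
    Real.rpow_nonneg (div_nonneg (by have := h.lam_pos; positivity) P.cLow_pos.le) _
  have hε' : 0 < ε' := hε.trans_le hεε
  obtain ⟨y, hy, hfy⟩ := G.noncore p hp
  have hlam := h.lam_pos
  -- No component has been found yet, so `lam ≤ fmax` is not available; the value of `f` at `y`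
  -- gives this weaker bound, whence the factor 4 in `hηγ`.
  have hlam2 : lam ≤ 2 * P.fmax := by
    have e1 := h.le_fmax y
    have e2 : lam * (1 - 2 * η) ≥ lam * (1 / 2) :=
      mul_le_mul_of_nonneg_left (by linarith) hlam.le
    linarith
  have hlt : lam - γ < f y := by
    have : lam * η ≤ 2 * P.fmax * η := mul_le_mul_of_nonneg_right hlam2 hη
    linarith
  obtain ⟨C, hC, hyC⟩ := h.mem_cthickening_of_gap hγ hlt
  obtain ⟨c₀, hc₀⟩ := (levelComponents_isConnected hC).nonempty
  have hF := h.lam_le_fmax (levelComponents_subset hC hc₀)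
  specialize h1 hF; specialize hloc hF; specialize h1' hF; specialize h2' hF; specialize hloc' hF
  have hyN := h.near_of_le hC hyC (τ := 2 * lam * η) (by positivity) (by linarith)
  have hpN : Near ρ' C p := by
    rw [hρ']
    exact (hyN.trans ((dist_comm p y).trans_le hy)).mono (by linarith)
  have hp' : p ∈ corePoints X k ε' := corePoints_mono hεε hp
  have hpw : Reachable X k ε' p w := hpW Relation.ReflTransGen.refl
  have hwp : Reachable X k ε' w p := hpw.symm hp'
  -- The whole cluster `W` stays in the collar of this one `C`, so the clusters merged inside `W`
  -- all belong to `C`.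
  have hWN : ∀ q, Reachable X k ε' q w →
      Near ((2 * lam * η' / P.cLow) ^ (1 / P.beta) + 2 * ε') C q := fun q hq =>
    G'.near_of_reachable h hη' hε' hC hloc' (R := ρ') (by linarith) hp' hpN (hq.trans hwp)
  obtain ⟨K, hK, hK1, -, hK3⟩ := G.recovered h hη hε h1 hloc hC
  -- The points of `K` are within `ρ'` of `C`, where the second run connects all sample points; so
  -- `K` is among the merged sets, and it already covers `C`.
  have hKW : K ⊆ {q | Reachable X k ε' q w} := by
    intro q hq
    have hqr : q ∈ Set.range X := by
      obtain ⟨p1, hp1, rfl⟩ := hK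
      exact Reachable.mem_range hq hp1.1
    obtain ⟨i, rfl⟩ := hqr
    obtain ⟨⟨j, rfl⟩, -⟩ := id hp
    exact (G'.reachable_of_near h hε' hC h1' h2'
      (by rw [hρ']; exact hK1 _ hq) hpN).trans hpw
  refine ⟨C, hC, hausdorffEDist_le_ofReal ?_ ?_⟩
  · intro c hc
    obtain ⟨i, hi, hd⟩ := hK3 c hc
    exact ⟨X i, ⟨K, ⟨hK, hKW⟩, hi⟩, by rw [dist_comm]; linarith⟩
  · rintro q ⟨_, ⟨⟨p1, hp1, rfl⟩, hKp⟩, hq⟩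
    exact (G.near_of_reachable h hη hε hC hloc (by linarith) hp1
      (hWN p1 (hKp Relation.ReflTransGen.refl)) hq).mono hr

end Geometry

/-! ### Chernoff bounds for neighbour counts -/

section Concentration

variable {E : Type*} [MeasurableSpace E]

lemma lintegral_pi_prod (μ : Measure E) [IsProbabilityMeasure μ] {m : ℕ} {h : Fin m → E → ℝ≥0∞}
    (hh : ∀ j, Measurable (h j)) :
    ∫⁻ Y, ∏ j, h j (Y j) ∂(Measure.pi fun _ : Fin m => μ) = ∏ j, ∫⁻ x, h j x ∂μ := by
  have hind : ProbabilityTheory.iIndepFun (fun (j : Fin m) (Y : Fin m → E) => h j (Y j))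
      (Measure.pi fun _ : Fin m => μ) :=
    ProbabilityTheory.iIndepFun_pi (X := h) (fun j => (hh j).aemeasurable)
  rw [ProbabilityTheory.lintegral_prod_eq_prod_lintegral_of_indepFun _ _ hind
    (fun j => (hh j).comp (measurable_pi_apply j))]
  exact Finset.prod_congr rfl fun j _ =>
    (measurePreserving_eval (fun _ : Fin m => μ) j).lintegral_comp (hh j)

lemma lintegral_pi_prod_eq_pow (μ : Measure E) [IsProbabilityMeasure μ] (m : ℕ) {h : E → ℝ≥0∞}
    (hh : Measurable h) :
    ∫⁻ Y, ∏ j, h (Y j) ∂(Measure.pi fun _ : Fin m => μ) = (∫⁻ x, h x ∂μ) ^ m := by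
  simp [lintegral_pi_prod μ fun _ => hh]

/-- Chernoff's bound for the number of sample points in a fixed set. -/
lemma chernoff_pi (μ : Measure E) [IsProbabilityMeasure μ] (m : ℕ) {B : Set E}
    (hB : MeasurableSet B) (s a : ℝ) :
    (Measure.pi fun _ : Fin m => μ) {Y | s * a ≤ s * ∑ j, B.indicator (fun _ => (1 : ℝ)) (Y j)} ≤
      ENNReal.ofReal (Real.exp (-(s * a) + m * μ.real B * (Real.exp s - 1))) := by
  set h : E → ℝ≥0∞ := fun x => ENNReal.ofReal (Real.exp (s * B.indicator (fun _ => (1 : ℝ)) x))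
    with hh
  have hmeas : Measurable h := by
    refine ENNReal.measurable_ofReal.comp (Real.measurable_exp.comp ?_)
    exact (measurable_const.indicator hB).const_mul s
  have hprod : ∀ Y : Fin m → E, ∏ j, h (Y j) =
      ENNReal.ofReal (Real.exp (s * ∑ j, B.indicator (fun _ => (1 : ℝ)) (Y j))) := by
    intro Y
    rw [hh, ← ENNReal.ofReal_prod_of_nonneg (fun _ _ => (Real.exp_pos _).le), ← Real.exp_sum,
      Finset.mul_sum]
  have hint : ∫⁻ x, h x ∂μ = ENNReal.ofReal (1 + μ.real B * (Real.exp s - 1)) := by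
    have h1 : ∀ x, h x = B.indicator (fun _ => ENNReal.ofReal (Real.exp s)) x +
        Bᶜ.indicator (fun _ => 1) x := by
      intro x
      by_cases hx : x ∈ B <;> simp [hh, hx]
    simp_rw [h1]
    rw [lintegral_add_left (measurable_const.indicator hB), lintegral_indicator hB,
      lintegral_indicator hB.compl]
    simp only [lintegral_const, Measure.restrict_apply_univ, one_mul]
    rw [← ofReal_measureReal (μ := μ) (s := B), ← ofReal_measureReal (μ := μ) (s := Bᶜ),
      ← ENNReal.ofReal_mul (Real.exp_pos _).le, ← ENNReal.ofReal_add (by positivity) (by positivity),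
      probReal_compl_eq_one_sub hB]
    congr 1
    ring
  -- Markov's inequality for the exponential of `s` times the count; the sign of `s` selects the
  -- tail.
  have hM := mul_meas_ge_le_lintegral (μ := Measure.pi fun _ : Fin m => μ)
    (f := fun Y => ∏ j, h (Y j))
    (Finset.measurable_prod _ fun j _ => hmeas.comp (measurable_pi_apply j))
    (ENNReal.ofReal (Real.exp (s * a)))
  rw [lintegral_pi_prod_eq_pow μ m hmeas, hint] at hM
  have hset : {Y : Fin m → E | s * a ≤ s * ∑ j, B.indicator (fun _ => (1 : ℝ)) (Y j)} =
      {Y | ENNReal.ofReal (Real.exp (s * a)) ≤ ∏ j, h (Y j)} := by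
    ext Y
    simp only [Set.mem_ofPred_eq, hprod]
    rw [ENNReal.ofReal_le_ofReal_iff (Real.exp_pos _).le, Real.exp_le_exp]
  rw [hset]
  have hpos : 0 ≤ 1 + μ.real B * (Real.exp s - 1) := by
    have h1 : μ.real B ≤ 1 := measureReal_le_one
    have h2 : 0 ≤ μ.real B := measureReal_nonneg
    nlinarith [Real.exp_pos s]
  have hpow : (ENNReal.ofReal (1 + μ.real B * (Real.exp s - 1))) ^ m ≤
      ENNReal.ofReal (Real.exp (m * μ.real B * (Real.exp s - 1))) := by
    rw [← ENNReal.ofReal_pow hpos]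
    refine ENNReal.ofReal_le_ofReal ?_
    rw [mul_assoc, Real.exp_nat_mul]
    refine pow_le_pow_left₀ hpos ?_ m
    linarith [Real.add_one_le_exp (μ.real B * (Real.exp s - 1))]
  have hne : ENNReal.ofReal (Real.exp (s * a)) ≠ 0 := by
    simpa using Real.exp_pos _
  calc _ ≤ (ENNReal.ofReal (Real.exp (s * a)))⁻¹ *
        ENNReal.ofReal (Real.exp (m * μ.real B * (Real.exp s - 1))) := by
        rw [mul_comm (ENNReal.ofReal (Real.exp (s * a)))⁻¹, ← div_eq_mul_inv,
          ENNReal.le_div_iff_mul_le (.inl hne) (.inl (by simp)), mul_comm]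
        exact hM.trans hpow
    _ = _ := by
        rw [← ENNReal.ofReal_inv_of_pos (Real.exp_pos _), ← ENNReal.ofReal_mul (by positivity),
          ← Real.exp_neg, ← Real.exp_add]

variable [PseudoMetricSpace E] [OpensMeasurableSpace E] [SecondCountableTopology E]

lemma measurable_measureReal_closedBall (μ : Measure E) [IsProbabilityMeasure μ] (ε : ℝ) :
    Measurable fun x => μ.real (Metric.closedBall x ε) := by
  have hS : MeasurableSet {p : E × E | dist p.2 p.1 ≤ ε} :=
    measurableSet_le (measurable_snd.dist measurable_fst) measurable_const
  exact (measurable_measure_prodMk_left hS).ennreal_toReal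

/-- The centre counts itself; the other `m` points are independent of it. This is the source of the
off-by-one terms below. -/
lemma ncard_eq_one_add {α : Type*} [PseudoMetricSpace α] {m : ℕ} (X : Fin (m + 1) → α)
    (i : Fin (m + 1)) {ε : ℝ} (hε : 0 ≤ ε) :
    ({j | dist (X j) (X i) ≤ ε}.ncard : ℝ) = 1 + ∑ j : Fin m,
      (Metric.closedBall (X i) ε).indicator (fun _ => (1 : ℝ)) (X (i.succAbove j)) := by
  classical
  have h1 : {j | dist (X j) (X i) ≤ ε} =
      ((Finset.univ.filter fun j => dist (X j) (X i) ≤ ε : Finset (Fin (m + 1))) : Set _) := by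
    ext; simp
  rw [h1, Set.ncard_coe_finset, Finset.card_filter]
  push_cast
  rw [Fin.sum_univ_succAbove _ i]
  simp [hε, Set.indicator_apply]

/-- Union bound over the sample points for the number of neighbours of a sample point. -/
lemma measure_exists_count_le (μ : Measure E) [IsProbabilityMeasure μ] (m : ℕ) {T : Set E}
    (hT : MeasurableSet T) {ε : ℝ} (hε : 0 ≤ ε) (s a b : ℝ)
    (hb : ∀ x ∈ T, -(s * a) + m * μ.real (Metric.closedBall x ε) * (Real.exp s - 1) ≤ b) :
    (Measure.pi fun _ : Fin (m + 1) => μ) {X | ∃ i, X i ∈ T ∧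
      s * (a + 1) ≤ s * ({j | dist (X j) (X i) ≤ ε}.ncard : ℝ)} ≤
      ENNReal.ofReal ((m + 1) * Real.exp b) := by
  set S : Set (E × (Fin m → E)) := Prod.fst ⁻¹' T ∩ {p | s * a ≤ s * ∑ j,
    (Metric.closedBall p.1 ε).indicator (fun _ => (1 : ℝ)) (p.2 j)} with hSdef
  have hS : MeasurableSet S := by
    refine (measurable_fst hT).inter (measurableSet_le measurable_const ?_)
    refine (Finset.measurable_fun_sum _ fun j _ => ?_).const_mul s
    have hA : MeasurableSet {p : E × (Fin m → E) | dist (p.2 j) p.1 ≤ ε} :=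
      measurableSet_le (((measurable_pi_apply j).comp measurable_snd).dist measurable_fst)
        measurable_const
    exact measurable_const.indicator hA
  have hSle : (μ.prod (Measure.pi fun _ : Fin m => μ)) S ≤ ENNReal.ofReal (Real.exp b) := by
    -- Integrating over the centre last makes the ball deterministic, so no uniform bound over all
    -- balls is needed.
    rw [Measure.prod_apply hS]
    calc _ ≤ ∫⁻ _, ENNReal.ofReal (Real.exp b) ∂μ := by
          refine lintegral_mono fun x => ?_
          by_cases hx : x ∈ T
          · refine le_trans (measure_mono ?_) ((chernoff_pi μ m
              (Metric.isClosed_closedBall (x := x) (ε := ε)).measurableSet s a).trans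
              (ENNReal.ofReal_le_ofReal (Real.exp_le_exp.mpr (hb x hx))))
            intro Y hY
            exact hY.2
          · have : Prod.mk x ⁻¹' S = ∅ := by
              ext Y; simp [hSdef, hx]
            simp [this]
      _ = _ := by simp
  have hsub : {X : Fin (m + 1) → E | ∃ i, X i ∈ T ∧
      s * (a + 1) ≤ s * ({j | dist (X j) (X i) ≤ ε}.ncard : ℝ)} ⊆
      ⋃ i, (MeasurableEquiv.piFinSuccAbove (fun _ => E) i) ⁻¹' S := by
    rintro X ⟨i, hiT, hi⟩
    refine Set.mem_iUnion.mpr ⟨i, hiT, ?_⟩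
    rw [ncard_eq_one_add X i hε] at hi
    have : s * a ≤ s * ∑ j : Fin m,
      (Metric.closedBall (X i) ε).indicator (fun _ => (1 : ℝ)) (X (i.succAbove j)) := by linarith
    exact this
  calc _ ≤ ∑ i, (Measure.pi fun _ : Fin (m + 1) => μ)
        ((MeasurableEquiv.piFinSuccAbove (fun _ => E) i) ⁻¹' S) :=
        (measure_mono hsub).trans (measure_iUnion_fintype_le _ _)
    _ ≤ ∑ _i : Fin (m + 1), ENNReal.ofReal (Real.exp b) := by
        refine Finset.sum_le_sum fun i _ => ?_
        rw [(measurePreserving_piFinSuccAbove (fun _ : Fin (m + 1) => μ) i).measure_preimage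
          hS.nullMeasurableSet]
        exact hSle
    _ = _ := by
        rw [Finset.sum_const, Finset.card_univ, Fintype.card_fin, nsmul_eq_mul,
          ENNReal.ofReal_mul (by positivity)]
        congr 1
        rw [← Nat.cast_succ, ENNReal.ofReal_natCast]

/-- Lower tail with tilt `-η / 4`. The expected count without the centre is only at least `k (1 + η
/ 2) - 1`; this missing unit accounts for the `1` in the exponent. -/
lemma measure_few_neighbours_le (μ : Measure E) [IsProbabilityMeasure μ] {n : ℕ} (hn : 1 ≤ n)
    {ε : ℝ} (hε : 0 ≤ ε) (k : ℕ) {η : ℝ} (hη : 0 ≤ η) (hη1 : η ≤ 1 / 4) :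
    (Measure.pi fun _ : Fin n => μ) {X | ∃ i,
      k * (1 + η / 2) ≤ n * μ.real (Metric.closedBall (X i) ε) ∧
      ({j | dist (X j) (X i) ≤ ε}.ncard : ℝ) ≤ k} ≤
      ENNReal.ofReal (n * Real.exp (1 - k * η ^ 2 / 16)) := by
  obtain ⟨m, rfl⟩ : ∃ m, n = m + 1 := ⟨n - 1, by omega⟩
  have hmeas := measurable_measureReal_closedBall μ ε
  have := measure_exists_count_le μ m
    (T := {x | (k : ℝ) * (1 + η / 2) ≤ (m + 1 : ℕ) * μ.real (Metric.closedBall x ε)})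
    (measurableSet_le measurable_const (hmeas.const_mul _)) hε (-(η / 4)) k
    (1 - k * η ^ 2 / 16) ?_
  · push_cast at this ⊢
    refine (measure_mono ?_).trans this
    rintro X ⟨i, h1, h2⟩
    refine ⟨i, h1, ?_⟩
    nlinarith
  · intro x hx
    have hx' : (k : ℝ) * (1 + η / 2) ≤ (m + 1 : ℕ) * μ.real (Metric.closedBall x ε) := hx
    push_cast at hx'
    have hp1 : μ.real (Metric.closedBall x ε) ≤ 1 := measureReal_le_one
    have hmp : (k : ℝ) * (1 + η / 2) - 1 ≤ m * μ.real (Metric.closedBall x ε) := by linarith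
    have he1 : Real.exp (-(η / 4)) - 1 ≤ -(η / 4) + (η / 4) ^ 2 / 2 := by
      have := Real.quadratic_le_exp_of_nonneg (x := η / 4) (by positivity)
      rw [Real.exp_neg]
      have h3 : 0 < 1 + η / 4 + (η / 4) ^ 2 / 2 := by positivity
      have h4 : (Real.exp (η / 4))⁻¹ ≤ (1 + η / 4 + (η / 4) ^ 2 / 2)⁻¹ := by gcongr
      have h5 : (1 + η / 4 + (η / 4) ^ 2 / 2)⁻¹ ≤ 1 - η / 4 + (η / 4) ^ 2 / 2 := by
        rw [inv_le_iff_one_le_mul₀ h3]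
        nlinarith [sq_nonneg ((η / 4) ^ 2)]
      linarith
    have he2 : -1 ≤ Real.exp (-(η / 4)) - 1 := by linarith [Real.exp_pos (-(η / 4))]
    have he3 : Real.exp (-(η / 4)) - 1 ≤ 0 := by
      linarith [Real.exp_le_one_iff.mpr (by linarith : -(η / 4) ≤ 0)]
    have hk : (0 : ℝ) ≤ k := Nat.cast_nonneg k
    have h6 : m * μ.real (Metric.closedBall x ε) * (Real.exp (-(η / 4)) - 1) ≤
        ((k : ℝ) * (1 + η / 2) - 1) * (Real.exp (-(η / 4)) - 1) :=
      mul_le_mul_of_nonpos_right hmp he3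
    have h7 : (k : ℝ) * (1 + η / 2) * (Real.exp (-(η / 4)) - 1) ≤
        (k : ℝ) * (1 + η / 2) * (-(η / 4) + (η / 4) ^ 2 / 2) :=
      mul_le_mul_of_nonneg_left he1 (by positivity)
    have h8 : (k : ℝ) * η ^ 2 * η ≤ k * η ^ 2 * (1 / 4) := by gcongr
    have h9 : 0 ≤ (k : ℝ) * η ^ 2 := by positivity
    nlinarith

/-- Upper tail with tilt `η / 2`. Only `k - 1` neighbours are needed besides the centre, which costs
`η / 2 ≤ 1` in the exponent. -/
lemma measure_many_neighbours_le (μ : Measure E) [IsProbabilityMeasure μ] {n : ℕ} (hn : 1 ≤ n)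
    {ε : ℝ} (hε : 0 ≤ ε) (k : ℕ) {η : ℝ} (hη : 0 ≤ η) (hη1 : η ≤ 1 / 4) :
    (Measure.pi fun _ : Fin n => μ) {X | ∃ i,
      n * μ.real (Metric.closedBall (X i) ε) ≤ k * (1 - η) ∧
      (k : ℝ) ≤ ({j | dist (X j) (X i) ≤ ε}.ncard : ℝ)} ≤
      ENNReal.ofReal (n * Real.exp (1 - k * η ^ 2 / 16)) := by
  obtain ⟨m, rfl⟩ : ∃ m, n = m + 1 := ⟨n - 1, by omega⟩
  have hmeas := measurable_measureReal_closedBall μ ε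
  have := measure_exists_count_le μ m
    (T := {x | (m + 1 : ℕ) * μ.real (Metric.closedBall x ε) ≤ (k : ℝ) * (1 - η)})
    (measurableSet_le (hmeas.const_mul _) measurable_const) hε (η / 2) (k - 1)
    (1 - k * η ^ 2 / 16) ?_
  · push_cast at this ⊢
    refine (measure_mono ?_).trans this
    rintro X ⟨i, h1, h2⟩
    refine ⟨i, h1, ?_⟩
    nlinarith
  · intro x hx
    have hx' : (m + 1 : ℕ) * μ.real (Metric.closedBall x ε) ≤ (k : ℝ) * (1 - η) := hx
    push_cast at hx'
    have hp0 : 0 ≤ μ.real (Metric.closedBall x ε) := measureReal_nonneg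
    have he1 : Real.exp (η / 2) - 1 ≤ η / 2 + (η / 2) ^ 2 := by
      have := Real.abs_exp_sub_one_sub_id_le (x := η / 2) (by rw [abs_le]; constructor <;> linarith)
      linarith [(abs_le.mp this).2]
    have he3 : 0 ≤ Real.exp (η / 2) - 1 := by linarith [Real.add_one_le_exp (η / 2)]
    have hk : (0 : ℝ) ≤ k := Nat.cast_nonneg k
    have h6 : m * μ.real (Metric.closedBall x ε) * (Real.exp (η / 2) - 1) ≤
        ((k : ℝ) * (1 - η)) * (Real.exp (η / 2) - 1) :=
      mul_le_mul_of_nonneg_right (by linarith) he3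
    have h7 : (k : ℝ) * (1 - η) * (Real.exp (η / 2) - 1) ≤
        (k : ℝ) * (1 - η) * (η / 2 + (η / 2) ^ 2) :=
      mul_le_mul_of_nonneg_left he1 (mul_nonneg hk (by linarith))
    have h8 : 0 ≤ (k : ℝ) * η ^ 2 * η := by positivity
    have h9 : 0 ≤ (k : ℝ) * η ^ 2 := by positivity
    nlinarith

end Concentration

/-! ### Covering by the sample -/

section Nets

variable {E : Type*} [MeasurableSpace E] [PseudoMetricSpace E] [OpensMeasurableSpace E]

/-- A set all of whose points carry mass has a finite net. -/
lemma exists_finite_net (μ : Measure E) [IsProbabilityMeasure μ] (S : Set E) {r q : ℝ}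
    (hq : 0 < q) (hS : ∀ x ∈ S, q ≤ μ.real (Metric.ball x r)) :
    ∃ Z : Finset E, (Z : Set E) ⊆ S ∧ Z.card * q ≤ 1 ∧ ∀ x ∈ S, ∃ z ∈ Z, dist x z ≤ 2 * r := by
  classical
  let Sep : Finset E → Prop := fun Z => (Z : Set E) ⊆ S ∧
    (Z : Set E).Pairwise fun x y => 2 * r < dist x y
  have hcard : ∀ Z, Sep Z → Z.card * q ≤ 1 := by
    rintro Z ⟨hZS, hZ⟩
    have hdisj : (Z : Set E).PairwiseDisjoint fun z => Metric.ball z r := by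
      intro x hx y hy hxy
      exact Metric.ball_disjoint_ball (by have := hZ hx hy hxy; linarith)
    calc Z.card * q = ∑ _z ∈ Z, q := by simp
      _ ≤ ∑ z ∈ Z, μ.real (Metric.ball z r) := Finset.sum_le_sum fun z hz => hS z (hZS hz)
      _ = μ.real (⋃ z ∈ Z, Metric.ball z r) :=
          (measureReal_biUnion_finset hdisj fun z _ => Metric.isOpen_ball.measurableSet).symm
      _ ≤ 1 := measureReal_le_one
  have hbound : ∀ N, (∃ Z, Sep Z ∧ Z.card = N) → N ≤ ⌊1 / q⌋₊ := by
    rintro N ⟨Z, hZ, rfl⟩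
    exact Nat.le_floor ((le_div_iff₀ hq).mpr (hcard Z hZ))
  have h0 : ∃ Z, Sep Z ∧ Z.card = 0 := ⟨∅, by simp [Sep], rfl⟩
  -- Disjoint balls of mass at least `q` number at most `1 / q`, so a largest separated set exists;
  -- maximality makes it a net.
  obtain ⟨Z, hZ, hZc⟩ := Nat.findGreatest_spec (P := fun N => ∃ Z, Sep Z ∧ Z.card = N)
    (Nat.zero_le ⌊1 / q⌋₊) h0
  refine ⟨Z, hZ.1, hcard Z hZ, fun x hx => ?_⟩
  by_contra hcon
  push Not at hcon
  have hxZ : x ∉ Z := by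
    intro hxZ
    have h1 := hcon x hxZ
    rw [dist_self] at h1
    have h2 := hS x hx
    rw [Metric.ball_eq_empty.mpr (by linarith)] at h2
    simp at h2
    linarith
  have hsep : Sep (insert x Z) := by
    refine ⟨?_, ?_⟩
    · rw [Finset.coe_insert]
      exact Set.insert_subset hx hZ.1
    · rw [Finset.coe_insert]
      refine hZ.2.insert fun y hy _ => ⟨hcon y hy, ?_⟩
      rw [dist_comm]
      exact hcon y hy
  have := Nat.le_findGreatest (P := fun N => ∃ Z, Sep Z ∧ Z.card = N) (hbound (Z.card + 1)
    ⟨insert x Z, hsep, Finset.card_insert_of_notMem hxZ⟩)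
    ⟨insert x Z, hsep, Finset.card_insert_of_notMem hxZ⟩
  omega

/-- With high probability the sample hits every ball centred at a point that carries mass. -/
lemma measure_exists_uncovered_le (μ : Measure E) [IsProbabilityMeasure μ] (n : ℕ) (S : Set E)
    {r q : ℝ} (hr : 0 ≤ r) (hq : 0 < q) (hS : ∀ x ∈ S, q ≤ μ.real (Metric.ball x r)) :
    (Measure.pi fun _ : Fin n => μ) {X | ∃ x ∈ S, ∀ i, 4 * r < dist (X i) x} ≤
      ENNReal.ofReal (q⁻¹ * Real.exp (-(n * q))) := by
  obtain ⟨Z, hZS, hZc, hZ⟩ := exists_finite_net μ S hq hS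
  -- If `x` is more than `4r` from the sample, the `r`-ball about a net point within `2r` of `x` is
  -- missed, so finitely many balls have to be controlled.
  have hsub : {X : Fin n → E | ∃ x ∈ S, ∀ i, 4 * r < dist (X i) x} ⊆
      ⋃ z ∈ Z, Set.univ.pi fun _ => (Metric.ball z r)ᶜ := by
    rintro X ⟨x, hx, hX⟩
    obtain ⟨z, hz, hd⟩ := hZ x hx
    simp only [Set.mem_iUnion]
    refine ⟨z, hz, fun i _ => ?_⟩
    simp only [Set.mem_compl_iff, Metric.mem_ball, not_lt]
    have := hX i
    have := dist_triangle (X i) z x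
    rw [dist_comm z x] at this
    linarith
  have hterm : ∀ z ∈ Z, (Measure.pi fun _ : Fin n => μ)
      (Set.univ.pi fun _ => (Metric.ball z r)ᶜ) ≤ ENNReal.ofReal (Real.exp (-(n * q))) := by
    intro z hz
    rw [Measure.pi_pi, Finset.prod_const, Finset.card_univ, Fintype.card_fin,
      ← ofReal_measureReal (μ := μ), ← ENNReal.ofReal_pow measureReal_nonneg]
    refine ENNReal.ofReal_le_ofReal ?_
    rw [← mul_neg, Real.exp_nat_mul]
    refine pow_le_pow_left₀ measureReal_nonneg ?_ n
    rw [probReal_compl_eq_one_sub Metric.isOpen_ball.measurableSet]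
    linarith [hS z (hZS hz), Real.add_one_le_exp (-q)]
  calc _ ≤ ∑ z ∈ Z, (Measure.pi fun _ : Fin n => μ) (Set.univ.pi fun _ => (Metric.ball z r)ᶜ) :=
        (measure_mono hsub).trans (measure_biUnion_finset_le _ _)
    _ ≤ ∑ _z ∈ Z, ENNReal.ofReal (Real.exp (-(n * q))) := Finset.sum_le_sum hterm
    _ = ENNReal.ofReal (Z.card * Real.exp (-(n * q))) := by
        rw [Finset.sum_const, nsmul_eq_mul, ENNReal.ofReal_mul (by positivity),
          ENNReal.ofReal_natCast]
    _ ≤ _ := by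
        refine ENNReal.ofReal_le_ofReal (mul_le_mul_of_nonneg_right ?_ (Real.exp_pos _).le)
        rwa [← one_div, le_div_iff₀ hq]

end Nets

/-! ### Probability of a good sample -/

section Mass

variable {D : ℕ}

lemma unitBallVol_pos (D : ℕ) : 0 < unitBallVol D :=
  ENNReal.toReal_pos (Metric.measure_ball_pos _ _ one_pos).ne' measure_ball_lt_top.ne

lemma volume_closedBall_eq (x : Euc D) {r : ℝ} (hr : 0 ≤ r) :
    volume (Metric.closedBall x r) = ENNReal.ofReal (unitBallVol D * r ^ D) := by
  rw [Measure.addHaar_closedBall _ _ hr, finrank_euclideanSpace_fin, mul_comm (unitBallVol D),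
    ENNReal.ofReal_mul (by positivity), unitBallVol, ENNReal.ofReal_toReal measure_ball_lt_top.ne]

lemma volume_ball_eq (x : Euc D) {r : ℝ} (hr : 0 < r) :
    volume (Metric.ball x r) = ENNReal.ofReal (unitBallVol D * r ^ D) := by
  rw [Measure.addHaar_ball_of_pos _ _ hr, finrank_euclideanSpace_fin, mul_comm (unitBallVol D),
    ENNReal.ofReal_mul (by positivity), unitBallVol, ENNReal.ofReal_toReal measure_ball_lt_top.ne]

/-- The distribution with density `f`. -/
noncomputable def densityLaw (f : Euc D → ℝ) : Measure (Euc D) :=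
  (volume : Measure (Euc D)).withDensity fun x => ENNReal.ofReal (f x)

variable {P : Params} {lam : ℝ} {f : Euc D → ℝ}

lemma Admissible.isProbabilityMeasure (h : Admissible P lam f) :
    IsProbabilityMeasure (densityLaw f) :=
  ⟨by rw [densityLaw, withDensity_apply _ MeasurableSet.univ, setLIntegral_univ]
      exact h.lintegral_eq_one⟩

lemma le_densityLaw_real [IsProbabilityMeasure (densityLaw f)] {B : Set (Euc D)}
    (hB : MeasurableSet B) {t w : ℝ} (ht : 0 ≤ t) (hw : volume B = ENNReal.ofReal w)
    (hf : ∀ x ∈ B, t ≤ f x) : t * w ≤ (densityLaw f).real B := by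
  rw [measureReal_def, ← ENNReal.ofReal_le_iff_le_toReal (measure_ne_top _ _), densityLaw,
    withDensity_apply _ hB, ENNReal.ofReal_mul ht, ← hw, ← setLIntegral_const]
  exact setLIntegral_mono' hB fun x hx => ENNReal.ofReal_le_ofReal (hf x hx)

lemma densityLaw_real_le {B : Set (Euc D)}
    (hB : MeasurableSet B) {t w : ℝ} (ht : 0 ≤ t) (hw0 : 0 ≤ w) (hw : volume B = ENNReal.ofReal w)
    (hf : ∀ x ∈ B, f x ≤ t) : (densityLaw f).real B ≤ t * w := by
  rw [measureReal_def]
  refine ENNReal.toReal_le_of_le_ofReal (by positivity) ?_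
  rw [densityLaw, withDensity_apply _ hB, ENNReal.ofReal_mul ht, ← hw, ← setLIntegral_const]
  exact setLIntegral_mono' hB fun x hx => ENNReal.ofReal_le_ofReal (hf x hx)

/-- A sample is good at a given scale with high probability. -/
theorem measure_not_goodSample_le (h : Admissible P lam f) {n k : ℕ} (hn : 1 ≤ n)
    {ε η ρ δ₀ : ℝ} (hη : 0 ≤ η) (hη1 : η ≤ 1 / 4) (hε : 0 < ε)
    (heq : n * unitBallVol D * ε ^ D * (lam - lam * η) = k)
    (hk : 2 * 12 ^ D ≤ (k : ℝ))
    (hconc : n * Real.exp (1 - k * η ^ 2 / 16) ≤ δ₀)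
    (hcov : n * Real.exp (-(k / (2 * 12 ^ D))) ≤ δ₀)
    (hρ1 : lam ≤ P.fmax → P.cUp * (ρ + ε) ^ P.beta ≤ lam / 2)
    (hρ2 : lam ≤ P.fmax → ρ + ε ≤ P.rc) :
    sampleLaw f n {X | ¬ GoodSample f lam X k ε η ρ} ≤ ENNReal.ofReal (3 * δ₀) := by
  have := h.isProbabilityMeasure
  have hlam := h.lam_pos
  have hv := unitBallVol_pos D
  set μ := densityLaw f with hμ
  have hn0 : (0 : ℝ) < n := by exact_mod_cast hn
  have hδ₀ : 0 ≤ δ₀ := le_trans (by positivity) hcov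
  set V := unitBallVol D * ε ^ D with hV
  have hV0 : 0 < V := by positivity
  have heq' : n * V * lam * (1 - η) = k := by rw [← heq, hV]; ring
  set E1 : Set (Fin n → Euc D) := {X | ∃ i,
      k * (1 + η / 2) ≤ n * μ.real (Metric.closedBall (X i) ε) ∧
      ({j | dist (X j) (X i) ≤ ε}.ncard : ℝ) ≤ k} with hE1
  set E2 : Set (Fin n → Euc D) := {X | ∃ i,
      n * μ.real (Metric.closedBall (X i) ε) ≤ k * (1 - η) ∧
      (k : ℝ) ≤ ({j | dist (X j) (X i) ≤ ε}.ncard : ℝ)} with hE2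
  set S : Set (Euc D) := {x | ∃ c ∈ levelSet f lam, dist x c ≤ ρ} with hS
  set E3 : Set (Fin n → Euc D) := {X | ∃ x ∈ S, ∀ i, 4 * (ε / 12) < dist (X i) x} with hE3
  have hsub : {X | ¬ GoodSample f lam X k ε η ρ} ⊆ E1 ∪ E2 ∪ E3 := by
    intro X hX
    by_contra hcon
    simp only [Set.mem_union, not_or] at hcon
    obtain ⟨⟨h1, h2⟩, h3⟩ := hcon
    refine hX ⟨?_, ?_, ?_⟩
    · intro i hi
      refine ⟨⟨i, rfl⟩, ?_⟩
      by_contra hlt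
      push Not at hlt
      refine h1 ⟨i, ?_, by exact_mod_cast hlt.le⟩
      have hm := le_densityLaw_real (f := f) (t := lam * (1 - η / 2))
        (Metric.isClosed_closedBall (x := X i) (ε := ε)).measurableSet
        (mul_nonneg hlam.le (by linarith)) (volume_closedBall_eq (X i) hε.le)
        (fun y hy => hi y hy)
      rw [← hV, ← hμ] at hm
      have h4 : n * (lam * (1 - η / 2) * V) ≤ n * μ.real (Metric.closedBall (X i) ε) :=
        mul_le_mul_of_nonneg_left hm hn0.le
      -- `1 - η/2` exceeds `(1 - η)(1 + η/2)` by `η²/2`; in the next case `(1 - η)²` exceeds `1 -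
      -- 2η` by `η²`. These give the margins of the two counting bounds.
      have h5 : 0 ≤ n * V * lam * (η ^ 2 / 2) := by positivity
      have h6 : (k : ℝ) * (1 + η / 2) = n * (lam * (1 - η / 2) * V) - n * V * lam * (η ^ 2 / 2) := by
        rw [← heq']; ring
      linarith
    · rintro x ⟨⟨i, rfl⟩, hi⟩
      by_contra hno
      push Not at hno
      refine h2 ⟨i, ?_, by exact_mod_cast hi⟩
      have hm := densityLaw_real_le (f := f) (t := lam * (1 - 2 * η))
        (Metric.isClosed_closedBall (x := X i) (ε := ε)).measurableSet
        (mul_nonneg hlam.le (by linarith)) hV0.le (volume_closedBall_eq (X i) hε.le)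
        (fun y hy => (hno y hy).le)
      rw [← hμ] at hm
      have h4 : n * μ.real (Metric.closedBall (X i) ε) ≤ n * (lam * (1 - 2 * η) * V) :=
        mul_le_mul_of_nonneg_left hm hn0.le
      have h5 : 0 ≤ n * V * lam * η ^ 2 := by positivity
      have h6 : (k : ℝ) * (1 - η) = n * (lam * (1 - 2 * η) * V) + n * V * lam * η ^ 2 := by
        rw [← heq']; ring
      linarith
    · intro x c hc hd
      by_contra hno
      push Not at hno
      refine h3 ⟨x, ⟨c, hc, hd⟩, fun i => ?_⟩
      have := hno i
      linarith
  have hlaw : sampleLaw f n = Measure.pi fun _ : Fin n => μ := rfl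
  have p1 : sampleLaw f n E1 ≤ ENNReal.ofReal δ₀ :=
    (measure_few_neighbours_le μ hn hε.le k hη hη1).trans (ENNReal.ofReal_le_ofReal hconc)
  have p2 : sampleLaw f n E2 ≤ ENNReal.ofReal δ₀ :=
    (measure_many_neighbours_le μ hn hε.le k hη hη1).trans (ENNReal.ofReal_le_ofReal hconc)
  have p3 : sampleLaw f n E3 ≤ ENNReal.ofReal δ₀ := by
    -- Within `ρ + ε` of the level set `f` is at least `lam / 2`. The radius `ε / 12` is chosen
    -- since the net argument loses a factor 4.
    set q := lam / 2 * (unitBallVol D * (ε / 12) ^ D) with hq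
    have hq0 : 0 < q := by positivity
    have hmass : ∀ x ∈ S, q ≤ μ.real (Metric.ball x (ε / 12)) := by
      rintro x ⟨c, hc, hd⟩
      have hF := h.lam_le_fmax hc
      refine le_densityLaw_real Metric.isOpen_ball.measurableSet (by positivity)
        (volume_ball_eq x (by positivity)) fun y hy => ?_
      have := h.lower_bound hc (hρ2 hF) (x := y)
        (by have := dist_triangle y x c; have := Metric.mem_ball.mp hy; linarith)
      linarith [hρ1 hF]
    have hnq : k / (2 * 12 ^ D) ≤ n * q := by
      rw [div_le_iff₀ (by positivity), hq, div_pow]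
      have : (n : ℝ) * (lam / 2 * (unitBallVol D * (ε ^ D / 12 ^ D))) * (2 * 12 ^ D) =
          n * V * lam := by
        rw [hV]; field_simp
      rw [this]
      have : n * V * lam * (1 - η) ≤ n * V * lam * 1 :=
        mul_le_mul_of_nonneg_left (by linarith) (by positivity)
      linarith
    -- The net has at most `q⁻¹ ≤ n` points; this is where `k ≥ 2 * 12 ^ D` enters.
    have hqinv : q⁻¹ ≤ n := by
      rw [inv_le_iff_one_le_mul₀ hq0]
      refine le_trans ?_ hnq
      rwa [le_div_iff₀ (by positivity), one_mul]
    refine (measure_exists_uncovered_le μ n S (by positivity) hq0 hmass).trans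
      (ENNReal.ofReal_le_ofReal (le_trans ?_ hcov))
    gcongr
  calc _ ≤ sampleLaw f n (E1 ∪ E2 ∪ E3) := measure_mono hsub
    _ ≤ sampleLaw f n E1 + sampleLaw f n E2 + sampleLaw f n E3 :=
        (measure_union_le _ _).trans (add_le_add_left (measure_union_le _ _) _)
    _ ≤ ENNReal.ofReal δ₀ + ENNReal.ofReal δ₀ + ENNReal.ofReal δ₀ :=
        add_le_add (add_le_add p1 p2) p3
    _ = _ := by
        rw [← ENNReal.ofReal_add hδ₀ hδ₀, ← ENNReal.ofReal_add (by positivity) hδ₀]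
        congr 1; ring

end Mass

/-! ### Numerical estimates and the range of k -/

section Numerics

lemma confConst_sq (C₀ δ : ℝ) (D n : ℕ) :
    confConst C₀ δ D n ^ 2 = C₀ ^ 2 * Real.log (2 / δ) ^ 2 * D * Real.log n := by
  have : 0 ≤ Real.log n := Real.log_natCast_nonneg n
  rw [confConst, mul_pow, mul_pow, Real.sq_sqrt (by positivity)]
  ring

lemma half_le_log {n : ℕ} (hn : 2 ≤ n) : 1 / 2 ≤ Real.log n := by
  have h1 : Real.log 2 ≤ Real.log n := Real.log_le_log (by norm_num) (by exact_mod_cast hn)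
  linarith [Real.log_two_gt_d9]

lemma le_log_two_div {δ : ℝ} (hδ : 0 < δ) (hδ1 : δ < 1) : 69 / 100 ≤ Real.log (2 / δ) := by
  have h1 : Real.log 2 ≤ Real.log (2 / δ) :=
    Real.log_le_log (by norm_num) (by rw [le_div_iff₀ hδ]; linarith)
  linarith [Real.log_two_gt_d9]

lemma mul_exp_le_of_log {δ Q : ℝ} (hδ : 0 < δ) {n : ℕ} (hn : 0 < n)
    (hQ : Real.log n + Real.log (2 / δ) + 2 ≤ Q) : n * Real.exp (-Q) ≤ δ / 6 := by
  have hn0 : (0 : ℝ) < n := by positivity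
  have h1 : Real.exp (-Q) ≤ Real.exp (-(Real.log n + Real.log (2 / δ) + 2)) :=
    Real.exp_le_exp.mpr (by linarith)
  have h2 : Real.exp (-(Real.log n + Real.log (2 / δ) + 2)) = (n : ℝ)⁻¹ * (δ / 2) * Real.exp (-2) := by
    rw [neg_add, neg_add, Real.exp_add, Real.exp_add, Real.exp_neg, Real.exp_neg (Real.log (2 / δ)),
      Real.exp_log hn0, Real.exp_log (by positivity), inv_div]
  have h3 : Real.exp (-2) ≤ 1 / 3 := by
    rw [Real.exp_neg, inv_le_comm₀ (Real.exp_pos _) (by norm_num)]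
    linarith [Real.add_one_le_exp (2 : ℝ)]
  calc n * Real.exp (-Q) ≤ n * ((n : ℝ)⁻¹ * (δ / 2) * Real.exp (-2)) :=
        mul_le_mul_of_nonneg_left (h1.trans_eq h2) hn0.le
    _ = (δ / 2) * Real.exp (-2) := by field_simp
    _ ≤ (δ / 2) * (1 / 3) := mul_le_mul_of_nonneg_left h3 (by positivity)
    _ = δ / 6 := by ring

/-- With `C₀ = 10` the deviation probabilities are small enough for a union bound. -/
lemma mul_exp_confConst_le {δ : ℝ} (hδ : 0 < δ) (hδ1 : δ < 1) {D n : ℕ} (hD : 1 ≤ D) (hn : 2 ≤ n)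
    {Q : ℝ} (hQ : (confConst 10 δ D n ^ 2) ^ 2 ≤ Q) :
    n * Real.exp (1 - Q / 16) ≤ δ / 6 := by
  rw [show 1 - Q / 16 = -(Q / 16 - 1) by ring]
  refine mul_exp_le_of_log hδ (by omega) ?_
  rw [confConst_sq] at hQ
  set l := Real.log n with hl
  set L := Real.log (2 / δ) with hL
  have hl2 : 69 / 100 ≤ l := by
    have h1 : Real.log 2 ≤ Real.log n := Real.log_le_log (by norm_num) (by exact_mod_cast hn)
    linarith [Real.log_two_gt_d9]
  have hL2 : 69 / 100 ≤ L := le_log_two_div hδ hδ1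
  have hD1 : (1 : ℝ) ≤ D := by exact_mod_cast hD
  rw [show (10 : ℝ) ^ 2 = 100 by norm_num] at hQ
  have h1 : (100 * L ^ 2 * 1 * l) ^ 2 ≤ (100 * L ^ 2 * D * l) ^ 2 := by
    gcongr
  have h2 : (3 / 10 : ℝ) * L ≤ L ^ 4 := by
    have : (69 / 100 : ℝ) ^ 3 ≤ L ^ 3 := pow_le_pow_left₀ (by norm_num) hL2 3
    nlinarith
  have h3 : (69 / 100 : ℝ) * l ≤ l ^ 2 := by nlinarith
  have h4 : (3 / 10 * L) * (69 / 100 * l) ≤ L ^ 4 * l ^ 2 := by gcongr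
  have h5 : (69 / 100) * L ≤ L * l := by nlinarith
  have h6 : (69 / 100) * l ≤ L * l := by nlinarith
  nlinarith

/-- The radius at which a ball on which `f = lam (1 - η)` has mass `k / n`. -/
noncomputable def radius (lam : ℝ) (D n k : ℕ) (η : ℝ) : ℝ :=
  ((k : ℝ) / (n * unitBallVol D * (lam - lam * η))) ^ (1 / (D : ℝ))

variable {D n k : ℕ} {lam η : ℝ}

lemma radius_arg_pos (hlam : 0 < lam) (hη : η ≤ 1 / 2) (hn : 2 ≤ n) :
    0 < n * unitBallVol D * (lam - lam * η) := by
  have hv := unitBallVol_pos D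
  have hn0 : (0 : ℝ) < n := by positivity
  have : 0 < lam - lam * η := by nlinarith
  positivity

lemma radius_pos (hlam : 0 < lam) (hη : η ≤ 1 / 2) (hn : 2 ≤ n) (hk : 0 < k) :
    0 < radius lam D n k η := by
  have := radius_arg_pos (D := D) hlam hη hn
  have hk' : (0 : ℝ) < k := by exact_mod_cast hk
  exact Real.rpow_pos_of_pos (by positivity) _

lemma radius_spec (hD : 1 ≤ D) (hlam : 0 < lam) (hη : η ≤ 1 / 2) (hn : 2 ≤ n) :
    n * unitBallVol D * radius lam D n k η ^ D * (lam - lam * η) = k := by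
  have := radius_arg_pos (D := D) hlam hη hn
  rw [radius, ← Real.rpow_natCast, ← Real.rpow_mul (by positivity),
    one_div_mul_cancel (by positivity), Real.rpow_one]
  calc _ = (n * unitBallVol D * (lam - lam * η)) *
        (k / (n * unitBallVol D * (lam - lam * η))) := by ring
    _ = k := mul_div_cancel₀ _ this.ne'

lemma radius_mono {η' : ℝ} (hlam : 0 < lam) (hη : η ≤ η') (hη' : η' ≤ 1 / 2) (hn : 2 ≤ n) :
    radius lam D n k η ≤ radius lam D n k η' := by
  have h1 := radius_arg_pos (D := D) hlam hη' hn
  have hv := unitBallVol_pos D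
  refine Real.rpow_le_rpow (by have := radius_arg_pos (D := D) hlam (hη.trans hη') hn; positivity)
    ?_ (by positivity)
  gcongr

/-- For `k` small enough the radius is small compared to the slack `ℓ / √k`. -/
lemma exists_upper_constant (hD : 1 ≤ D) {β lam0 m : ℝ} (hβ : 0 < β) (hlam0 : 0 < lam0)
    (hm : 0 < m) : ∃ Ku : ℝ, 0 < Ku ∧ ∀ (lam η : ℝ) (n k : ℕ), lam0 < lam → η ≤ 1 / 2 → 2 ≤ n →
      0 < k →
      (k : ℝ) ≤ Ku * Real.log n ^ (2 * D / (2 * β + D)) * (n : ℝ) ^ (2 * β / (2 * β + D)) →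
      radius lam D n k η ^ β ≤ m * (Real.log n / Real.sqrt k) := by
  have hv := unitBallVol_pos D
  have hD0 : (0 : ℝ) < D := by exact_mod_cast hD
  set B := 2 / (unitBallVol D * lam0) with hB
  have hB0 : 0 < B := by positivity
  -- `p = β/D + 1/2`: the `p`-th power turns the limit on `k` into `k^(β/D) √k ≲ log n · n^(β/D)`,
  -- that is, `(k/n)^(β/D) ≲ log n / √k`.
  set p := (2 * β + D) / (2 * D) with hp
  have hp0 : 0 < p := by positivity
  refine ⟨(m / B ^ (β / D)) ^ (1 / p), by positivity, ?_⟩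
  intro lam η n k hlam hη hn hk hku
  have hn0 : (0 : ℝ) < n := by positivity
  have hk0 : (0 : ℝ) < k := by exact_mod_cast hk
  have hl : 0 < Real.log n := by linarith [half_le_log hn]
  have h1 : (k : ℝ) / (n * unitBallVol D * (lam - lam * η)) ≤ B * (k / n) := by
    have h2 : lam0 / 2 ≤ lam - lam * η := by nlinarith
    calc (k : ℝ) / (n * unitBallVol D * (lam - lam * η)) ≤ k / (n * unitBallVol D * (lam0 / 2)) := by
          gcongr
      _ = _ := by rw [hB]; field_simp
  have h2 : radius lam D n k η ^ β ≤ (B * (k / n)) ^ (β / D) := by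
    have h3 := radius_arg_pos (D := D) (hlam0.trans hlam) hη hn
    rw [radius, ← Real.rpow_mul (by positivity), one_div_mul_eq_div]
    exact Real.rpow_le_rpow (by positivity) h1 (by positivity)
  have h3 : (k : ℝ) ^ p ≤ m / B ^ (β / D) * Real.log n * (n : ℝ) ^ (β / D) := by
    have := Real.rpow_le_rpow hk0.le hku hp0.le
    rw [Real.mul_rpow (by positivity) (by positivity), Real.mul_rpow (by positivity) (by positivity),
      ← Real.rpow_mul (by positivity), ← Real.rpow_mul hl.le, ← Real.rpow_mul hn0.le,
      one_div_mul_cancel hp0.ne', Real.rpow_one] at this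
    have e1 : 2 * D / (2 * β + D) * p = 1 := by rw [hp]; field_simp
    have e2 : 2 * β / (2 * β + D) * p = β / D := by rw [hp]; field_simp
    rwa [e1, e2, Real.rpow_one] at this
  have h4 : (k : ℝ) ^ p = (k : ℝ) ^ (β / D) * Real.sqrt k := by
    rw [Real.sqrt_eq_rpow, ← Real.rpow_add hk0]
    congr 1
    rw [hp]; field_simp
  refine h2.trans ?_
  have hs : 0 < Real.sqrt k := Real.sqrt_pos.mpr hk0
  rw [← mul_div_assoc m, le_div_iff₀ hs, Real.mul_rpow hB0.le (by positivity),
    Real.div_rpow hk0.le hn0.le]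
  calc B ^ (β / D) * ((k : ℝ) ^ (β / D) / (n : ℝ) ^ (β / D)) * Real.sqrt k
      = B ^ (β / D) * (k : ℝ) ^ p / (n : ℝ) ^ (β / D) := by rw [h4]; ring
    _ ≤ B ^ (β / D) * (m / B ^ (β / D) * Real.log n * (n : ℝ) ^ (β / D)) / (n : ℝ) ^ (β / D) := by
        gcongr
    _ = m * Real.log n := by field_simp

/-- For `k` large enough compared to `(log n)²`, the slack is small and `k` dominates `log n`. -/
lemma exists_lower_constant {A h₀ M : ℝ} (hA : 0 < A) (hh : 0 < h₀) (hM : 0 < M) :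
    ∃ Kl : ℝ, 0 < Kl ∧ ∀ n k : ℕ, 2 ≤ n → Kl * Real.log n ^ 2 ≤ k →
      0 < k ∧ A * Real.log n / Real.sqrt k ≤ h₀ ∧ M * (Real.log n + 1) ≤ k := by
  refine ⟨(A / h₀) ^ 2 + 6 * M, by positivity, ?_⟩
  intro n k hn hk
  have hl := half_le_log hn
  have h1 : 0 ≤ (A / h₀) ^ 2 * Real.log n ^ 2 := by positivity
  -- The 6 is sharp for `log n ≥ 1/2`.
  have h2 : Real.log n + 1 ≤ 6 * Real.log n ^ 2 := by nlinarith
  have h3 : M * (Real.log n + 1) ≤ M * (6 * Real.log n ^ 2) := mul_le_mul_of_nonneg_left h2 hM.le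
  have h5 : M * (Real.log n + 1) ≤ k := by linarith
  have hk0 : (0 : ℝ) < k := lt_of_lt_of_le (by positivity) h5
  refine ⟨by exact_mod_cast hk0, ?_, h5⟩
  have h6 : (A / h₀ * Real.log n) ≤ Real.sqrt k := by
    refine Real.le_sqrt_of_sq_le ?_
    rw [mul_pow]
    nlinarith [sq_nonneg (Real.log n)]
  rw [div_le_iff₀ (Real.sqrt_pos.mpr hk0)]
  calc A * Real.log n = h₀ * (A / h₀ * Real.log n) := by field_simp
    _ ≤ _ := mul_le_mul_of_nonneg_left h6 hh.le

/-- For `k` large enough compared to `(log n)³`, the slack of the pruning step is small too, but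
large compared to that of the first step. -/
lemma exists_lower_constant_pruned {A h₀ : ℝ} (hA : 0 < A) (hh : 0 < h₀) :
    ∃ Kl : ℝ, 0 < Kl ∧ ∀ n k : ℕ, 2 ≤ n → 0 < k → Kl * Real.log n ^ 3 ≤ k →
      A * Real.log n / (k : ℝ) ^ (1 / 3 : ℝ) ≤ h₀ ∧
      A * Real.log n / Real.sqrt k ≤ h₀ * (A * Real.log n / (k : ℝ) ^ (1 / 3 : ℝ)) := by
  -- The first summand bounds the pruning slack by `h₀`. The second, as `(log n)³ ≥ 1/8`, gives
  -- `k^(1/6) ≥ 1/h₀`, and `k^(1/6)` is the ratio of the two slacks.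
  refine ⟨(A / h₀) ^ 3 + 8 * (1 / h₀) ^ 6, by positivity, ?_⟩
  intro n k hn hk0 hk
  have hk0' : (0 : ℝ) < k := by exact_mod_cast hk0
  have hl := half_le_log hn
  have hl3 : 1 / 8 ≤ Real.log n ^ 3 := by
    have := pow_le_pow_left₀ (by norm_num) hl 3
    norm_num at this ⊢
    exact this
  have h1 : (A / h₀ * Real.log n) ^ 3 ≤ k := by
    rw [mul_pow]
    have : 0 ≤ 8 * (1 / h₀) ^ 6 * Real.log n ^ 3 := by positivity
    linarith
  have h2 : (1 / h₀) ^ 6 ≤ k := by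
    have e1 : 0 ≤ (A / h₀) ^ 3 * Real.log n ^ 3 := by positivity
    have e2 : 8 * (1 / h₀) ^ 6 * (1 / 8) ≤ 8 * (1 / h₀) ^ 6 * Real.log n ^ 3 :=
      mul_le_mul_of_nonneg_left hl3 (by positivity)
    linarith
  have h3 : A / h₀ * Real.log n ≤ (k : ℝ) ^ (1 / 3 : ℝ) := by
    have := Real.rpow_le_rpow (by positivity) h1 (by norm_num : (0 : ℝ) ≤ 1 / 3)
    rwa [← Real.rpow_natCast, ← Real.rpow_mul (by positivity),
      show ((3 : ℕ) : ℝ) * (1 / 3) = 1 by norm_num, Real.rpow_one] at this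
  have h4 : 1 / h₀ ≤ (k : ℝ) ^ (1 / 6 : ℝ) := by
    have := Real.rpow_le_rpow (by positivity) h2 (by norm_num : (0 : ℝ) ≤ 1 / 6)
    rwa [← Real.rpow_natCast, ← Real.rpow_mul (by positivity),
      show ((6 : ℕ) : ℝ) * (1 / 6) = 1 by norm_num, Real.rpow_one] at this
  have hk3 : 0 < (k : ℝ) ^ (1 / 3 : ℝ) := by positivity
  constructor
  · rw [div_le_iff₀ hk3]
    calc A * Real.log n = h₀ * (A / h₀ * Real.log n) := by field_simp
      _ ≤ _ := mul_le_mul_of_nonneg_left h3 hh.le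
  · have h5 : Real.sqrt k = (k : ℝ) ^ (1 / 3 : ℝ) * (k : ℝ) ^ (1 / 6 : ℝ) := by
      rw [Real.sqrt_eq_rpow, ← Real.rpow_add hk0']; norm_num
    rw [h5, ← div_div, div_le_iff₀ (by positivity)]
    have h6 : 1 ≤ h₀ * (k : ℝ) ^ (1 / 6 : ℝ) := by
      rwa [div_le_iff₀' hh] at h4
    calc A * Real.log n / (k : ℝ) ^ (1 / 3 : ℝ) ≤ A * Real.log n / (k : ℝ) ^ (1 / 3 : ℝ) *
        (h₀ * (k : ℝ) ^ (1 / 6 : ℝ)) := le_mul_of_one_le_right (by positivity) h6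
      _ = _ := by ring

end Numerics

/-! ### Upper bounds on the Hausdorff error -/

section UpperBounds

/-- The relative slack `C_{δ,n}² / √k` in the density level. -/
noncomputable def slack (δ : ℝ) (D n k : ℕ) : ℝ := confConst 10 δ D n ^ 2 / Real.sqrt k

/-- The relative slack `C_{δ,n}² / k^{1/3}` of the pruning step. -/
noncomputable def slackPruned (δ : ℝ) (D n k : ℕ) : ℝ :=
  confConst 10 δ D n ^ 2 / (k : ℝ) ^ (1 / 3 : ℝ)

lemma estClusters_eq (δ lam : ℝ) {D n : ℕ} (k : ℕ) (X : Fin n → Euc D) :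
    estClusters 10 δ lam k X = dbscan X k (radius lam D n k (slack δ D n k)) := by
  rw [estClusters, eps, radius, slack, mul_div_assoc]

lemma prunedClusters_eq (δ lam : ℝ) {D n : ℕ} (k : ℕ) (X : Fin n → Euc D) :
    prunedClusters 10 δ lam k X = mergeClusters (dbscan X k (radius lam D n k (slack δ D n k)))
      (dbscan X k (radius lam D n k (slackPruned δ D n k))) := by
  rw [prunedClusters, eps, epsTilde, radius, radius, slack, slackPruned, mul_div_assoc,
    mul_div_assoc]

lemma confConst_nonneg {δ : ℝ} (hδ : 0 < δ) (hδ1 : δ < 1) (D n : ℕ) :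
    0 ≤ confConst 10 δ D n := by
  have := le_log_two_div hδ hδ1
  unfold confConst
  positivity

/-- In terms of the slack, the bound is twice a localisation radius, so it dominates `(2 * lam * η /
cLow) ^ (1 / β) + 2ε` once `2ε` is below the first term. -/
lemma errBound_eq {δ lam : ℝ} (hδ : 0 < δ) (hδ1 : δ < 1) (hlam : 0 < lam) (P : Params)
    (D n k : ℕ) :
    errBound 10 δ lam P D n k = 2 * (4 * lam * slack δ D n k / P.cLow) ^ (1 / P.beta) := by
  have hc := confConst_nonneg hδ hδ1 D n
  have hč := P.cLow_pos
  have hβ := P.beta_pos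
  have e1 : confConst 10 δ D n ^ (2 / P.beta) = (confConst 10 δ D n ^ 2) ^ (1 / P.beta) := by
    rw [← Real.rpow_natCast, ← Real.rpow_mul hc]
    congr 1
    push_cast; ring
  have e2 : (k : ℝ) ^ (-(1 / (2 * P.beta))) = ((Real.sqrt k)⁻¹) ^ (1 / P.beta) := by
    rw [Real.inv_rpow (Real.sqrt_nonneg _), Real.sqrt_eq_rpow, ← Real.rpow_mul (Nat.cast_nonneg k),
      ← Real.rpow_neg (Nat.cast_nonneg k)]
    congr 2
    field_simp
  rw [errBound, e1, e2, mul_assoc, mul_assoc, ← Real.mul_rpow (by positivity) (by positivity),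
    ← Real.mul_rpow (by positivity) (by positivity), slack]
  congr 2
  field_simp

/-- The reason for dividing by `√k`: the Chernoff exponent `k η²` becomes free of `k`. -/
lemma mul_slack_sq (δ : ℝ) (D n : ℕ) {k : ℕ} (hk : 0 < k) :
    k * slack δ D n k ^ 2 = (confConst 10 δ D n ^ 2) ^ 2 := by
  have hk' : (0 : ℝ) < k := by exact_mod_cast hk
  rw [slack, div_pow, Real.sq_sqrt hk'.le]
  field_simp

variable {D : ℕ} {δ : ℝ}

/-- The constants of the range of `k` for which the slack and the radii are as small as needed. -/
lemma exists_range_constants (hD : 1 ≤ D) (hδ : 0 < δ) (hδ1 : δ < 1) (P : Params) {h₀ m : ℝ}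
    (hh : 0 < h₀) (hm : 0 < m) :
    ∃ Kl Ku : ℝ, 0 < Kl ∧ 0 < Ku ∧ ∀ (lam : ℝ) (n k : ℕ), P.lam0 < lam → 2 ≤ n →
      InRange Kl Ku P.beta 2 D n k →
      0 < k ∧ 0 ≤ slack δ D n k ∧ slack δ D n k ≤ h₀ ∧ 2 * 12 ^ D ≤ (k : ℝ) ∧
      n * Real.exp (-(k / (2 * 12 ^ D))) ≤ δ / 6 ∧
      ∀ η ≤ 1 / 2, radius lam D n k η ^ P.beta ≤ m * slack δ D n k := by
  have hD0 : (0 : ℝ) < D := by exact_mod_cast hD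
  have hL := le_log_two_div hδ hδ1
  set A : ℝ := 10 ^ 2 * Real.log (2 / δ) ^ 2 * D with hA
  have hA0 : 0 < A := by positivity
  set M : ℝ := 2 * 12 ^ D * (Real.log (2 / δ) + 2) with hM
  have h12 : (0 : ℝ) < 2 * 12 ^ D := by positivity
  have hM0 : 0 < M := by positivity
  obtain ⟨Kl, hKl, H1⟩ := exists_lower_constant hA0 hh hM0
  obtain ⟨Ku, hKu, H2⟩ := exists_upper_constant hD P.beta_pos P.lam0_pos (mul_pos hm hA0)
  refine ⟨Kl, Ku, hKl, hKu, ?_⟩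
  intro lam n k hlam hn hk
  obtain ⟨h1, h2, h3⟩ := H1 n k hn hk.1
  have hs : slack δ D n k = A * Real.log n / Real.sqrt k := by rw [slack, confConst_sq]
  have hl := half_le_log hn
  have hkM : Real.log n + Real.log (2 / δ) + 2 ≤ k / (2 * 12 ^ D) := by
    rw [le_div_iff₀ h12]
    refine le_trans ?_ h3
    rw [hM, mul_assoc, mul_comm]
    refine mul_le_mul_of_nonneg_left ?_ h12.le
    nlinarith
  refine ⟨h1, ?_, ?_, ?_, ?_, ?_⟩
  · rw [hs]; positivity
  · rwa [hs]
  · have : 1 ≤ (k : ℝ) / (2 * 12 ^ D) := by linarith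
    rwa [le_div_iff₀ h12, one_mul] at this
  · exact mul_exp_le_of_log hδ (by omega) hkM
  · intro η hη
    refine (H2 lam η n k hlam hη hn h1 hk.2).trans_eq ?_
    rw [hs]; ring

/-- The admissible ratio `m` in `ε^β ≤ m η`. -/
noncomputable def ratioBound (P : Params) : ℝ :=
  min (2 * P.lam0 / (P.cLow * 2 ^ P.beta)) (P.lam0 / (2 * 3 ^ P.beta * P.cUp))

lemma ratioBound_pos (P : Params) : 0 < ratioBound P := by
  have h1 := P.lam0_pos
  have h2 := P.cLow_pos
  have h3 := P.cUp_pos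
  exact lt_min (by positivity) (by positivity)

/-- The first entry of `ratioBound` makes the localisation radius dominate the connection radius. -/
lemma two_mul_le_of_rpow_le {P : Params} {lam ε η : ℝ} (hlam : P.lam0 < lam) (hη : 0 ≤ η)
    (hε : 0 ≤ ε) (h : ε ^ P.beta ≤ ratioBound P * η) :
    2 * ε ≤ (2 * lam * η / P.cLow) ^ (1 / P.beta) := by
  have hβ := P.beta_pos
  have hc := P.cLow_pos
  have h1 : (2 * ε) ^ P.beta ≤ 2 * lam * η / P.cLow := by
    rw [Real.mul_rpow (by norm_num) hε]
    calc (2 : ℝ) ^ P.beta * ε ^ P.beta ≤ 2 ^ P.beta * (2 * P.lam0 / (P.cLow * 2 ^ P.beta) * η) := by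
          refine mul_le_mul_of_nonneg_left (h.trans ?_) (by positivity)
          exact mul_le_mul_of_nonneg_right (min_le_left _ _) hη
      _ = 2 * P.lam0 * η / P.cLow := by field_simp
      _ ≤ _ := by gcongr
  have h2 := Real.rpow_le_rpow (by positivity) h1 (one_div_pos.mpr hβ).le
  rwa [← Real.rpow_mul (by positivity), mul_one_div_cancel hβ.ne', Real.rpow_one] at h2

/-- The second entry of `ratioBound` gives the core condition of `core_of_near` at `ρ = ε`. -/
lemma cUp_mul_rpow_le {P : Params} {lam ε η : ℝ} (hlam : P.lam0 < lam) (hη : 0 ≤ η)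
    (hε : 0 ≤ ε) (h : ε ^ P.beta ≤ ratioBound P * η) :
    P.cUp * (3 * ε) ^ P.beta ≤ lam * η / 2 := by
  have hc := P.cUp_pos
  rw [Real.mul_rpow (by norm_num) hε]
  calc P.cUp * ((3 : ℝ) ^ P.beta * ε ^ P.beta) ≤
        P.cUp * (3 ^ P.beta * (P.lam0 / (2 * 3 ^ P.beta * P.cUp) * η)) := by
        refine mul_le_mul_of_nonneg_left (mul_le_mul_of_nonneg_left (h.trans ?_) (by positivity))
          hc.le
        exact mul_le_mul_of_nonneg_right (min_le_right _ _) hη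
    _ = P.lam0 * η / 2 := by field_simp
    _ ≤ _ := by gcongr

/-- `lam ≤ fmax` makes the threshold on `η` free of `lam`; the factor 10 leaves room in the collar
for several radii. -/
lemma rpow_le_rc {P : Params} {lam η : ℝ} (hlam : 0 < lam) (hη : 0 ≤ η) (hF : lam ≤ P.fmax)
    (h : η ≤ P.cLow * (P.rc / 10) ^ P.beta / (2 * P.fmax)) :
    (2 * lam * η / P.cLow) ^ (1 / P.beta) ≤ P.rc / 10 := by
  have hβ := P.beta_pos
  have hc := P.cLow_pos
  have hr := P.rc_pos
  have hF0 := P.fmax_pos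
  have h1 : 2 * lam * η / P.cLow ≤ (P.rc / 10) ^ P.beta := by
    rw [div_le_iff₀ hc]
    rw [le_div_iff₀ (by positivity)] at h
    nlinarith
  have h2 := Real.rpow_le_rpow (by positivity) h1 (one_div_pos.mpr hβ).le
  rwa [← Real.rpow_mul (by positivity), mul_one_div_cancel hβ.ne', Real.rpow_one] at h2

/-- Upper bound on the Hausdorff error for every component of the level set. -/
theorem exists_allRecovered (hD : 1 ≤ D) (hδ : 0 < δ) (hδ1 : δ < 1) (P : Params) :
    ∃ Kl Ku : ℝ, 0 < Kl ∧ 0 < Ku ∧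
      ∀ (lam : ℝ) (f : Euc D → ℝ), Admissible P lam f →
      ∀ n k : ℕ, 2 ≤ n → InRange Kl Ku P.beta 2 D n k →
        sampleLaw f n {X | ¬ AllRecovered (levelComponents f lam) (estClusters 10 δ lam k X)
          (errBound 10 δ lam P D n k)} ≤ ENNReal.ofReal δ := by
  have hc := P.cLow_pos
  have hr := P.rc_pos
  have hF0 := P.fmax_pos
  set h₀ := min (1 / 4) (P.cLow * (P.rc / 10) ^ P.beta / (2 * P.fmax)) with hh₀
  have hh : 0 < h₀ := lt_min (by norm_num) (by positivity)
  obtain ⟨Kl, Ku, hKl, hKu, H⟩ := exists_range_constants hD hδ hδ1 P hh (ratioBound_pos P)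
  refine ⟨Kl, Ku, hKl, hKu, ?_⟩
  intro lam f hf n k hn hk
  obtain ⟨hk0, hη, hηh, hk12, hcov, hrad⟩ := H lam n k hf.lam0_lt hn hk
  have hlam := hf.lam_pos
  set η := slack δ D n k with hηdef
  have hη4 : η ≤ 1 / 4 := hηh.trans (min_le_left _ _)
  set ε := radius lam D n k η with hεdef
  have hε : 0 < ε := radius_pos hlam (by linarith) hn hk0
  have hεβ := hrad η (by linarith)
  have h2ε := two_mul_le_of_rpow_le hf.lam0_lt hη hε.le hεβ
  have h3ε := cUp_mul_rpow_le hf.lam0_lt hη hε.le hεβ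
  have hrc : lam ≤ P.fmax → (2 * lam * η / P.cLow) ^ (1 / P.beta) ≤ P.rc / 10 := fun hF =>
    rpow_le_rc hlam hη hF (hηh.trans (min_le_right _ _))
  have hprob := measure_not_goodSample_le hf (by omega : 1 ≤ n) hη hη4 hε (ρ := ε)
    (radius_spec hD hlam (by linarith) hn) hk12
    (mul_exp_confConst_le hδ hδ1 hD hn (mul_slack_sq δ D n hk0).ge) hcov
    (fun _ => by
      refine (mul_le_mul_of_nonneg_left (Real.rpow_le_rpow (by positivity)
        (by linarith : ε + ε ≤ 3 * ε) P.beta_pos.le) P.cUp_pos.le).trans (h3ε.trans ?_)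
      nlinarith)
    (fun hF => by linarith [hrc hF])
  refine le_trans (measure_mono ?_) (hprob.trans (ENNReal.ofReal_le_ofReal (by linarith)))
  intro X hX hG
  refine hX ?_
  rw [estClusters_eq, errBound_eq hδ hδ1 hlam]
  refine allRecovered_of_goodSample hf hη hε hG (fun _ => h3ε)
    (fun hF => by linarith [hrc hF]) ?_
  have h4 : (2 * lam * η / P.cLow) ^ (1 / P.beta) ≤ (4 * lam * η / P.cLow) ^ (1 / P.beta) := by
    have := P.beta_pos
    gcongr
    norm_num
  linarith

set_option maxHeartbeats 1000000 in
/-- Removal of the false clusters by the pruning step. -/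
theorem exists_noFalseCluster (hD : 1 ≤ D) (hδ : 0 < δ) (hδ1 : δ < 1) (P : Params) {γ : ℝ}
    (hγ : 0 < γ) :
    ∃ Kl Ku : ℝ, 0 < Kl ∧ 0 < Ku ∧
      ∀ (lam : ℝ) (f : Euc D → ℝ), Admissible P lam f → γ ≤ gap f lam P.rc →
      ∀ n k : ℕ, 2 ≤ n → InRange Kl Ku P.beta 3 D n k →
        sampleLaw f n {X | ¬ NoFalseCluster (levelComponents f lam) (prunedClusters 10 δ lam k X)
          (errBound 10 δ lam P D n k)} ≤ ENNReal.ofReal δ := by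
  have hc := P.cLow_pos
  have hcu := P.cUp_pos
  have hr := P.rc_pos
  have hF0 := P.fmax_pos
  have hβ := P.beta_pos
  have hD0 : (0 : ℝ) < D := by exact_mod_cast hD
  -- In order: the Chernoff bounds, localisation inside the collar, beating the gap `γ`, and the
  -- core condition `h5` of the second run.
  set h₀ := min (min (1 / 4) (P.cLow * (P.rc / 10) ^ P.beta / (2 * P.fmax)))
    (min (γ / (8 * P.fmax)) (P.cLow / (4 * 5 ^ P.beta * P.cUp))) with hh₀
  have hh : 0 < h₀ := lt_min (lt_min (by norm_num) (by positivity))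
    (lt_min (by positivity) (by positivity))
  have hb1 : h₀ ≤ 1 / 4 := (min_le_left _ _).trans (min_le_left _ _)
  have hb2 : h₀ ≤ P.cLow * (P.rc / 10) ^ P.beta / (2 * P.fmax) :=
    (min_le_left _ _).trans (min_le_right _ _)
  have hb3 : h₀ ≤ γ / (8 * P.fmax) := (min_le_right _ _).trans (min_le_left _ _)
  have hb4 : h₀ ≤ P.cLow / (4 * 5 ^ P.beta * P.cUp) := (min_le_right _ _).trans (min_le_right _ _)
  obtain ⟨Kl, Ku, hKl, hKu, H⟩ := exists_range_constants hD hδ hδ1 P hh (ratioBound_pos P)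
  have hL := le_log_two_div hδ hδ1
  obtain ⟨Kl', hKl', H'⟩ := exists_lower_constant_pruned
    (A := 10 ^ 2 * Real.log (2 / δ) ^ 2 * D) (by positivity) hh
  -- `2 * Kl` reduces the cubic range to the quadratic one, as `log n ≥ 1/2`.
  refine ⟨2 * Kl + Kl', Ku, by positivity, hKu, ?_⟩
  intro lam f hf hgap n k hn hk
  have hl := half_le_log hn
  have hk2 : InRange Kl Ku P.beta 2 D n k := by
    refine ⟨le_trans ?_ hk.1, hk.2⟩
    have e1 : Kl * Real.log n ^ 2 * (1 / 2) ≤ Kl * Real.log n ^ 2 * Real.log n := by gcongr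
    have e2 : 0 ≤ Kl' * Real.log n ^ 3 := by positivity
    nlinarith
  obtain ⟨hk0, hη, hηh, hk12, hcov, hrad⟩ := H lam n k hf.lam0_lt hn hk2
  have hk3 : Kl' * Real.log n ^ 3 ≤ k := by
    refine le_trans ?_ hk.1
    have e2 : 0 ≤ 2 * Kl * Real.log n ^ 3 := by positivity
    linarith
  obtain ⟨hηh', hηη⟩ := H' n k hn hk0 hk3
  rw [← confConst_sq] at hηh' hηη
  change slackPruned δ D n k ≤ h₀ at hηh'
  change slack δ D n k ≤ h₀ * slackPruned δ D n k at hηη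
  have hlam := hf.lam_pos
  set η := slack δ D n k with hηdef
  set η' := slackPruned δ D n k with hηdef'
  have hη' : 0 ≤ η' := by
    rw [hηdef', slackPruned]; positivity
  have hle : η ≤ η' := hηη.trans (mul_le_of_le_one_left hη' (by linarith))
  have hη4 : η ≤ 1 / 4 := hηh.trans hb1
  have hη4' : η' ≤ 1 / 4 := hηh'.trans hb1
  set ε := radius lam D n k η with hεdef
  set ε' := radius lam D n k η' with hεdef'
  have hε : 0 < ε := radius_pos hlam (by linarith) hn hk0
  have hεε : ε ≤ ε' := radius_mono hlam hle (by linarith) hn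
  have hε' : 0 < ε' := hε.trans_le hεε
  have hεβ := hrad η (by linarith)
  have h2ε := two_mul_le_of_rpow_le hf.lam0_lt hη hε.le hεβ
  have h3ε := cUp_mul_rpow_le hf.lam0_lt hη hε.le hεβ
  -- `hrad` is uniform over slacks up to `1/2`, so `ε'` too is controlled by the smaller slack `η`;
  -- hence `s + 2ε + 2ε' ≤ 5s` below.
  have h2ε' := two_mul_le_of_rpow_le hf.lam0_lt hη hε'.le (hrad η' (by linarith))
  set s := (2 * lam * η / P.cLow) ^ (1 / P.beta) with hs
  have hs0 : 0 ≤ s := by positivity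
  have hrc : lam ≤ P.fmax → s ≤ P.rc / 10 := fun hF =>
    rpow_le_rc hlam hη hF (hηh.trans hb2)
  have hrc' : lam ≤ P.fmax → (2 * lam * η' / P.cLow) ^ (1 / P.beta) ≤ P.rc / 10 := fun hF =>
    rpow_le_rc hlam hη' hF (hηh'.trans hb2)
  have h5 : P.cUp * ((s + 2 * ε) + 2 * ε') ^ P.beta ≤ lam * η' / 2 := by
    have e1 : ((s + 2 * ε) + 2 * ε') ^ P.beta ≤ (5 * s) ^ P.beta :=
      Real.rpow_le_rpow (by positivity) (by linarith) hβ.le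
    have e2 : (5 * s) ^ P.beta = 5 ^ P.beta * (2 * lam * η / P.cLow) := by
      rw [Real.mul_rpow (by norm_num) hs0, hs, ← Real.rpow_mul (by positivity),
        one_div_mul_cancel hβ.ne', Real.rpow_one]
    have e3 : η ≤ P.cLow / (4 * 5 ^ P.beta * P.cUp) * η' :=
      hηη.trans (mul_le_mul_of_nonneg_right hb4 hη')
    calc P.cUp * ((s + 2 * ε) + 2 * ε') ^ P.beta ≤
          P.cUp * (5 ^ P.beta * (2 * lam * η / P.cLow)) := by rw [← e2]; gcongr
      _ ≤ P.cUp * (5 ^ P.beta * (2 * lam * (P.cLow / (4 * 5 ^ P.beta * P.cUp) * η') / P.cLow)) := by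
          gcongr
      _ = lam * η' / 2 := by field_simp; ring
  have hconc := mul_exp_confConst_le hδ hδ1 hD hn (mul_slack_sq δ D n hk0).ge
  rw [← hηdef] at hconc
  have hconc' : n * Real.exp (1 - k * η' ^ 2 / 16) ≤ δ / 6 := by
    refine mul_exp_confConst_le hδ hδ1 hD hn ?_
    rw [← mul_slack_sq δ D n hk0]
    gcongr
  have hprob := measure_not_goodSample_le hf (by omega : 1 ≤ n) hη hη4 hε (ρ := ε)
    (radius_spec hD hlam (by linarith) hn) hk12 hconc hcov
    (fun _ => by
      refine (mul_le_mul_of_nonneg_left (Real.rpow_le_rpow (by positivity)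
        (by linarith : ε + ε ≤ 3 * ε) hβ.le) hcu.le).trans (h3ε.trans ?_)
      nlinarith)
    (fun hF => by linarith [hrc hF])
  have hprob' := measure_not_goodSample_le hf (by omega : 1 ≤ n) hη' hη4' hε' (ρ := s + 2 * ε)
    (radius_spec hD hlam (by linarith) hn) hk12 hconc' hcov
    (fun _ => by
      refine (mul_le_mul_of_nonneg_left (Real.rpow_le_rpow (by positivity)
        (by linarith : s + 2 * ε + ε' ≤ s + 2 * ε + 2 * ε') hβ.le) hcu.le).trans (h5.trans ?_)
      nlinarith)
    (fun hF => by linarith [hrc hF])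
  have hsub : {X : Fin n → Euc D | ¬ NoFalseCluster (levelComponents f lam)
      (prunedClusters 10 δ lam k X) (errBound 10 δ lam P D n k)} ⊆
      {X | ¬ GoodSample f lam X k ε η ε} ∪ {X | ¬ GoodSample f lam X k ε' η' (s + 2 * ε)} := by
    intro X hX
    by_contra hcon
    simp only [Set.mem_union, Set.mem_ofPred_eq, not_or, not_not] at hcon
    obtain ⟨hG, hG'⟩ := hcon
    refine hX ?_
    rw [prunedClusters_eq, errBound_eq hδ hδ1 hlam]
    refine noFalseCluster_of_goodSample hf hgap hη hη' hε hεε ?_ hη4 rfl hG hG' (fun _ => h3ε)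
      (fun hF => by linarith [hrc hF]) (fun _ => h5) (fun hF => by linarith [hrc hF])
      (fun hF => by linarith [hrc hF, hrc' hF]) ?_
    · have e1 := hηh.trans hb3
      rw [le_div_iff₀ (by positivity)] at e1
      linarith
    · have h4 : s ≤ (4 * lam * η / P.cLow) ^ (1 / P.beta) := by
        rw [hs]
        gcongr
        norm_num
      linarith
  -- Three bad events at each of two radii, each of probability at most `δ / 6`.
  calc _ ≤ ENNReal.ofReal (3 * (δ / 6)) + ENNReal.ofReal (3 * (δ / 6)) :=
        (measure_mono hsub).trans ((measure_union_le _ _).trans (add_le_add hprob hprob'))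
    _ = ENNReal.ofReal δ := by
        rw [← ENNReal.ofReal_add (by positivity) (by positivity)]
        congr 1; ring

end UpperBounds

/-! ### Rates for the optimal order of k -/

section Rates

variable {D : ℕ} {δ : ℝ}

/-- The choice `k ≈ n^{2β/(2β+D)}` is eventually in the admissible range. -/
lemma exists_inRange {β Kl Ku a₁ a₂ : ℝ} (D a : ℕ) (hD : 1 ≤ D) (hβ : 0 < β) (hKl : 0 < Kl)
    (hKu : 0 < Ku) (ha₁ : 0 < a₁) :
    ∃ N : ℕ, 2 ≤ N ∧ ∀ n k : ℕ, N ≤ n → a₁ * (n : ℝ) ^ (2 * β / (2 * β + D)) ≤ k →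
      (k : ℝ) ≤ a₂ * (n : ℝ) ^ (2 * β / (2 * β + D)) → InRange Kl Ku β a D n k := by
  have hD0 : (0 : ℝ) < D := by exact_mod_cast hD
  have h1 : ∀ᶠ n : ℕ in atTop, Kl * Real.log n ^ a ≤ a₁ * (n : ℝ) ^ (2 * β / (2 * β + D)) := by
    have ho := (isLittleO_log_rpow_rpow_atTop (a : ℝ)
      (by positivity : 0 < 2 * β / (2 * β + D))).bound (by positivity : 0 < a₁ / Kl)
    filter_upwards [tendsto_natCast_atTop_atTop.eventually ho, eventually_ge_atTop 1] with n hn hn1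
    have hl := Real.log_natCast_nonneg n
    rw [Real.norm_of_nonneg (by positivity), Real.norm_of_nonneg (by positivity),
      Real.rpow_natCast] at hn
    calc Kl * Real.log n ^ a ≤ Kl * (a₁ / Kl * (n : ℝ) ^ (2 * β / (2 * β + D))) := by gcongr
      _ = _ := by field_simp
  have h2 : ∀ᶠ n : ℕ in atTop, a₂ / Ku ≤ Real.log n ^ (2 * D / (2 * β + D)) :=
    ((tendsto_rpow_atTop (by positivity : 0 < 2 * D / (2 * β + D))).comp
      (Real.tendsto_log_atTop.comp tendsto_natCast_atTop_atTop)).eventually_ge_atTop _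
  obtain ⟨N, hN⟩ := eventually_atTop.mp (h1.and (h2.and (eventually_ge_atTop 2)))
  refine ⟨N, (hN N le_rfl).2.2, fun n k hn hk1 hk2 => ?_⟩
  obtain ⟨e1, e2, -⟩ := hN n hn
  refine ⟨e1.trans hk1, hk2.trans ?_⟩
  rw [div_le_iff₀' hKu] at e2
  gcongr

/-- The error bound for `k ≈ n^{2β/(2β+D)}`. -/
lemma exists_errBound_le (hD : 1 ≤ D) (hδ : 0 < δ) (hδ1 : δ < 1) (P : Params) {a₁ : ℝ}
    (ha₁ : 0 < a₁) : ∃ R : ℝ, 0 < R ∧ ∀ (lam : ℝ) (n k : ℕ), 0 < lam → lam ≤ P.fmax → 2 ≤ n →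
      a₁ * (n : ℝ) ^ (2 * P.beta / (2 * P.beta + D)) ≤ k →
      errBound 10 δ lam P D n k ≤
        R * Real.log n ^ (1 / P.beta) * (n : ℝ) ^ (-(1 / (2 * P.beta + D))) := by
  have hD0 : (0 : ℝ) < D := by exact_mod_cast hD
  have hc := P.cLow_pos
  have hβ := P.beta_pos
  have hF := P.fmax_pos
  have hL := le_log_two_div hδ hδ1
  set B := 10 * Real.log (2 / δ) * Real.sqrt D with hB
  have hB0 : 0 < B := by positivity
  refine ⟨2 * (4 * P.fmax / P.cLow) ^ (1 / P.beta) * B ^ (2 / P.beta) *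
    a₁ ^ (-(1 / (2 * P.beta))), by positivity, ?_⟩
  intro lam n k hlam hlamF hn hk
  have hn0 : (0 : ℝ) < n := by positivity
  have hl : 0 < Real.log n := by linarith [half_le_log hn]
  have e1 : confConst 10 δ D n ^ (2 / P.beta) = B ^ (2 / P.beta) * Real.log n ^ (1 / P.beta) := by
    have : confConst 10 δ D n = B * Real.sqrt (Real.log n) := by
      rw [confConst, Real.sqrt_mul hD0.le, hB]; ring
    rw [this, Real.mul_rpow hB0.le (Real.sqrt_nonneg _), Real.sqrt_eq_rpow,
      ← Real.rpow_mul hl.le]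
    congr 2
    field_simp
  have e2 : (k : ℝ) ^ (-(1 / (2 * P.beta))) ≤
      a₁ ^ (-(1 / (2 * P.beta))) * (n : ℝ) ^ (-(1 / (2 * P.beta + D))) := by
    have h1 := Real.rpow_le_rpow_of_nonpos (z := -(1 / (2 * P.beta))) (by positivity) hk
      (by rw [neg_nonpos]; positivity)
    refine h1.trans_eq ?_
    rw [Real.mul_rpow ha₁.le (by positivity), ← Real.rpow_mul hn0.le]
    congr 2
    field_simp
  rw [errBound, e1]
  calc 2 * (4 * lam / P.cLow) ^ (1 / P.beta) *
        (B ^ (2 / P.beta) * Real.log n ^ (1 / P.beta)) * (k : ℝ) ^ (-(1 / (2 * P.beta))) ≤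
        2 * (4 * P.fmax / P.cLow) ^ (1 / P.beta) *
        (B ^ (2 / P.beta) * Real.log n ^ (1 / P.beta)) *
        (a₁ ^ (-(1 / (2 * P.beta))) * (n : ℝ) ^ (-(1 / (2 * P.beta + D)))) := by gcongr
    _ = _ := by ring

/-- `R` can be chosen free of `lam`: the bound is only needed when a component exists, and then `lam
≤ fmax`. -/
theorem exists_allRecovered_rate (hD : 1 ≤ D) (hδ : 0 < δ) (hδ1 : δ < 1) (P : Params) {a₁ a₂ : ℝ}
    (ha₁ : 0 < a₁) : ∃ (N : ℕ) (R : ℝ), 0 < R ∧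
      ∀ (lam : ℝ) (f : Euc D → ℝ), Admissible P lam f →
      ∀ n k : ℕ, N ≤ n → a₁ * (n : ℝ) ^ (2 * P.beta / (2 * P.beta + D)) ≤ k →
        (k : ℝ) ≤ a₂ * (n : ℝ) ^ (2 * P.beta / (2 * P.beta + D)) →
        sampleLaw f n {X | ¬ AllRecovered (levelComponents f lam) (estClusters 10 δ lam k X)
          (R * Real.log n ^ (1 / P.beta) * (n : ℝ) ^ (-(1 / (2 * P.beta + D))))} ≤
            ENNReal.ofReal δ := by
  obtain ⟨Kl, Ku, hKl, hKu, H⟩ := exists_allRecovered hD hδ hδ1 P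
  obtain ⟨N, hN2, hN⟩ := exists_inRange (a₂ := a₂) D 2 hD P.beta_pos hKl hKu ha₁
  obtain ⟨R, hR, HR⟩ := exists_errBound_le hD hδ hδ1 P ha₁
  refine ⟨N, R, hR, fun lam f hf n k hn hk1 hk2 => ?_⟩
  refine le_trans (measure_mono ?_) (H lam f hf n k (hN2.trans hn) (hN n k hn hk1 hk2))
  intro X hX hA
  refine hX fun C hC => ?_
  obtain ⟨K, hK, hKd⟩ := hA C hC
  obtain ⟨c, hc⟩ := (levelComponents_isConnected hC).nonempty
  exact ⟨K, hK, hKd.trans (ENNReal.ofReal_le_ofReal (HR lam n k hf.lam_pos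
    (hf.lam_le_fmax (levelComponents_subset hC hc)) (hN2.trans hn) hk1))⟩

theorem exists_noFalseCluster_rate (hD : 1 ≤ D) (hδ : 0 < δ) (hδ1 : δ < 1) (P : Params)
    {γ a₁ a₂ : ℝ} (hγ : 0 < γ) (ha₁ : 0 < a₁) : ∃ (N : ℕ) (R : ℝ), 0 < R ∧
      ∀ (lam : ℝ) (f : Euc D → ℝ), Admissible P lam f → γ ≤ gap f lam P.rc →
      ∀ n k : ℕ, N ≤ n → a₁ * (n : ℝ) ^ (2 * P.beta / (2 * P.beta + D)) ≤ k →
        (k : ℝ) ≤ a₂ * (n : ℝ) ^ (2 * P.beta / (2 * P.beta + D)) →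
        sampleLaw f n {X | ¬ NoFalseCluster (levelComponents f lam) (prunedClusters 10 δ lam k X)
          (R * Real.log n ^ (1 / P.beta) * (n : ℝ) ^ (-(1 / (2 * P.beta + D))))} ≤
            ENNReal.ofReal δ := by
  obtain ⟨Kl, Ku, hKl, hKu, H⟩ := exists_noFalseCluster hD hδ hδ1 P hγ
  obtain ⟨N, hN2, hN⟩ := exists_inRange (a₂ := a₂) D 3 hD P.beta_pos hKl hKu ha₁
  obtain ⟨R, hR, HR⟩ := exists_errBound_le hD hδ hδ1 P ha₁
  refine ⟨N, R, hR, fun lam f hf hgap n k hn hk1 hk2 => ?_⟩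
  refine le_trans (measure_mono ?_) (H lam f hf hgap n k (hN2.trans hn) (hN n k hn hk1 hk2))
  intro X hX hA
  refine hX fun K hK => ?_
  obtain ⟨C, hC, hKd⟩ := hA K hK
  obtain ⟨c, hc⟩ := (levelComponents_isConnected hC).nonempty
  exact ⟨C, hC, hKd.trans (ENNReal.ofReal_le_ofReal (HR lam n k hf.lam_pos
    (hf.lam_le_fmax (levelComponents_subset hC hc)) (hN2.trans hn) hk1))⟩

end Rates

/-! ### Positivity of the gap -/

section Gap

variable {D : ℕ} {P : Params} {lam : ℝ} {f : Euc D → ℝ}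

/-- The gap is positive for densities that vanish at infinity. -/
theorem gap_pos (h : Admissible P lam f) (hf : Tendsto f (cocompact (Euc D)) (𝓝 0)) :
    0 < gap f lam P.rc := by
  have hlam := h.lam_pos
  set U : Set (Euc D) := (⋃ C ∈ levelComponents f lam, Metric.cthickening P.rc C)ᶜ with hU
  -- A point of `{f ≥ lam}` has its open `rc`-ball inside a collar, so it is not a limit of `U`.
  -- Compactness then makes the strict inequality uniform.
  have hlt : ∀ x ∈ closure U, f x < lam := by
    intro x hx
    by_contra hcon
    push Not at hcon
    obtain ⟨C, hC, hxC⟩ := exists_levelComponent (f := f) (t := lam) (x := x) hcon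
    obtain ⟨y, hy, hd⟩ := Metric.mem_closure_iff.mp hx P.rc P.rc_pos
    refine hy (Set.mem_iUnion₂.mpr ⟨C, hC, ?_⟩)
    exact Metric.mem_cthickening_of_dist_le y x P.rc C hxC (by rw [dist_comm]; exact hd.le)
  have hev : ∀ᶠ x in cocompact (Euc D), f x < lam / 2 := hf.eventually_lt_const (by linarith)
  obtain ⟨K, hK, hKsub⟩ := mem_cocompact.mp hev
  obtain ⟨b, hb, hbU⟩ : ∃ b < lam, ∀ x ∈ U, f x ≤ b := by
    have hKU : IsCompact (K ∩ closure U) := hK.inter_right isClosed_closure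
    rcases (K ∩ closure U).eq_empty_or_nonempty with he | hne
    · refine ⟨lam / 2, by linarith, fun x hx => ?_⟩
      have hxK : x ∉ K := fun hxK => by
        have : x ∈ K ∩ closure U := ⟨hxK, subset_closure hx⟩
        rw [he] at this
        exact this
      exact le_of_lt (hKsub hxK)
    · obtain ⟨z, hz, hmax⟩ := hKU.exists_isMaxOn hne h.continuous.continuousOn
      refine ⟨max (f z) (lam / 2), max_lt (hlt z hz.2) (by linarith), fun x hx => ?_⟩
      by_cases hxK : x ∈ K
      · exact le_max_of_le_left (hmax ⟨hxK, subset_closure hx⟩)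
      · exact le_max_of_le_right (le_of_lt (hKsub hxK))
  -- The `0` covers empty `U`, where `sSup` takes its default value.
  have hs : sSup (f '' U) ≤ max b 0 := by
    rcases U.eq_empty_or_nonempty with he | hne
    · rw [he, Set.image_empty, Real.sSup_empty]
      exact le_max_right _ _
    · refine csSup_le (hne.image f) ?_
      rintro _ ⟨x, hx, rfl⟩
      exact le_max_of_le_left (hbU x hx)
  have : max b 0 < lam := max_lt hb hlam
  unfold gap
  linarith

end Gap

/-! ### Le Cam's two-point method -/

section LeCam

variable {E : Type*} [MeasurableSpace E]

lemma pi_withDensity (μ : Measure E) [IsProbabilityMeasure μ] {g : E → ℝ≥0∞} (hg : Measurable g)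
    [IsProbabilityMeasure (μ.withDensity g)] (n : ℕ) :
    (Measure.pi fun _ : Fin n => μ.withDensity g) =
      (Measure.pi fun _ : Fin n => μ).withDensity fun X => ∏ j, g (X j) := by
  refine Measure.pi_eq fun s hs => ?_
  rw [withDensity_apply _ (MeasurableSet.univ_pi hs),
    ← lintegral_indicator (MeasurableSet.univ_pi hs)]
  have h1 : ∀ X : Fin n → E, (Set.univ.pi s).indicator (fun X => ∏ j, g (X j)) X =
      ∏ j, (s j).indicator g (X j) := by
    intro X
    by_cases hX : X ∈ Set.univ.pi s
    · rw [Set.indicator_of_mem hX]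
      exact Finset.prod_congr rfl fun j _ => (Set.indicator_of_mem (hX j trivial) g).symm
    · rw [Set.indicator_of_notMem hX]
      simp only [Set.mem_pi, not_forall] at hX
      obtain ⟨j, -, hj⟩ := hX
      exact (Finset.prod_eq_zero (Finset.mem_univ j) (Set.indicator_of_notMem hj g)).symm
  simp_rw [h1]
  rw [lintegral_pi_prod μ (fun j => hg.indicator (hs j))]
  exact Finset.prod_congr rfl fun j _ => by
    rw [lintegral_indicator (hs j), withDensity_apply _ (hs j)]

/-- For `G ≥ 1` this is `(G/2 - 1)² ≥ 0`. It turns a second-moment bound into a lower bound on the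
overlap `∫ min 1 G`. -/
lemma le_min_one_add_sq_div_four (G : ℝ≥0∞) : G ≤ min 1 G + G ^ 2 / 4 := by
  rcases eq_or_ne G ⊤ with rfl | hG
  · have : (⊤ : ℝ≥0∞) ^ 2 / 4 = ⊤ := by
      rw [ENNReal.top_pow (by norm_num), ENNReal.top_div_of_ne_top (by norm_num)]
    rw [this]; simp
  · lift G to NNReal using hG
    rcases le_total G 1 with h | h
    · have : min (1 : ℝ≥0∞) G = G := min_eq_right (by exact_mod_cast h)
      rw [this]
      exact le_self_add
    · have : min (1 : ℝ≥0∞) G = 1 := min_eq_left (by exact_mod_cast h)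
      rw [this]
      have h4 : (4 : ℝ≥0∞) = ((4 : NNReal) : ℝ≥0∞) := by norm_num
      rw [h4, ← ENNReal.coe_pow, ← ENNReal.coe_div (by norm_num), ← ENNReal.coe_one,
        ← ENNReal.coe_add, ENNReal.coe_le_coe, ← NNReal.coe_le_coe]
      push_cast
      nlinarith [sq_nonneg ((G : ℝ) / 2 - 1)]

/-- **Le Cam's two-point method** with a `χ²`-bound on the alternative; the two events need not
be measurable. -/
theorem one_half_le_add_of_chi_sq (μ : Measure E) [IsProbabilityMeasure μ] {g : E → ℝ≥0∞}
    (hg : Measurable g) [IsProbabilityMeasure (μ.withDensity g)] {n : ℕ}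
    (hχ : (∫⁻ x, g x ^ 2 ∂μ) ^ n ≤ 2) {E₀ E₁ : Set (Fin n → E)} (hE : E₀ ∪ E₁ = Set.univ) :
    1 / 2 ≤ (Measure.pi fun _ : Fin n => μ) E₀ +
      (Measure.pi fun _ : Fin n => μ.withDensity g) E₁ := by
  set Q := Measure.pi fun _ : Fin n => μ with hQ
  set G : (Fin n → E) → ℝ≥0∞ := fun X => ∏ j, g (X j) with hG
  have hGm : Measurable G :=
    Finset.measurable_prod _ fun j _ => hg.comp (measurable_pi_apply j)
  -- A common minorant of both product laws, of mass at least `1 - 2/4`. Only monotonicity and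
  -- subadditivity are applied to the events, hence no measurability.
  set ν := Q.withDensity fun X => min 1 (G X) with hν
  have h0 : ν ≤ Q := by
    have : ν ≤ Q.withDensity 1 := withDensity_mono (ae_of_all _ fun X => min_le_left _ _)
    rwa [withDensity_one] at this
  have h1 : ν ≤ Measure.pi fun _ : Fin n => μ.withDensity g := by
    rw [pi_withDensity μ hg n]
    exact withDensity_mono (ae_of_all _ fun X => min_le_right _ _)
  have hint : ∫⁻ X, G X ∂Q = 1 := by
    have := measure_univ (μ := Measure.pi fun _ : Fin n => μ.withDensity g)
    rwa [pi_withDensity μ hg n, withDensity_apply _ MeasurableSet.univ, setLIntegral_univ] at this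
  have hsq : ∫⁻ X, G X ^ 2 ∂Q ≤ 2 := by
    have : ∀ X, G X ^ 2 = ∏ j, g (X j) ^ 2 := fun X => (Finset.prod_pow _ _ _).symm
    simp_rw [this]
    rw [lintegral_pi_prod_eq_pow μ n (hg.pow_const 2)]
    exact hχ
  have hν1 : 1 / 2 ≤ ν Set.univ := by
    rw [hν, withDensity_apply _ MeasurableSet.univ, setLIntegral_univ]
    have h2 : (1 : ℝ≥0∞) ≤ ∫⁻ X, min 1 (G X) ∂Q + 1 / 2 := by
      calc (1 : ℝ≥0∞) = ∫⁻ X, G X ∂Q := hint.symm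
        _ ≤ ∫⁻ X, (min 1 (G X) + G X ^ 2 / 4) ∂Q :=
            lintegral_mono fun X => le_min_one_add_sq_div_four _
        _ = ∫⁻ X, min 1 (G X) ∂Q + (∫⁻ X, G X ^ 2 ∂Q) * 4⁻¹ := by
            rw [lintegral_add_left (measurable_const.min hGm)]
            simp_rw [div_eq_mul_inv]
            rw [lintegral_mul_const _ (hGm.pow_const 2)]
        _ ≤ ∫⁻ X, min 1 (G X) ∂Q + 2 * 4⁻¹ := by gcongr
        _ = _ := by
            congr 1
            rw [← ENNReal.toReal_eq_toReal_iff' (by finiteness) (by finiteness)]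
            norm_num
    refine ENNReal.le_of_add_le_add_right (a := 1 / 2) (by norm_num) ?_
    rwa [ENNReal.add_halves]
  calc 1 / 2 ≤ ν Set.univ := hν1
    _ ≤ ν E₀ + ν E₁ := by rw [← hE]; exact measure_union_le _ _
    _ ≤ _ := add_le_add (h0 E₀) (h1 E₁)

end LeCam

/-! ### The two hypotheses -/

section Construction

variable {D : ℕ}

lemma exists_norm_eq_one (hD : 1 ≤ D) : ∃ e : Euc D, ‖e‖ = 1 :=
  ⟨EuclideanSpace.single ⟨0, hD⟩ 1, by simp⟩

/-- A low continuous density that vanishes near the origin. -/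
lemma exists_low_density (hD : 1 ≤ D) {r t : ℝ} (hr : 0 < r) (ht : 0 < t) :
    ∃ b : Euc D → ℝ, Continuous b ∧ (∀ x, 0 ≤ b x) ∧ (∀ x, b x ≤ t) ∧ (∀ x, ‖x‖ ≤ r → b x = 0) ∧
      ∫⁻ x, ENNReal.ofReal (b x) = 1 := by
  obtain ⟨e, he⟩ := exists_norm_eq_one hD
  have hv := unitBallVol_pos D
  -- The bump equals one on a ball of volume at least `1 / t`, so normalising its mass brings its
  -- height below `t`; `R ≥ 1` gives `R ≤ R ^ D`.
  set R := max 1 (1 / (t * unitBallVol D)) with hR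
  have hR1 : 1 ≤ R := le_max_left _ _
  set M := 2 * R + r + 2 with hM
  set φ : Euc D → ℝ := fun x => max 0 (min 1 (min (‖x‖ - r) (M - ‖x‖))) with hφ
  have hφc : Continuous φ := by fun_prop
  have hφ0 : ∀ x, 0 ≤ φ x := fun x => le_max_left _ _
  have hφ1 : ∀ x, φ x ≤ 1 := fun x => max_le zero_le_one (min_le_left _ _)
  have hvol : 1 / t ≤ unitBallVol D * R ^ D := by
    have h1 : R ≤ R ^ D := le_self_pow₀ hR1 (by omega)
    have h2 : 1 / (t * unitBallVol D) ≤ R := le_max_right _ _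
    calc 1 / t = unitBallVol D * (1 / (t * unitBallVol D)) := by field_simp
      _ ≤ unitBallVol D * R ^ D := by gcongr; exact h2.trans h1
  set J := ∫⁻ x, ENNReal.ofReal (φ x) with hJ
  have hJlow : ENNReal.ofReal (1 / t) ≤ J := by
    set B := Metric.closedBall ((R + r + 1) • e) R with hB
    calc ENNReal.ofReal (1 / t) ≤ volume B := by
          rw [hB, volume_closedBall_eq _ (by linarith)]
          exact ENNReal.ofReal_le_ofReal hvol
      _ = ∫⁻ _ in B, 1 := by simp
      _ ≤ ∫⁻ x in B, ENNReal.ofReal (φ x) := by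
          refine setLIntegral_mono' Metric.isClosed_closedBall.measurableSet fun x hx => ?_
          rw [hB, Metric.mem_closedBall, dist_eq_norm] at hx
          have h1 : ‖(R + r + 1) • e‖ = R + r + 1 := by
            rw [norm_smul, he, mul_one, Real.norm_of_nonneg (by linarith)]
          have h2 := abs_le.mp ((abs_norm_sub_norm_le x ((R + r + 1) • e)).trans hx)
          rw [h1] at h2
          have h3 : φ x = 1 := by
            refine le_antisymm (hφ1 x) (le_max_of_le_right (le_min le_rfl (le_min ?_ ?_)))
            · linarith [h2.1]
            · rw [hM]; linarith [h2.2]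
          rw [h3, ENNReal.ofReal_one]
      _ ≤ J := setLIntegral_le_lintegral _ _
  have hJtop : J ≠ ⊤ := by
    have : J ≤ volume (Metric.closedBall (0 : Euc D) M) := by
      rw [← setLIntegral_one, ← lintegral_indicator Metric.isClosed_closedBall.measurableSet]
      refine lintegral_mono fun x => ?_
      by_cases hx : x ∈ Metric.closedBall (0 : Euc D) M
      · rw [Set.indicator_of_mem hx]
        exact ENNReal.ofReal_le_one.mpr (hφ1 x)
      · rw [Set.indicator_of_notMem hx]
        rw [Metric.mem_closedBall, dist_zero_right, not_le] at hx
        have h3 : φ x = 0 := max_eq_left ((min_le_right _ _).trans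
          ((min_le_right _ _).trans (by linarith)))
        rw [h3, ENNReal.ofReal_zero]
    exact (this.trans_lt measure_closedBall_lt_top).ne
  have hJr : 1 / t ≤ J.toReal := (ENNReal.ofReal_le_iff_le_toReal hJtop).mp hJlow
  have hJ0 : 0 < J.toReal := lt_of_lt_of_le (by positivity) hJr
  refine ⟨fun x => J.toReal⁻¹ * φ x, by fun_prop, fun x => by have := hφ0 x; positivity,
    fun x => ?_, fun x hx => ?_, ?_⟩
  · calc J.toReal⁻¹ * φ x ≤ J.toReal⁻¹ * 1 := by gcongr; exact hφ1 x
      _ ≤ t := by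
        rw [mul_one, inv_le_comm₀ hJ0 ht]
        rwa [one_div] at hJr
  · have h3 : φ x = 0 := max_eq_left ((min_le_right _ _).trans
      ((min_le_left _ _).trans (by linarith)))
    simp only [h3, mul_zero]
  · simp_rw [ENNReal.ofReal_mul (inv_nonneg.mpr hJ0.le)]
    rw [lintegral_const_mul _ (by fun_prop), ← hJ, ENNReal.ofReal_inv_of_pos hJ0,
      ENNReal.ofReal_toReal hJtop, ENNReal.inv_mul_cancel _ hJtop]
    intro h0
    rw [h0] at hJ0
    simp at hJ0

/-- `q` is comparable to the distance to `z`, and equal to the norm off a ball of radius `2 s`. -/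
structure IsProfile (s : ℝ) (z : Euc D) (q : Euc D → ℝ) : Prop where
  continuous : Continuous q
  lower : ∀ x, ‖x - z‖ / 2 ≤ q x
  upper : ∀ x, q x ≤ 2 * ‖x - z‖
  far : ∀ x, 2 * s ≤ ‖x‖ → q x = ‖x‖
  near : ∀ x, ‖x‖ ≤ 2 * s → q x ≤ 2 * s
  norm_le : ‖z‖ ≤ s

lemma isProfile_norm {s : ℝ} (hs : 0 ≤ s) : IsProfile s (0 : Euc D) (fun x => ‖x‖) where
  continuous := continuous_norm
  lower x := by rw [sub_zero]; linarith [norm_nonneg x]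
  upper x := by rw [sub_zero]; linarith [norm_nonneg x]
  far x _ := rfl
  near x h := h
  norm_le := by simpa using hs

/-- The inner minimum vanishes for `‖x‖ ≤ s`, so the zero moves to `z`, and it equals `‖x‖` from
`2s` on; `‖x‖ - s ≤ ‖x - z‖` keeps it comparable to the distance to `z`. -/
lemma isProfile_shifted {s : ℝ} (hs : 0 ≤ s) {z : Euc D} (hz : ‖z‖ = s) :
    IsProfile s z (fun x => max (‖x - z‖ / 2) (min ‖x‖ (2 * max 0 (‖x‖ - s)))) where
  continuous := by fun_prop
  lower x := le_max_left _ _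
  upper x := by
    have h1 := norm_sub_norm_le x z
    have h2 := norm_nonneg (x - z)
    refine max_le (by linarith) ((min_le_right _ _).trans ?_)
    have : max 0 (‖x‖ - s) ≤ ‖x - z‖ := max_le h2 (by linarith)
    linarith
  far x hx := by
    have h1 := norm_sub_le x z
    rw [max_eq_right (by linarith : (0 : ℝ) ≤ ‖x‖ - s), min_eq_left (by linarith),
      max_eq_right (by linarith)]
  near x hx := by
    have h1 := norm_sub_le x z
    exact max_le (by linarith) ((min_le_left _ _).trans hx)
  norm_le := hz.le

lemma IsProfile.nonneg {s : ℝ} {z : Euc D} {q : Euc D → ℝ} (hq : IsProfile s z q) (x : Euc D) :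
    0 ≤ q x := le_trans (by positivity) (hq.lower x)

/-- The data from which the two hypotheses of the lower bound are built: a level `lam`, an
exponent `β`, a radius `r` of the peak, and a low density `b` away from the peak. -/
structure PeakData (D : ℕ) where
  (lam β r : ℝ)
  b : Euc D → ℝ
  lam_pos : 0 < lam
  beta_pos : 0 < β
  r_pos : 0 < r
  r_le : r ≤ 1
  mass_le : lam * (unitBallVol D * r ^ D) ≤ 1 / 2
  b_cont : Continuous b
  b_nonneg : ∀ x, 0 ≤ b x
  b_le : ∀ x, b x ≤ lam / 4
  b_zero : ∀ x, ‖x‖ ≤ r → b x = 0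
  b_mass : ∫⁻ x, ENNReal.ofReal (b x) = 1

namespace PeakData

variable (W : PeakData D)

/-- The slope `κ = lam / r^β` of the peak. -/
noncomputable def slope : ℝ := W.lam / W.r ^ W.β

/-- The radius of the ball `{f ≥ lam / 2}`. -/
noncomputable def halfRadius : ℝ := W.r * (1 / 2) ^ (1 / W.β)

/-- The peak `(lam - κ q^β)⁺`. -/
noncomputable def peak (q : Euc D → ℝ) (x : Euc D) : ℝ := max 0 (W.lam - W.slope * q x ^ W.β)

/-- The mass of the peak. -/
noncomputable def peakMass (q : Euc D → ℝ) : ℝ := (∫⁻ x, ENNReal.ofReal (W.peak q x)).toReal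

/-- The density with the given peak. -/
noncomputable def density (q : Euc D → ℝ) (x : Euc D) : ℝ := W.peak q x + (1 - W.peakMass q) * W.b x

/-- The constants of the separation conditions met by the densities. -/
noncomputable def params : Params where
  beta := W.β
  cLow := W.slope / 2 ^ W.β
  cUp := W.slope * 2 ^ W.β
  rs := 1
  rc := W.halfRadius / 4
  lam0 := W.lam / 2
  fmax := W.lam
  beta_pos := W.beta_pos
  cLow_pos := by
    have := W.lam_pos; have := W.r_pos
    unfold slope; positivity
  cUp_pos := by
    have := W.lam_pos; have := W.r_pos
    unfold slope; positivity
  rs_pos := one_pos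
  rc_pos := by
    have := W.r_pos
    unfold halfRadius; positivity
  lam0_pos := half_pos W.lam_pos
  fmax_pos := W.lam_pos

lemma slope_pos : 0 < W.slope := by
  have := W.lam_pos; have := W.r_pos
  unfold slope; positivity

lemma halfRadius_pos : 0 < W.halfRadius := by
  have := W.r_pos
  unfold halfRadius; positivity

lemma halfRadius_lt : W.halfRadius < W.r := by
  have h : ((1 : ℝ) / 2) ^ (1 / W.β) < 1 :=
    Real.rpow_lt_one (by norm_num) (by norm_num) (one_div_pos.mpr W.beta_pos)
  exact mul_lt_of_lt_one_right W.r_pos h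

lemma slope_mul_r : W.slope * W.r ^ W.β = W.lam := by
  have := W.r_pos
  unfold slope; field_simp

lemma slope_mul_halfRadius : W.slope * W.halfRadius ^ W.β = W.lam / 2 := by
  have hβ := W.beta_pos
  rw [halfRadius, Real.mul_rpow W.r_pos.le (by positivity), ← Real.rpow_mul (by norm_num),
    one_div_mul_cancel hβ.ne', Real.rpow_one, ← mul_assoc, slope_mul_r]
  ring

variable {W} {s : ℝ} {z : Euc D} {q : Euc D → ℝ}

lemma continuous_peak (hq : IsProfile s z q) : Continuous (W.peak q) := by
  refine continuous_const.max (continuous_const.sub (continuous_const.mul ?_))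
  exact hq.continuous.rpow_const fun x => Or.inr W.beta_pos.le

lemma peak_nonneg (x : Euc D) : 0 ≤ W.peak q x := le_max_left _ _

lemma peak_le (hq : IsProfile s z q) (x : Euc D) : W.peak q x ≤ W.lam :=
  max_le W.lam_pos.le (sub_le_self _ (mul_nonneg W.slope_pos.le (Real.rpow_nonneg (hq.nonneg x) _)))

lemma peak_eq_zero (hq : IsProfile s z q) (hs : s ≤ W.halfRadius / 4) {x : Euc D}
    (hx : W.r ≤ ‖x‖) : W.peak q x = 0 := by
  have h1 := W.halfRadius_lt
  have h2 := W.halfRadius_pos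
  have h3 : q x = ‖x‖ := hq.far x (by linarith)
  have h4 : W.lam ≤ W.slope * q x ^ W.β := by
    rw [← W.slope_mul_r, h3]
    exact mul_le_mul_of_nonneg_left (Real.rpow_le_rpow W.r_pos.le hx W.beta_pos.le) W.slope_pos.le
  exact max_eq_left (by linarith)

lemma peak_eq {x : Euc D} (hq : IsProfile s z q) (hs : s ≤ W.halfRadius / 4) (hx : ‖x‖ < W.r) :
    W.peak q x = W.lam - W.slope * q x ^ W.β := by
  have h1 : q x ≤ W.r := by
    rcases le_total (2 * s) ‖x‖ with h | h
    · rw [hq.far x h]; exact hx.le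
    · exact (hq.near x h).trans (by linarith [W.halfRadius_lt, W.halfRadius_pos])
  have h2 : W.slope * q x ^ W.β ≤ W.lam := by
    rw [← W.slope_mul_r]
    exact mul_le_mul_of_nonneg_left (Real.rpow_le_rpow (hq.nonneg x) h1 W.beta_pos.le)
      W.slope_pos.le
  exact max_eq_right (by linarith)

/-- This leaves `b` a weight of at least `1/2`, which later bounds the density from below away from
the peak. -/
lemma lintegral_peak_le (hq : IsProfile s z q) (hs : s ≤ W.halfRadius / 4) :
    ∫⁻ x, ENNReal.ofReal (W.peak q x) ≤ ENNReal.ofReal (1 / 2) := by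
  calc ∫⁻ x, ENNReal.ofReal (W.peak q x) ≤
      ∫⁻ x, (Metric.closedBall (0 : Euc D) W.r).indicator
        (fun _ => ENNReal.ofReal W.lam) x := by
        refine lintegral_mono fun x => ?_
        by_cases hx : x ∈ Metric.closedBall (0 : Euc D) W.r
        · rw [Set.indicator_of_mem hx]
          exact ENNReal.ofReal_le_ofReal (peak_le hq x)
        · rw [Set.indicator_of_notMem hx]
          rw [Metric.mem_closedBall, dist_zero_right, not_le] at hx
          rw [peak_eq_zero hq hs hx.le, ENNReal.ofReal_zero]
    _ = ENNReal.ofReal (W.lam * (unitBallVol D * W.r ^ D)) := by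
        rw [lintegral_indicator_const Metric.isClosed_closedBall.measurableSet,
          volume_closedBall_eq _ W.r_pos.le, ENNReal.ofReal_mul W.lam_pos.le]
    _ ≤ _ := ENNReal.ofReal_le_ofReal W.mass_le

lemma ofReal_peakMass (hq : IsProfile s z q) (hs : s ≤ W.halfRadius / 4) :
    ENNReal.ofReal (W.peakMass q) = ∫⁻ x, ENNReal.ofReal (W.peak q x) :=
  ENNReal.ofReal_toReal ((lintegral_peak_le hq hs).trans_lt ENNReal.ofReal_lt_top).ne

lemma peakMass_nonneg : 0 ≤ W.peakMass q := ENNReal.toReal_nonneg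

lemma peakMass_le (hq : IsProfile s z q) (hs : s ≤ W.halfRadius / 4) : W.peakMass q ≤ 1 / 2 :=
  ENNReal.toReal_le_of_le_ofReal (by norm_num) (lintegral_peak_le hq hs)

lemma continuous_density (hq : IsProfile s z q) : Continuous (W.density q) :=
  (continuous_peak hq).add (continuous_const.mul W.b_cont)

lemma density_nonneg (hq : IsProfile s z q) (hs : s ≤ W.halfRadius / 4) (x : Euc D) :
    0 ≤ W.density q x :=
  add_nonneg (peak_nonneg x)
    (mul_nonneg (by linarith [peakMass_le (W := W) hq hs]) (W.b_nonneg x))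

lemma lintegral_density (hq : IsProfile s z q) (hs : s ≤ W.halfRadius / 4) :
    ∫⁻ x, ENNReal.ofReal (W.density q x) = 1 := by
  have h1 := peakMass_le hq hs
  have h2 : 0 ≤ W.peakMass q := peakMass_nonneg
  unfold density
  simp_rw [ENNReal.ofReal_add (peak_nonneg _)
    (mul_nonneg (by linarith : 0 ≤ 1 - W.peakMass q) (W.b_nonneg _)),
    ENNReal.ofReal_mul (by linarith : 0 ≤ 1 - W.peakMass q)]
  rw [lintegral_add_left (continuous_peak hq).measurable.ennreal_ofReal,
    lintegral_const_mul _ W.b_cont.measurable.ennreal_ofReal, W.b_mass, ← ofReal_peakMass hq hs,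
    mul_one, ← ENNReal.ofReal_add h2 (by linarith)]
  simp

lemma density_eq {x : Euc D} (hq : IsProfile s z q) (hs : s ≤ W.halfRadius / 4) (hx : ‖x‖ < W.r) :
    W.density q x = W.lam - W.slope * q x ^ W.β := by
  rw [density, peak_eq hq hs hx, W.b_zero x hx.le, mul_zero, add_zero]

lemma density_le_quarter {x : Euc D} (hq : IsProfile s z q) (hs : s ≤ W.halfRadius / 4)
    (hx : W.r ≤ ‖x‖) : W.density q x ≤ W.lam / 4 := by
  rw [density, peak_eq_zero hq hs hx, zero_add]
  refine (mul_le_of_le_one_left (W.b_nonneg x) ?_).trans (W.b_le x)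
  linarith [peakMass_nonneg (W := W) (q := q)]

lemma levelSet_top (hq : IsProfile s z q) (hs : s ≤ W.halfRadius / 4) :
    levelSet (W.density q) W.lam = {z} := by
  have hlam := W.lam_pos
  have hκ := W.slope_pos
  ext x
  rw [Set.mem_singleton_iff]
  constructor
  · intro hx
    have hx' : W.lam ≤ W.density q x := hx
    have hxr : ‖x‖ < W.r := by
      by_contra hcon
      push Not at hcon
      linarith [density_le_quarter hq hs hcon]
    rw [density_eq hq hs hxr] at hx'
    have h1 : q x ^ W.β ≤ 0 := by nlinarith
    have h2 : q x = 0 := by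
      by_contra hne
      have : 0 < q x := lt_of_le_of_ne (hq.nonneg x) (Ne.symm hne)
      linarith [Real.rpow_pos_of_pos this W.β]
    have h3 := hq.lower x
    rw [h2] at h3
    have h4 : ‖x - z‖ = 0 := le_antisymm (by linarith) (norm_nonneg _)
    exact sub_eq_zero.mp (norm_eq_zero.mp h4)
  · rintro rfl
    have hxr : ‖x‖ < W.r := by linarith [hq.norm_le, W.halfRadius_lt, W.halfRadius_pos]
    have h1 : q x = 0 := le_antisymm (by simpa using hq.upper x) (hq.nonneg x)
    change W.lam ≤ W.density q x
    rw [density_eq hq hs hxr, h1, Real.zero_rpow W.beta_pos.ne', mul_zero, sub_zero]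

lemma profile_le {x : Euc D} (hq : IsProfile s z q) {t : ℝ} (hs : 2 * s ≤ t) (hx : ‖x‖ ≤ t) :
    q x ≤ t := by
  rcases le_total (2 * s) ‖x‖ with h | h
  · rwa [hq.far x h]
  · exact (hq.near x h).trans hs

lemma levelSet_half (hq : IsProfile s z q) (hs : s ≤ W.halfRadius / 4) :
    levelSet (W.density q) (W.lam / 2) = Metric.closedBall 0 W.halfRadius := by
  have hlam := W.lam_pos
  have hκ := W.slope_pos
  have ht := W.halfRadius_pos
  ext x
  rw [Metric.mem_closedBall, dist_zero_right]
  constructor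
  · intro hx
    have hx' : W.lam / 2 ≤ W.density q x := hx
    have hxr : ‖x‖ < W.r := by
      by_contra hcon
      push Not at hcon
      linarith [density_le_quarter hq hs hcon]
    rw [density_eq hq hs hxr] at hx'
    by_contra hcon
    push Not at hcon
    have h2 : W.halfRadius < q x := by rwa [hq.far x (by linarith)]
    have h3 := mul_lt_mul_of_pos_left (Real.rpow_lt_rpow ht.le h2 W.beta_pos) hκ
    rw [slope_mul_halfRadius] at h3
    linarith
  · intro hx
    change W.lam / 2 ≤ W.density q x
    rw [density_eq hq hs (hx.trans_lt W.halfRadius_lt)]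
    have h3 := mul_le_mul_of_nonneg_left (Real.rpow_le_rpow (hq.nonneg x)
      (profile_le hq (by linarith) hx) W.beta_pos.le) hκ.le
    rw [slope_mul_halfRadius] at h3
    linarith

lemma levelComponents_of_isPreconnected {f : Euc D → ℝ} {t : ℝ}
    (h : IsPreconnected (levelSet f t)) (hne : (levelSet f t).Nonempty) :
    levelComponents f t = {levelSet f t} := by
  ext C
  rw [Set.mem_singleton_iff]
  constructor
  · rintro ⟨x, hx, rfl⟩
    exact h.connectedComponentIn hx
  · rintro rfl
    obtain ⟨x, hx⟩ := hne
    exact ⟨x, hx, (h.connectedComponentIn hx).symm⟩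

lemma levelComponents_top (hq : IsProfile s z q) (hs : s ≤ W.halfRadius / 4) :
    levelComponents (W.density q) W.lam = {{z}} := by
  have h := levelSet_top hq hs
  rw [levelComponents_of_isPreconnected (h ▸ isPreconnected_singleton)
    (h ▸ Set.singleton_nonempty z), h]

lemma levelComponents_half (hq : IsProfile s z q) (hs : s ≤ W.halfRadius / 4) :
    levelComponents (W.density q) (W.lam / 2) = {Metric.closedBall 0 W.halfRadius} := by
  have h := levelSet_half hq hs
  rw [levelComponents_of_isPreconnected (h ▸ (convex_closedBall _ _).isPreconnected)
    (h ▸ Metric.nonempty_closedBall.mpr W.halfRadius_pos.le), h]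

theorem admissible (hq : IsProfile s z q) (hs : s ≤ W.halfRadius / 4) :
    Admissible W.params W.lam (W.density q) where
  continuous := continuous_density hq
  nonneg := density_nonneg hq hs
  le_fmax x := by
    change W.density q x ≤ W.lam
    rcases lt_or_ge ‖x‖ W.r with h | h
    · rw [density_eq hq hs h]
      exact sub_le_self _ (mul_nonneg W.slope_pos.le (Real.rpow_nonneg (hq.nonneg x) _))
    · linarith [density_le_quarter hq hs h, W.lam_pos]
  lintegral_eq_one := lintegral_density hq hs
  lam0_lt := half_lt_self W.lam_pos
  separation := by
    have hlam := W.lam_pos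
    have hκ := W.slope_pos
    have ht := W.halfRadius_pos
    intro C hC
    rw [levelComponents_top hq hs, Set.mem_singleton_iff] at hC
    subst hC
    have hthick : Metric.cthickening W.params.rc {z} = Metric.closedBall z (W.halfRadius / 4) :=
      Metric.cthickening_singleton z W.params.rc_pos.le
    have hball : Metric.closedBall z (W.halfRadius / 4) ⊆ Metric.closedBall 0 W.halfRadius :=
      Metric.closedBall_subset_closedBall' (by
        rw [dist_zero_right]; linarith [hq.norm_le])
    -- The lower level set is this ball, so there is nothing to separate it from: the empty
    -- separator works, with supremum `⊥`.
    refine ⟨Metric.closedBall 0 W.halfRadius, ?_, ?_, ⟨∅, ?_, ?_⟩, ?_, ?_⟩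
    · change _ ∈ levelComponents (W.density q) (W.lam / 2)
      rw [levelComponents_half hq hs]
      exact Set.mem_singleton _
    · intro C' hC' hne
      rw [levelComponents_top hq hs, Set.mem_singleton_iff] at hC'
      exact absurd hC' hne
    · rintro x - y ⟨hy, hy'⟩
      change y ∈ levelSet (W.density q) (W.lam / 2) at hy
      rw [levelSet_half hq hs] at hy
      exact absurd hy hy'
    · have h1 : ((W.lam / 2 : ℝ) : EReal) ≤ ⨅ x ∈ Metric.closedBall 0 W.halfRadius ∪
          (levelSet (W.density q) W.params.lam0 \ Metric.closedBall 0 W.halfRadius),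
          (W.density q x : EReal) := by
        refine le_iInf₂ fun x hx => ?_
        have hx' : x ∈ levelSet (W.density q) (W.lam / 2) := by
          rcases hx with hx | hx
          · rwa [levelSet_half hq hs]
          · exact hx.1
        exact EReal.coe_le_coe_iff.mpr hx'
      refine lt_of_lt_of_le ?_ h1
      simp
    · rw [hthick]; exact hball
    · rintro x ⟨hx, -⟩
      rw [hthick] at hx
      have hx0 := hball hx
      rw [Metric.mem_closedBall, dist_zero_right] at hx0
      rw [density_eq hq hs (hx0.trans_lt W.halfRadius_lt), Metric.infDist_singleton, dist_eq_norm,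
        sub_sub_cancel]
      have hβ := W.beta_pos
      have h2 : ‖x - z‖ ^ W.β / 2 ^ W.β ≤ q x ^ W.β := by
        rw [← Real.div_rpow (norm_nonneg _) (by norm_num)]
        exact Real.rpow_le_rpow (by positivity) (hq.lower x) hβ.le
      have h3 : q x ^ W.β ≤ 2 ^ W.β * ‖x - z‖ ^ W.β := by
        rw [← Real.mul_rpow (by norm_num) (norm_nonneg _)]
        exact Real.rpow_le_rpow (hq.nonneg x) (hq.upper x) hβ.le
      constructor
      · calc W.slope / 2 ^ W.β * ‖x - z‖ ^ W.β = W.slope * (‖x - z‖ ^ W.β / 2 ^ W.β) := by ring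
          _ ≤ _ := mul_le_mul_of_nonneg_left h2 hκ.le
      · calc W.slope * q x ^ W.β ≤ W.slope * (2 ^ W.β * ‖x - z‖ ^ W.β) :=
              mul_le_mul_of_nonneg_left h3 hκ.le
          _ = W.slope * 2 ^ W.β * ‖x - z‖ ^ W.β := by ring

theorem le_gap (hq : IsProfile s z q) (hs : s ≤ W.halfRadius / 4) :
    min (3 * W.lam / 4) (W.slope * (W.halfRadius / 8) ^ W.β) ≤
      gap (W.density q) W.lam W.params.rc := by
  have hlam := W.lam_pos
  have hκ := W.slope_pos
  have ht := W.halfRadius_pos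
  set γ := min (3 * W.lam / 4) (W.slope * (W.halfRadius / 8) ^ W.β) with hγ
  have h1 : γ ≤ 3 * W.lam / 4 := min_le_left _ _
  suffices h : sSup (W.density q '' (⋃ C ∈ levelComponents (W.density q) W.lam,
      Metric.cthickening W.params.rc C)ᶜ) ≤ W.lam - γ by
    unfold gap; linarith
  refine Real.sSup_le ?_ (by linarith)
  rintro _ ⟨x, hx, rfl⟩
  rw [levelComponents_top hq hs, Set.biUnion_singleton] at hx
  rcases lt_or_ge ‖x‖ W.r with h | h
  · rw [density_eq hq hs h]
    have hx' : W.halfRadius / 4 < ‖x - z‖ := by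
      by_contra hcon
      push Not at hcon
      refine hx (Metric.mem_cthickening_of_dist_le x z _ _ rfl ?_)
      rwa [dist_eq_norm]
    have h2 : W.halfRadius / 8 ≤ q x := by linarith [hq.lower x]
    have h3 := mul_le_mul_of_nonneg_left (Real.rpow_le_rpow (by positivity) h2 W.beta_pos.le) hκ.le
    have h4 : γ ≤ W.slope * (W.halfRadius / 8) ^ W.β := min_le_right _ _
    linarith
  · linarith [density_le_quarter hq hs h]

end PeakData

end Construction

/-! ### Minimax lower bound -/

section LowerBound

variable {D : ℕ}

namespace PeakData

variable {W : PeakData D} {s : ℝ} {z z' : Euc D} {q q' : Euc D → ℝ}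

lemma peak_eq_of_far (hq : IsProfile s z q) (hq' : IsProfile s z' q') {x : Euc D}
    (hx : 2 * s ≤ ‖x‖) : W.peak q x = W.peak q' x := by
  rw [peak, peak, hq.far x hx, hq'.far x hx]

lemma peak_sub_le (hq : IsProfile s z q) (hq' : IsProfile s z' q')
    (hs : s ≤ W.halfRadius / 4) {x : Euc D} (hx : ‖x‖ ≤ 2 * s) :
    W.peak q x - W.peak q' x ≤ W.slope * (2 * s) ^ W.β := by
  have hr : ‖x‖ < W.r := by linarith [W.halfRadius_lt, W.halfRadius_pos]
  rw [peak_eq hq hs hr, peak_eq hq' hs hr]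
  have h1 := mul_nonneg W.slope_pos.le (Real.rpow_nonneg (hq.nonneg x) W.β)
  have h2 := mul_le_mul_of_nonneg_left (Real.rpow_le_rpow (hq'.nonneg x) (hq'.near x hx)
    W.beta_pos.le) W.slope_pos.le
  linarith

lemma peakMass_sub_le (hs0 : 0 ≤ s) (hq : IsProfile s z q) (hq' : IsProfile s z' q')
    (hs : s ≤ W.halfRadius / 4) :
    W.peakMass q - W.peakMass q' ≤ W.slope * (2 * s) ^ W.β * (unitBallVol D * (2 * s) ^ D) := by
  have hv := unitBallVol_pos D
  have hκ := W.slope_pos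
  set d := W.slope * (2 * s) ^ W.β with hd
  have hd0 : 0 ≤ d := by positivity
  have hV : 0 ≤ unitBallVol D * (2 * s) ^ D := by positivity
  have h : ENNReal.ofReal (W.peakMass q) ≤
      ENNReal.ofReal (W.peakMass q' + d * (unitBallVol D * (2 * s) ^ D)) := by
    rw [ENNReal.ofReal_add peakMass_nonneg (by positivity), ofReal_peakMass hq hs,
      ofReal_peakMass hq' hs, ENNReal.ofReal_mul hd0,
      ← volume_closedBall_eq (0 : Euc D) (by positivity),
      ← lintegral_indicator_const Metric.isClosed_closedBall.measurableSet,
      ← lintegral_add_left (continuous_peak hq').measurable.ennreal_ofReal]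
    refine lintegral_mono fun x => ?_
    by_cases hx : x ∈ Metric.closedBall (0 : Euc D) (2 * s)
    · rw [Set.indicator_of_mem hx, ← ENNReal.ofReal_add (peak_nonneg x) hd0]
      rw [Metric.mem_closedBall, dist_zero_right] at hx
      exact ENNReal.ofReal_le_ofReal (by linarith [peak_sub_le hq hq' hs hx])
    · rw [Set.indicator_of_notMem hx, add_zero]
      rw [Metric.mem_closedBall, dist_zero_right, not_le] at hx
      rw [peak_eq_of_far hq hq' hx.le]
  rw [ENNReal.ofReal_le_ofReal_iff (add_nonneg peakMass_nonneg (by positivity))] at h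
  linarith

lemma half_le_density (hq : IsProfile s z q) (hs : s ≤ W.halfRadius / 4) {x : Euc D}
    (hx : ‖x‖ ≤ 2 * s) : W.lam / 2 ≤ W.density q x := by
  have h : x ∈ levelSet (W.density q) (W.lam / 2) := by
    rw [levelSet_half hq hs, Metric.mem_closedBall, dist_zero_right]
    linarith [W.halfRadius_pos]
  exact h

/-- Absolute continuity is the point: where the first density vanishes, the peaks agree and are zero
and `b` is zero, so the second vanishes too. -/
lemma densityLaw_eq_withDensity (hq : IsProfile s z q) (hq' : IsProfile s z' q')
    (hs : s ≤ W.halfRadius / 4) :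
    densityLaw (W.density q') = (densityLaw (W.density q)).withDensity
      fun x => ENNReal.ofReal (W.density q' x / W.density q x) := by
  have hm := (continuous_density (W := W) hq).measurable
  have hm' := (continuous_density (W := W) hq').measurable
  have hr : Measurable fun x => ENNReal.ofReal (W.density q' x / W.density q x) :=
    (hm'.div hm).ennreal_ofReal
  rw [densityLaw, densityLaw, ← withDensity_mul _ hm.ennreal_ofReal hr]
  congr 1
  ext x
  rw [Pi.mul_apply, ← ENNReal.ofReal_mul (density_nonneg hq hs x)]
  congr 1
  refine (mul_div_cancel_of_imp' fun h0 => ?_).symm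
  rcases le_total ‖x‖ (2 * s) with hx | hx
  · linarith [half_le_density hq hs hx, W.lam_pos]
  · have h1 := peakMass_le (W := W) hq hs
    have h2 := W.b_nonneg x
    have h3 : 0 ≤ W.peak q x := peak_nonneg x
    have h4 : W.b x * (1 / 2) ≤ (1 - W.peakMass q) * W.b x := by nlinarith
    rw [density] at h0
    have h5 : W.b x = 0 := by linarith
    rw [density, ← peak_eq_of_far hq hq' hx, h5]
    rw [h5] at h0
    linarith

/-- The bound on the `χ²`-divergence. -/
noncomputable def chiSq (W : PeakData D) (s : ℝ) : ℝ :=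
  2 / W.lam * (W.slope * (2 * s) ^ W.β) ^ 2 * (unitBallVol D * (2 * s) ^ D) +
    2 * (W.slope * (2 * s) ^ W.β * (unitBallVol D * (2 * s) ^ D)) ^ 2

/-- With `f`, `f'` the two densities, this is `(f' - f)² ≤ w f` divided by `f`, arranged without
subtraction for integration in `ℝ≥0∞`. Near the peak `f ≥ lam / 2`; elsewhere `f ≥ b / 2` and the
densities differ only through the peak masses. -/
lemma density_sq_le (hs0 : 0 ≤ s) (hq : IsProfile s z q) (hq' : IsProfile s z' q')
    (hs : s ≤ W.halfRadius / 4) (x : Euc D) :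
    W.density q x * (W.density q' x / W.density q x) ^ 2 + W.density q x ≤
      2 * W.density q' x + (Metric.closedBall (0 : Euc D) (2 * s)).indicator
        (fun _ => 2 / W.lam * (W.slope * (2 * s) ^ W.β) ^ 2) x +
      2 * (W.slope * (2 * s) ^ W.β * (unitBallVol D * (2 * s) ^ D)) ^ 2 * W.b x := by
  have hlam := W.lam_pos
  have hκ := W.slope_pos
  have hv := unitBallVol_pos D
  set d := W.slope * (2 * s) ^ W.β with hd
  have hd0 : 0 ≤ d := by positivity
  set Δ := d * (unitBallVol D * (2 * s) ^ D) with hΔ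
  have hΔ0 : 0 ≤ Δ := by positivity
  set w := (Metric.closedBall (0 : Euc D) (2 * s)).indicator (fun _ => 2 / W.lam * d ^ 2) x +
    2 * Δ ^ 2 * W.b x with hw
  have hb := W.b_nonneg x
  have hind0 : 0 ≤ (Metric.closedBall (0 : Euc D) (2 * s)).indicator
      (fun _ => 2 / W.lam * d ^ 2) x := Set.indicator_nonneg (fun _ _ => by positivity) _
  have hw0 : 0 ≤ w := add_nonneg hind0 (by positivity)
  have hf0 := density_nonneg (W := W) hq hs x
  have hf1 := density_nonneg (W := W) hq' hs x
  have hm := peakMass_le (W := W) hq hs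
  have key : (W.density q' x - W.density q x) ^ 2 ≤ w * W.density q x := by
    rcases le_or_gt ‖x‖ (2 * s) with hx | hx
    · have hmem : x ∈ Metric.closedBall (0 : Euc D) (2 * s) := by
        rwa [Metric.mem_closedBall, dist_zero_right]
      have hbx : W.b x = 0 := W.b_zero x (by linarith [W.halfRadius_lt, W.halfRadius_pos])
      have h1 := peak_sub_le (W := W) hq hq' hs hx
      have h2 := peak_sub_le (W := W) hq' hq hs hx
      have h3 := half_le_density (W := W) hq hs hx
      have h4 : (W.density q' x - W.density q x) ^ 2 ≤ d ^ 2 := by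
        refine sq_le_sq' ?_ ?_ <;> · rw [density, density, hbx]; linarith
      have h5 : w = 2 / W.lam * d ^ 2 := by
        rw [hw, Set.indicator_of_mem hmem, hbx, mul_zero, add_zero]
      calc _ ≤ d ^ 2 := h4
        _ = 2 / W.lam * d ^ 2 * (W.lam / 2) := by field_simp
        _ ≤ w * W.density q x := by rw [h5]; gcongr
    · have hp := peak_eq_of_far (W := W) hq hq' hx.le
      have h1 := peakMass_sub_le (W := W) hs0 hq hq' hs
      have h2 := peakMass_sub_le (W := W) hs0 hq' hq hs
      have h3 : (W.peakMass q - W.peakMass q') ^ 2 ≤ Δ ^ 2 := sq_le_sq' (by linarith) h1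
      have h4 : W.b x / 2 ≤ W.density q x := by
        have : 0 ≤ W.peak q x := peak_nonneg x
        rw [density]; nlinarith
      calc (W.density q' x - W.density q x) ^ 2 =
            (W.peakMass q - W.peakMass q') ^ 2 * W.b x ^ 2 := by
            rw [density, density, ← hp]; ring
        _ ≤ Δ ^ 2 * W.b x ^ 2 := by gcongr
        _ = 2 * Δ ^ 2 * W.b x * (W.b x / 2) := by ring
        _ ≤ w * W.density q x := by
            refine mul_le_mul ?_ h4 (by positivity) hw0
            rw [hw]; linarith
  rw [add_assoc, ← hw]
  rcases hf0.eq_or_lt with h0 | h0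
  · rw [← h0]; simp only [zero_mul, zero_add]; positivity
  · have h1 : W.density q x * (W.density q' x / W.density q x) ^ 2 =
        W.density q' x ^ 2 / W.density q x := by field_simp
    have h2 : W.density q' x ^ 2 / W.density q x ≤ 2 * W.density q' x + w - W.density q x := by
      rw [div_le_iff₀ h0]
      linarith
    linarith

lemma lintegral_ratio_sq_le (hs0 : 0 ≤ s) (hq : IsProfile s z q) (hq' : IsProfile s z' q')
    (hs : s ≤ W.halfRadius / 4) :
    ∫⁻ x, ENNReal.ofReal (W.density q' x / W.density q x) ^ 2 ∂(densityLaw (W.density q)) ≤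
      ENNReal.ofReal (1 + W.chiSq s) := by
  have hlam := W.lam_pos
  have hκ := W.slope_pos
  have hv := unitBallVol_pos D
  have hm := (continuous_density (W := W) hq).measurable
  have hm' := (continuous_density (W := W) hq').measurable
  set d := W.slope * (2 * s) ^ W.β with hd
  have hd0 : 0 ≤ d := by positivity
  set Δ := d * (unitBallVol D * (2 * s) ^ D) with hΔ
  have hΔ0 : 0 ≤ Δ := by positivity
  have hχ : W.chiSq s = 2 / W.lam * d ^ 2 * (unitBallVol D * (2 * s) ^ D) + 2 * Δ ^ 2 := rfl
  have hr : Measurable fun x => ENNReal.ofReal (W.density q' x / W.density q x) :=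
    (hm'.div hm).ennreal_ofReal
  rw [densityLaw, lintegral_withDensity_eq_lintegral_mul _ hm.ennreal_ofReal (hr.pow_const 2)]
  have h1 : ∀ x, ((fun x => ENNReal.ofReal (W.density q x)) *
      fun x => ENNReal.ofReal (W.density q' x / W.density q x) ^ 2) x =
      ENNReal.ofReal (W.density q x * (W.density q' x / W.density q x) ^ 2) := by
    intro x
    rw [Pi.mul_apply, ENNReal.ofReal_mul (density_nonneg hq hs x), ENNReal.ofReal_pow
      (div_nonneg (density_nonneg hq' hs x) (density_nonneg hq hs x))]
  simp_rw [h1]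
  have h2 : (∫⁻ x, ENNReal.ofReal (W.density q x * (W.density q' x / W.density q x) ^ 2)) + 1 ≤
      ENNReal.ofReal (1 + W.chiSq s) + 1 := by
    calc _ = ∫⁻ x, (ENNReal.ofReal (W.density q x * (W.density q' x / W.density q x) ^ 2) +
          ENNReal.ofReal (W.density q x)) := by
          rw [lintegral_add_right _ hm.ennreal_ofReal, lintegral_density hq hs]
      _ ≤ ∫⁻ x, (ENNReal.ofReal 2 * ENNReal.ofReal (W.density q' x) +
          (Metric.closedBall (0 : Euc D) (2 * s)).indicator
            (fun _ => ENNReal.ofReal (2 / W.lam * d ^ 2)) x +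
          ENNReal.ofReal (2 * Δ ^ 2) * ENNReal.ofReal (W.b x)) := by
          refine lintegral_mono fun x => ?_
          have h0 := density_nonneg (W := W) hq hs x
          have h0' := density_nonneg (W := W) hq' hs x
          have hi : (Metric.closedBall (0 : Euc D) (2 * s)).indicator
              (fun _ => ENNReal.ofReal (2 / W.lam * d ^ 2)) x =
              ENNReal.ofReal ((Metric.closedBall (0 : Euc D) (2 * s)).indicator
                (fun _ => 2 / W.lam * d ^ 2) x) := by
            by_cases hx : x ∈ Metric.closedBall (0 : Euc D) (2 * s)
            · rw [Set.indicator_of_mem hx, Set.indicator_of_mem hx]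
            · rw [Set.indicator_of_notMem hx, Set.indicator_of_notMem hx, ENNReal.ofReal_zero]
          have hi0 : 0 ≤ (Metric.closedBall (0 : Euc D) (2 * s)).indicator
              (fun _ => 2 / W.lam * d ^ 2) x := Set.indicator_nonneg (fun _ _ => by positivity) _
          rw [hi, ← ENNReal.ofReal_mul (by norm_num), ← ENNReal.ofReal_mul (by positivity),
            ← ENNReal.ofReal_add (by positivity) h0, ← ENNReal.ofReal_add (by positivity) hi0,
            ← ENNReal.ofReal_add (by positivity) (mul_nonneg (by positivity) (W.b_nonneg x))]
          exact ENNReal.ofReal_le_ofReal (density_sq_le hs0 hq hq' hs x)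
      _ = ENNReal.ofReal 2 + ENNReal.ofReal (2 / W.lam * d ^ 2) *
          ENNReal.ofReal (unitBallVol D * (2 * s) ^ D) + ENNReal.ofReal (2 * Δ ^ 2) := by
          rw [lintegral_add_right _ (W.b_cont.measurable.ennreal_ofReal.const_mul _),
            lintegral_add_left (hm'.ennreal_ofReal.const_mul _),
            lintegral_const_mul _ hm'.ennreal_ofReal,
            lintegral_const_mul _ W.b_cont.measurable.ennreal_ofReal, W.b_mass,
            lintegral_density hq' hs,
            lintegral_indicator_const Metric.isClosed_closedBall.measurableSet,
            volume_closedBall_eq _ (by positivity), mul_one, mul_one]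
      _ = ENNReal.ofReal (1 + W.chiSq s) + 1 := by
          rw [← ENNReal.ofReal_mul (by positivity), ← ENNReal.ofReal_add (by norm_num)
            (by positivity), ← ENNReal.ofReal_add (by positivity) (by positivity),
            ← ENNReal.ofReal_one, ← ENNReal.ofReal_add (by rw [hχ]; positivity) zero_le_one, hχ]
          congr 1; ring
  exact (ENNReal.add_le_add_iff_right ENNReal.one_ne_top).mp h2

/-- The squared peak difference, of order `s^(2β)`, is spread over volume of order `s^D`; the mass
correction has one more factor `(2s)^D ≤ 1`. -/
lemma chiSq_le (W : PeakData D) (hs0 : 0 < s) (hs1 : 2 * s ≤ 1) :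
    W.chiSq s ≤ (2 / W.lam * W.slope ^ 2 * unitBallVol D + 2 * W.slope ^ 2 * unitBallVol D ^ 2) *
      (2 * s) ^ (2 * W.β + D) := by
  have hlam := W.lam_pos
  have hκ := W.slope_pos
  have hv := unitBallVol_pos D
  have e : (2 * s) ^ (2 * W.β + D) = ((2 * s) ^ W.β) ^ 2 * (2 * s) ^ D := by
    rw [Real.rpow_add (by positivity), Real.rpow_natCast, mul_comm 2 W.β,
      Real.rpow_mul (by positivity)]
    norm_num
  have h1 : (2 * s) ^ D ≤ 1 := pow_le_one₀ (by positivity) hs1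
  set Y := (2 * s) ^ W.β with hY
  set Z := (2 * s) ^ D with hZ
  have hY0 : 0 < Y := by positivity
  have hZ0 : 0 < Z := by positivity
  rw [chiSq, e, ← hY, ← hZ]
  have h2 : 2 * W.slope ^ 2 * unitBallVol D ^ 2 * Y ^ 2 * Z * Z ≤
      2 * W.slope ^ 2 * unitBallVol D ^ 2 * Y ^ 2 * Z * 1 := by gcongr
  linarith

end PeakData

lemma exists_peakData (hD : 1 ≤ D) {β lam : ℝ} (hβ : 0 < β) (hlam : 0 < lam) :
    ∃ W : PeakData D, W.β = β ∧ W.lam = lam := by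
  have hv := unitBallVol_pos D
  set r := min 1 (1 / (2 * (lam * unitBallVol D))) with hr
  have hr0 : 0 < r := lt_min one_pos (by positivity)
  have hr1 : r ≤ 1 := min_le_left _ _
  obtain ⟨b, hb1, hb2, hb3, hb4, hb5⟩ :=
    exists_low_density hD hr0 (by positivity : 0 < lam / 4)
  refine ⟨⟨lam, β, r, b, hlam, hβ, hr0, hr1, ?_, hb1, hb2, hb3, hb4, hb5⟩, rfl, rfl⟩
  have h1 : r ^ D ≤ r := pow_le_of_le_one hr0.le hr1 (by omega)
  have h2 : r ≤ 1 / (2 * (lam * unitBallVol D)) := min_le_right _ _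
  calc lam * (unitBallVol D * r ^ D) ≤
        lam * (unitBallVol D * (1 / (2 * (lam * unitBallVol D)))) := by
        gcongr; exact h1.trans h2
    _ = 1 / 2 := by field_simp

lemma one_add_pow_le_two {n : ℕ} {χ : ℝ} (hχ0 : 0 ≤ χ) (hχ : n * χ ≤ 1 / 2) :
    (ENNReal.ofReal (1 + χ)) ^ n ≤ 2 := by
  rw [← ENNReal.ofReal_pow (by linarith), ← ENNReal.ofReal_ofNat 2]
  refine ENNReal.ofReal_le_ofReal ?_
  have h1 : (1 + χ) ^ n ≤ Real.exp (n * χ) := by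
    rw [Real.exp_nat_mul]
    exact pow_le_pow_left₀ (by linarith) (by linarith [Real.add_one_le_exp χ]) n
  have h2 : Real.exp (1 / 2) ≤ 2 := by
    have h := Real.exp_one_lt_d9
    have h3 : Real.exp (1 / 2) ^ 2 = Real.exp 1 := by rw [← Real.exp_nat_mul]; norm_num
    nlinarith [Real.exp_pos (1 / 2 : ℝ)]
  exact h1.trans ((Real.exp_le_exp.mpr hχ).trans h2)

lemma edist_le_hausdorffEDist_add {α : Type*} [PseudoEMetricSpace α] (x y : α) (T : Set α) :
    edist x y ≤ Metric.hausdorffEDist {x} T + Metric.hausdorffEDist {y} T := by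
  calc edist x y = Metric.infEDist x {y} := Metric.infEDist_singleton.symm
    _ ≤ Metric.hausdorffEDist {x} {y} :=
        Metric.infEDist_le_hausdorffEDist_of_mem (Set.mem_singleton x)
    _ ≤ Metric.hausdorffEDist {x} T + Metric.hausdorffEDist T {y} :=
        Metric.hausdorffEDist_triangle
    _ = _ := by rw [Metric.hausdorffEDist_comm (s := T)]

/-- No estimator has a better rate than `n^{-1/(2β+D)}`. -/
theorem exists_minimax_lower_bound (hD : 1 ≤ D) {β lam : ℝ} (hβ : 0 < β) (hlam : 0 < lam) :
    ∃ (P : Params) (γ c : ℝ), P.beta = β ∧ 0 < γ ∧ 0 < c ∧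
      ∀ n : ℕ, 1 ≤ n → ∀ T : (Fin n → Euc D) → Set (Euc D),
        ∃ (f : Euc D → ℝ) (C : Set (Euc D)),
          Admissible P lam f ∧ γ ≤ gap f lam P.rc ∧ levelComponents f lam = {C} ∧
          1 / 4 ≤ sampleLaw f n {X | ENNReal.ofReal (c * (n : ℝ) ^ (-(1 / (2 * β + D)))) <
            Metric.hausdorffEDist C (T X)} := by
  obtain ⟨W, rfl, rfl⟩ := exists_peakData hD hβ hlam
  have hκ := W.slope_pos
  have ht := W.halfRadius_pos
  have hv := unitBallVol_pos D
  have hD0 : (0 : ℝ) < D := by exact_mod_cast hD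
  set K := 2 / W.lam * W.slope ^ 2 * unitBallVol D + 2 * W.slope ^ 2 * unitBallVol D ^ 2 with hK
  have hK0 : 0 < K := by positivity
  set p := 2 * W.β + D with hp
  have hp0 : 0 < p := by positivity
  -- The first two entries keep the perturbation inside the peak; the last makes `n` times the
  -- `χ²`-bound at most `1/2`.
  set y := min (min 1 (W.halfRadius / 2)) ((1 / (2 * K)) ^ (1 / p)) with hy
  have hy0 : 0 < y := lt_min (lt_min one_pos (by positivity)) (by positivity)
  have hy1 : y ≤ 1 := (min_le_left _ _).trans (min_le_left _ _)
  have hy2 : y ≤ W.halfRadius / 2 := (min_le_left _ _).trans (min_le_right _ _)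
  have hy3 : y ^ p ≤ 1 / (2 * K) := by
    have := Real.rpow_le_rpow hy0.le (min_le_right _ _ : y ≤ (1 / (2 * K)) ^ (1 / p)) hp0.le
    rwa [← Real.rpow_mul (by positivity), one_div_mul_cancel hp0.ne', Real.rpow_one] at this
  obtain ⟨e, he⟩ := exists_norm_eq_one hD
  -- The two level sets are `y τ / 2` apart, more than twice `y τ / 6`, so one set cannot be within
  -- the latter of both.
  refine ⟨W.params, min (3 * W.lam / 4) (W.slope * (W.halfRadius / 8) ^ W.β), y / 6, rfl,
    lt_min (by positivity) (by positivity), by positivity, ?_⟩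
  intro n hn T
  have hn0 : (0 : ℝ) < n := by exact_mod_cast hn
  have hn1 : (1 : ℝ) ≤ n := by exact_mod_cast hn
  set τ := (n : ℝ) ^ (-(1 / p)) with hτ
  have hτ0 : 0 < τ := by positivity
  have hτ1 : τ ≤ 1 := Real.rpow_le_one_of_one_le_of_nonpos hn1 (by rw [neg_nonpos]; positivity)
  have hτp : τ ^ p = (n : ℝ)⁻¹ := by
    rw [hτ, ← Real.rpow_mul hn0.le, neg_mul, one_div_mul_cancel hp0.ne', Real.rpow_neg_one]
  set s := y * τ / 2 with hs
  have hs0 : 0 < s := by positivity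
  have hyτ : y * τ ≤ y := mul_le_of_le_one_right hy0.le hτ1
  have hs2 : 2 * s = y * τ := by rw [hs]; ring
  have hst : s ≤ W.halfRadius / 4 := by linarith
  have hz : ‖s • e‖ = s := by rw [norm_smul, he, mul_one, Real.norm_of_nonneg hs0.le]
  have hq := isProfile_norm (D := D) hs0.le
  have hq' := isProfile_shifted hs0.le hz
  set q : Euc D → ℝ := fun x => ‖x‖ with hqdef
  set q' : Euc D → ℝ := fun x => max (‖x - s • e‖ / 2) (min ‖x‖ (2 * max 0 (‖x‖ - s))) with hqdef'
  have hA := PeakData.admissible hq hst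
  have hA' := PeakData.admissible hq' hst
  have := hA.isProbabilityMeasure
  have hprob' := hA'.isProbabilityMeasure
  have hχ : n * W.chiSq s ≤ 1 / 2 := by
    have h1 := PeakData.chiSq_le W hs0 (by linarith)
    rw [← hK, ← hp, hs2, Real.mul_rpow hy0.le hτ0.le, hτp] at h1
    calc n * W.chiSq s ≤ n * (K * (1 / (2 * K) * (n : ℝ)⁻¹)) := by
          refine mul_le_mul_of_nonneg_left (h1.trans ?_) hn0.le
          gcongr
      _ = 1 / 2 := by field_simp
  have hχ0 : 0 ≤ W.chiSq s := by
    have := W.lam_pos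
    unfold PeakData.chiSq; positivity
  set E₀ : Set (Fin n → Euc D) :=
    {X | ENNReal.ofReal (y / 6 * τ) < Metric.hausdorffEDist {(0 : Euc D)} (T X)} with hE₀
  set E₁ : Set (Fin n → Euc D) :=
    {X | ENNReal.ofReal (y / 6 * τ) < Metric.hausdorffEDist {s • e} (T X)} with hE₁
  have hE : E₀ ∪ E₁ = Set.univ := by
    refine Set.eq_univ_of_forall fun X => ?_
    by_contra hcon
    simp only [hE₀, hE₁, Set.mem_union, Set.mem_ofPred_eq, not_or, not_lt] at hcon
    have h1 := (edist_le_hausdorffEDist_add 0 (s • e) (T X)).trans (add_le_add hcon.1 hcon.2)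
    rw [edist_dist, dist_zero_left, hz, ← ENNReal.ofReal_add (by positivity) (by positivity),
      ENNReal.ofReal_le_ofReal_iff (by positivity)] at h1
    nlinarith
  have hlaw := PeakData.densityLaw_eq_withDensity hq hq' hst
  rw [hlaw] at hprob'
  have hg : Measurable fun x => ENNReal.ofReal (W.density q' x / W.density q x) :=
    ((PeakData.continuous_density hq').measurable.div
      (PeakData.continuous_density hq).measurable).ennreal_ofReal
  have hsum := one_half_le_add_of_chi_sq (densityLaw (W.density q)) hg (n := n)
    (le_trans (pow_le_pow_left' (PeakData.lintegral_ratio_sq_le hs0.le hq hq' hst) n)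
      (one_add_pow_le_two hχ0 hχ)) hE
  rw [← hlaw] at hsum
  by_cases h0 : 1 / 4 ≤ sampleLaw (W.density q) n E₀
  · exact ⟨W.density q, {0}, hA, PeakData.le_gap hq hst, PeakData.levelComponents_top hq hst, h0⟩
  · refine ⟨W.density q', {s • e}, hA', PeakData.le_gap hq' hst,
      PeakData.levelComponents_top hq' hst, ?_⟩
    by_contra h1
    push Not at h0 h1
    have h2 := hsum.trans_lt (ENNReal.add_lt_add h0 h1)
    have h3 : (1 / 4 : ℝ≥0∞) + 1 / 4 = 1 / 2 := by
      rw [← ENNReal.toReal_eq_toReal_iff' (by finiteness) (by finiteness),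
        ENNReal.toReal_add (by finiteness) (by finiteness)]
      norm_num
    rw [h3] at h2
    exact lt_irrefl _ h2

end LowerBound

end LevelSetDBSCAN

theorem mainTheorem4 :
    -- upper bounds; `C₀` is a universal constant
    (∃ C₀ : ℝ, 0 < C₀ ∧ ∀ (D : ℕ), 1 ≤ D → ∀ (δ : ℝ), 0 < δ → δ < 1 →
      ∀ P : LevelSetDBSCAN.Params,
      -- Hausdorff error
      (∃ Kl Ku : ℝ, 0 < Kl ∧ 0 < Ku ∧
        ∀ (lam : ℝ) (f : LevelSetDBSCAN.Euc D → ℝ), LevelSetDBSCAN.Admissible P lam f →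
        ∀ n k : ℕ, 2 ≤ n → LevelSetDBSCAN.InRange Kl Ku P.beta 2 D n k →
          LevelSetDBSCAN.sampleLaw f n {X | ¬ LevelSetDBSCAN.AllRecovered
            (LevelSetDBSCAN.levelComponents f lam) (LevelSetDBSCAN.estClusters C₀ δ lam k X)
            (LevelSetDBSCAN.errBound C₀ δ lam P D n k)} ≤ ENNReal.ofReal δ) ∧
      -- removal of false clusters
      (∀ γ : ℝ, 0 < γ → ∃ Kl Ku : ℝ, 0 < Kl ∧ 0 < Ku ∧
        ∀ (lam : ℝ) (f : LevelSetDBSCAN.Euc D → ℝ), LevelSetDBSCAN.Admissible P lam f →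
        γ ≤ LevelSetDBSCAN.gap f lam P.rc →
        ∀ n k : ℕ, 2 ≤ n → LevelSetDBSCAN.InRange Kl Ku P.beta 3 D n k →
          LevelSetDBSCAN.sampleLaw f n {X | ¬ LevelSetDBSCAN.NoFalseCluster
            (LevelSetDBSCAN.levelComponents f lam) (LevelSetDBSCAN.prunedClusters C₀ δ lam k X)
            (LevelSetDBSCAN.errBound C₀ δ lam P D n k)} ≤ ENNReal.ofReal δ) ∧
      -- rate for `k ≈ n^{2β/(2β+D)}`, for every true cluster
      (∀ a₁ a₂ : ℝ, 0 < a₁ → 0 < a₂ → ∃ (N : ℕ) (R : ℝ), 0 < R ∧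
        ∀ (lam : ℝ) (f : LevelSetDBSCAN.Euc D → ℝ), LevelSetDBSCAN.Admissible P lam f →
        ∀ n k : ℕ, N ≤ n →
          a₁ * (n : ℝ) ^ (2 * P.beta / (2 * P.beta + D)) ≤ k →
          (k : ℝ) ≤ a₂ * (n : ℝ) ^ (2 * P.beta / (2 * P.beta + D)) →
          LevelSetDBSCAN.sampleLaw f n {X | ¬ LevelSetDBSCAN.AllRecovered
            (LevelSetDBSCAN.levelComponents f lam) (LevelSetDBSCAN.estClusters C₀ δ lam k X)
            (R * Real.log n ^ (1 / P.beta) * (n : ℝ) ^ (-(1 / (2 * P.beta + D))))}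
              ≤ ENNReal.ofReal δ) ∧
      -- rate for `k ≈ n^{2β/(2β+D)}`, for every cluster that survives the pruning
      (∀ γ a₁ a₂ : ℝ, 0 < γ → 0 < a₁ → 0 < a₂ → ∃ (N : ℕ) (R : ℝ), 0 < R ∧
        ∀ (lam : ℝ) (f : LevelSetDBSCAN.Euc D → ℝ), LevelSetDBSCAN.Admissible P lam f →
        γ ≤ LevelSetDBSCAN.gap f lam P.rc →
        ∀ n k : ℕ, N ≤ n →
          a₁ * (n : ℝ) ^ (2 * P.beta / (2 * P.beta + D)) ≤ k →
          (k : ℝ) ≤ a₂ * (n : ℝ) ^ (2 * P.beta / (2 * P.beta + D)) →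
          LevelSetDBSCAN.sampleLaw f n {X | ¬ LevelSetDBSCAN.NoFalseCluster
            (LevelSetDBSCAN.levelComponents f lam) (LevelSetDBSCAN.prunedClusters C₀ δ lam k X)
            (R * Real.log n ^ (1 / P.beta) * (n : ℝ) ^ (-(1 / (2 * P.beta + D))))}
              ≤ ENNReal.ofReal δ)) ∧
    -- the gap is positive for densities vanishing at infinity
    (∀ (D : ℕ), 1 ≤ D → ∀ (P : LevelSetDBSCAN.Params) (lam : ℝ) (f : LevelSetDBSCAN.Euc D → ℝ),
      LevelSetDBSCAN.Admissible P lam f → Tendsto f (cocompact (LevelSetDBSCAN.Euc D)) (𝓝 0) →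
      0 < LevelSetDBSCAN.gap f lam P.rc) ∧
    -- minimax lower bound: no estimator beats the rate `n^{-1/(2β+D)}`
    (∀ (D : ℕ), 1 ≤ D → ∀ (β lam : ℝ), 0 < β → 0 < lam →
      ∃ (P : LevelSetDBSCAN.Params) (γ c : ℝ), P.beta = β ∧ 0 < γ ∧ 0 < c ∧
        ∀ n : ℕ, 1 ≤ n → ∀ T : (Fin n → LevelSetDBSCAN.Euc D) → Set (LevelSetDBSCAN.Euc D),
          ∃ (f : LevelSetDBSCAN.Euc D → ℝ) (C : Set (LevelSetDBSCAN.Euc D)),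
            LevelSetDBSCAN.Admissible P lam f ∧ γ ≤ LevelSetDBSCAN.gap f lam P.rc ∧
            LevelSetDBSCAN.levelComponents f lam = {C} ∧
            1 / 4 ≤ LevelSetDBSCAN.sampleLaw f n {X |
              ENNReal.ofReal (c * (n : ℝ) ^ (-(1 / (2 * β + D)))) <
                Metric.hausdorffEDist C (T X)}) := by
  -- `C₀ = 10` makes `C_{δ,n}⁴` at least `16 (log n + log (2/δ) + 3)`, as the union bound requires.
  refine ⟨⟨10, by norm_num, fun D hD δ hδ hδ1 P => ⟨?_, ?_, ?_, ?_⟩⟩, ?_, ?_⟩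
  · exact LevelSetDBSCAN.exists_allRecovered hD hδ hδ1 P
  · exact fun γ hγ => LevelSetDBSCAN.exists_noFalseCluster hD hδ hδ1 P hγ
  · exact fun a₁ a₂ ha₁ _ => LevelSetDBSCAN.exists_allRecovered_rate hD hδ hδ1 P ha₁
  · exact fun γ a₁ a₂ hγ ha₁ _ => LevelSetDBSCAN.exists_noFalseCluster_rate hD hδ hδ1 P hγ ha₁
  · exact fun D _ P lam f hf h0 => LevelSetDBSCAN.gap_pos hf h0
  · exact fun D hD β lam hβ hlam => LevelSetDBSCAN.exists_minimax_lower_bound hD hβ hlam
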